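/- **Setting.** Let $M>0$ and $|a|\le M$, and put $r_\pm=M\pm\sqrt{M^2-a^2}$, $\Delta=(r-r_+)(r-r_-)$, $\Sigma=r^2+a^2\cos^2\theta$. The Kerr exterior is $\mathbb R_t\times[r_+,\infty)_r\times\mathbb S^2$ (boundary $\mathcal H^+=\{r=r_+\}$ included) with the metric, in Kerr coordinates $(t,r,\theta,\phi)$, $$g=-\Big(1-\tfrac{2Mr}{\Sigma}\Big)dt^2+2\,dt\,dr+\Sigma\,d\theta^2+\tfrac{(r^2+a^2)^2-\Delta a^2\sin^2\theta}{\Sigma}\sin^2\theta\,d\phi^2-2a\sin^2\theta\,dr\,d\phi-\tfrac{4aMr}{\Sigma}\sin^2\theta\,dt\,d\phi .$$ Let $e_3=-\partial_r$, $e_4=\tfrac{2(r^2+a^2)}{\Sigma}\partial_t+\tfrac{\Delta}{\Sigma}\partial_r+\tfrac{2a}{\Sigma}\partial_\phi$ (so $g(e_3,e_4)=-2$), and let $(e_1,e_2)$ be the orthonormal frame of the horizontal distribution $\langle e_3,e_4\rangle^\perp$ given by $$e_1=\tfrac{a^2\sin\theta\cos\theta}{\Sigma}\partial_t+\tfrac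 r\Sigma\partial_\theta+\tfrac{a\cos\theta}{\Sigma\sin\theta}\partial_\phi,\qquad e_2=\tfrac{ar\sin\theta}{\Sigma}\partial_t-\tfrac{a\cos\theta}{\Sigma}\partial_\theta+\tfrac{r}{\Sigma\sin\theta}\partial_\phi ,$$ with $\varepsilon_{12}=1$. Horizontal one-forms are one-forms annihilating $e_3,e_4$; $\slashed\nabla$ is the connection induced on them by the Levi-Civita connection $\nabla$ (by projection), $\slashed{\mathrm{div}}\,\varsigma=\sum_A(\slashed\nabla_A\varsigma)_A$, $\slashed{\mathrm{curl}}\,\varsigma=(\slashed\nabla_1\varsigma)_2-(\slashed\nabla_2\varsigma)_1$, ${}^\star\varsigma=(\varsigma_2,-\varsigma_1)$, and norms are taken with respect to $g$. Let $\chi_{AB}=g(\nabla_Ae_4,e_B)$, $\underline\chi_{AB}=g(\nabla_Ae_3,e_B)$, $\nabla_4e_4=\hat\omega e_4$, and $$\mathfrak T(\alpha)_A=\tfrac12\Sigma\big((\slashed\nabla_3\alpha)_A+\underline\chi_{AB}\alpha_B\big),\qquad \underline{\mathfrak T}(\underline\alpha)_A=\tfrac12\Sigma\big((\slashed\nabla_4\underline\alpha)_A+\chi_{AB}\underline\alpha_B+\hat\omega\,\underline\alpha_A\big).$$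 *Time function.* Let $\iota,\zeta:\mathbb R\to[0,1]$ be smooth with $\iota=1$ for $r\le\frac{17M}8$, $\iota=0$ for $r\ge\frac{9M}4$, $\zeta=0$ for $r\le3M$, $\zeta=1$ for $r\ge4M$, and such that $w:=\frac{r^2+a^2}\Delta-\iota\big(\frac{r^2+a^2}\Delta-1\big)$ satisfies $w>0$ and $2-(1-\frac{2Mr}\Sigma)w>0$ for $r>r_+$. Put $\tilde t^*=t-\int_{9M/4}^r\big[(1-\iota)\frac{s^2+a^2}{\Delta(s)}+\iota\big]ds-\zeta(r)\big(r+2M\log r-\frac{3M^2}r\big)$, $\Sigma_0=\{\tilde t^*=0\}$, $\mathbb S^2_{\tau,r_+}=\{\tilde t^*=\tau,\ r=r_+\}$, $d\Omega=\sin\theta\,d\theta\,d\phi$. $L^2(\mathbb S^2_{0,r_+})$ is taken with respect to the induced area form rescaled to total mass $4\pi$. *Modified solutions.* Let $c=\frac14\Sigma[(\mathrm{tr}\underline\chi)^2-(\varepsilon\cdot\underline\chi)^2]$ and $d=\frac12\Sigma(\varepsilon\cdot\underline\chi)(\mathrm{tr}\underline\chi)$, with $\varepsilon\cdot\underline\chi=\underline\chi_{12}-\underline\chi_{21}$.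 A *modified solution* is a quadruple $\mathfrak S=(\alpha,\underline\alpha,\hat\rho,\hat\sigma)$ of horizontal one-forms $\alpha,\underline\alpha$ and functions $\hat\rho,\hat\sigma$, smooth on $\{\tilde t^*\ge0\}$ up to and including $\mathcal H^+$ and $\Sigma_0$, that satisfies there $$\begin{aligned} e_3\hat\sigma&=\Sigma d\,\slashed{\mathrm{div}}\,\underline\alpha-\Sigma c\,\slashed{\mathrm{curl}}\,\underline\alpha, & e_3\hat\rho&=-\Sigma c\,\slashed{\mathrm{div}}\,\underline\alpha-\Sigma d\,\slashed{\mathrm{curl}}\,\underline\alpha,\\ e_4\hat\sigma&=-d\,\slashed{\mathrm{div}}(\Sigma\alpha)-c\,\slashed{\mathrm{curl}}(\Sigma\alpha), & e_4\hat\rho&=c\,\slashed{\mathrm{div}}(\Sigma\alpha)-d\,\slashed{\mathrm{curl}}(\Sigma\alpha),\\ \slashed\nabla\hat\sigma&=-d\,(\mathfrak T(\alpha)-\underline{\mathfrak T}(\underline\alpha))-c\,({}^\star\mathfrak T(\alpha)+{}^\star\underline{\mathfrak T}(\underline\alpha)), & \slashed\nabla\hat\rho&=c\,(\mathfrak T(\alpha)-\underline{\mathfrak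 T}(\underline\alpha))-d\,({}^\star\mathfrak T(\alpha)+{}^\star\underline{\mathfrak T}(\underline\alpha)). \end{aligned}$$ Its seed data are $\alpha|_{\Sigma_0},\underline\alpha|_{\Sigma_0},\hat\rho|_{\mathbb S^2_{0,r_+}},\hat\sigma|_{\mathbb S^2_{0,r_+}}$. For $\mathfrak q_1,\mathfrak q_2\in\mathbb R$, $\mathfrak S_{\mathfrak q_1,\mathfrak q_2}=(0,0,\mathfrak q_1,\mathfrak q_2)$ is the modified stationary solution. Finally $$\mathbb E_{\mathcal H^+}[r^2\alpha](\tau_1,\tau_2)=\int_{\tau_1}^{\tau_2}\int_{\mathbb S^2_{s,r_+}}\big(|r^2\alpha|^2+|\slashed\nabla(r^2\alpha)|^2+|\slashed\nabla_4(r^2\alpha)|^2\big)\,d\Omega\,ds .$$ **Lemma.** Let $M>0$ and $p_\alpha>0$. (0) For all $|a|\le M$, the constant $I_{a,M}:=\int_{\mathbb S^2}\frac{1-(a/r_+)^2\cos^2\theta}{1+(a/r_+)^2\cos^2\theta}\,d\Omega$ is nonzero; it equals $4\pi\Big(\frac{2\arctan(a/r_+)}{a/r_+}-1\Big)$ if $a\ne0$,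 and $4\pi$ if $a=0$. There is a constant $C=C(M,p_\alpha)>0$ such that, for every $|a|\le M$ and all $\iota,\zeta$ as above, there are real-valued functions $\mathfrak q_1,\mathfrak q_2$ of the seed data, depending only on the restriction of $(\alpha,\hat\rho,\hat\sigma)$ to $\mathbb S^2_{0,r_+}$, with the following property. Let $\mathbb D\ge0$ be any functional of the seed data, and let $\mathfrak S$ be a modified solution such that $$\lim_{\tau\to\infty}\int_{\mathbb S^2_{\tau,r_+}}\big(|\mathfrak T(\alpha)|^2+|\underline{\mathfrak T}(\underline\alpha)|^2\big)d\Omega=0,\qquad \mathbb E_{\mathcal H^+}[r^2\alpha](\tau,\infty)\le\frac{\mathbb D}{(1+\tau)^{1+p_\alpha}}\quad\text{for all }\tau\ge0 ,$$ where $\mathbb D$ is evaluated on the seed data of $\mathfrak S$. Then: (1) for all $\tau\ge0$, $$\Big|\int_{\mathbb S^2_{\tau,r_+}}\hat\rho\,d\Omega\Big|^2+\Big|\int_{\mathbb S^2_{\tau,r_+}}\hat\sigma\,d\Omega\Big|^2\le C\Big(\|\hat\rho\|^2_{L^2(\mathbb S^2_{0,r_+})}+\|\hat\sigma\|^2_{L^2(\mathbb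 S^2_{0,r_+})}+\mathbb D\Big);$$ (2) with $\mathfrak q_1,\mathfrak q_2$ evaluated on the seed data of $\mathfrak S$, the normalised solution $\widetilde{\mathfrak S}=\mathfrak S-\mathfrak S_{\mathfrak q_1,\mathfrak q_2}$ satisfies, for all $\tau\ge0$, $$\Big|\int_{\mathbb S^2_{\tau,r_+}}\hat\rho[\widetilde{\mathfrak S}]\,d\Omega\Big|^2+\Big|\int_{\mathbb S^2_{\tau,r_+}}\hat\sigma[\widetilde{\mathfrak S}]\,d\Omega\Big|^2\le C\,\frac{\mathbb D}{(1+\tau)^{p_\alpha}} .$$ -/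

import Mathlib

open scoped ContDiff NNReal ENNReal Topology

namespace KerrMaxwell

noncomputable section

/-! ## The Kerr exterior in Kerr coordinates

Vectors of `R4` serve in two ways: as Kerr coordinates `q = (t, r, θ, φ)` (ingoing coordinates, regular
at the horizon), and as points `p = (t, x, y, z)` of the global chart of the exterior in which
`(x, y, z) = r (sin θ cos φ, sin θ sin φ, cos θ)`. The global chart identifies the manifold with boundary
`ℝ × [r₊, ∞) × S²` with `{p | r₊ ≤ |(x, y, z)|}`; it has no singularity on the axis. -/

abbrev R4 : Type := Fin 4 → ℝ

/-- A field of spacetime covectors. -/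
abbrev OneForm : Type := R4 → R4 →L[ℝ] ℝ

def rPlus (a M : ℝ) : ℝ := M + Real.sqrt (M ^ 2 - a ^ 2)

def rMinus (a M : ℝ) : ℝ := M - Real.sqrt (M ^ 2 - a ^ 2)

/-- `Δ(r) = (r - r₊)(r - r₋)`. -/
def Del (a M r : ℝ) : ℝ := (r - rPlus a M) * (r - rMinus a M)

/-- `Σ(r, θ) = r² + a² cos² θ`, as a function of the Kerr coordinates. -/
def Sig (a : ℝ) (q : R4) : ℝ := q 1 ^ 2 + a ^ 2 * Real.cos (q 2) ^ 2

/-- The components of the Kerr metric in the Kerr coordinates `(t, r, θ, φ)`. -/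
def kerrMetric (a M : ℝ) (q : R4) : Matrix (Fin 4) (Fin 4) ℝ :=
  !![-(1 - 2 * M * q 1 / Sig a q), 1, 0, -(2 * a * M * q 1 / Sig a q) * Real.sin (q 2) ^ 2;
     1, 0, 0, -a * Real.sin (q 2) ^ 2;
     0, 0, Sig a q, 0;
     -(2 * a * M * q 1 / Sig a q) * Real.sin (q 2) ^ 2, -a * Real.sin (q 2) ^ 2, 0,
       ((q 1 ^ 2 + a ^ 2) ^ 2 - Del a M (q 1) * a ^ 2 * Real.sin (q 2) ^ 2) / Sig a q
         * Real.sin (q 2) ^ 2]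

/-- `g(u, v)` at the point with Kerr coordinates `q`. -/
def kerrInner (a M : ℝ) (q u v : R4) : ℝ := dotProduct u ((kerrMetric a M q).mulVec v)

/-- The coordinate map from Kerr coordinates to the global chart. -/
def chart (q : R4) : R4 :=
  ![q 0, q 1 * Real.sin (q 2) * Real.cos (q 3), q 1 * Real.sin (q 2) * Real.sin (q 3),
    q 1 * Real.cos (q 2)]

/-- The function `r` in the global chart. -/
def radius (p : R4) : ℝ := Real.sqrt (p 1 ^ 2 + p 2 ^ 2 + p 3 ^ 2)

/-- A covector field of the global chart, expressed in Kerr coordinates. -/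
def pullback (ς : OneForm) : OneForm := fun q => (ς (chart q)).comp (fderiv ℝ chart q)

/-! ## The algebraically special frame

`e₃ = -∂_r`, `e₄ = 2 (r² + a²) / Σ ∂_t + Δ / Σ ∂_r + 2 a / Σ ∂_φ` in Kerr coordinates; in Boyer–Lindquist
coordinates these are `(r² + a²) / Δ ∂_t - ∂_r + a / Δ ∂_φ` and
`(r² + a²) / Σ ∂_t + Δ / Σ ∂_r + a / Σ ∂_φ`. The pair `(e₁, e₂)` is an orthonormal basis, off the axis,
of the orthogonal complement of `e₃` and `e₄` (the horizontal distribution). -/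

def e3 (_q : R4) : R4 := ![0, -1, 0, 0]

def e4 (a M : ℝ) (q : R4) : R4 :=
  ![2 * (q 1 ^ 2 + a ^ 2) / Sig a q, Del a M (q 1) / Sig a q, 0, 2 * a / Sig a q]

def frame (a : ℝ) (A : Fin 2) (q : R4) : R4 :=
  if A = 0 then
    ![a ^ 2 * Real.sin (q 2) * Real.cos (q 2) / Sig a q, 0, q 1 / Sig a q,
      a * Real.cos (q 2) / (Sig a q * Real.sin (q 2))]
  else
    ![a * q 1 * Real.sin (q 2) / Sig a q, 0, -(a * Real.cos (q 2)) / Sig a q,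
      q 1 / (Sig a q * Real.sin (q 2))]

/-- `g(∇_X Y, Z)` at `q` for the Levi-Civita connection of the Kerr metric, with `X`, `Z` vectors and `Y`
a vector field: the derivative of the components of `Y` plus the Christoffel symbols of the first kind. -/
def leviCivita (a M : ℝ) (q X : R4) (Y : R4 → R4) (Z : R4) : ℝ :=
  kerrInner a M q (fderiv ℝ Y q X) Z
    + (1 / 2) * (fderiv ℝ (fun q' => kerrInner a M q' (Y q) Z) q X
        + fderiv ℝ (fun q' => kerrInner a M q' X Z) q (Y q)
        - fderiv ℝ (fun q' => kerrInner a M q' X (Y q)) q Z)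

/-- `χ_{AB} = g(∇_A e₄, e_B)`. -/
def chi (a M : ℝ) (q : R4) (A B : Fin 2) : ℝ :=
  leviCivita a M q (frame a A q) (e4 a M) (frame a B q)

/-- `χ̲_{AB} = g(∇_A e₃, e_B)`. -/
def chiBar (a M : ℝ) (q : R4) (A B : Fin 2) : ℝ :=
  leviCivita a M q (frame a A q) e3 (frame a B q)

/-- `ω̂`, defined by `∇₄ e₄ = ω̂ e₄`; recall that `g(e₃, e₄) = -2`. -/
def omegaHat (a M : ℝ) (q : R4) : ℝ :=
  -(1 / 2) * leviCivita a M q (e4 a M q) (e4 a M) (e3 q)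

/-- `tr χ̲`. -/
def trChiBar (a M : ℝ) (q : R4) : ℝ := chiBar a M q 0 0 + chiBar a M q 1 1

/-- `ε · χ̲ = ε^{AB} χ̲_{AB}`, with `ε(e₁, e₂) = 1`. -/
def epsChiBar (a M : ℝ) (q : R4) : ℝ := chiBar a M q 0 1 - chiBar a M q 1 0

/-! ## Horizontal one-forms

A horizontal one-form is represented by its canonical extension, a spacetime one-form that annihilates
`e₃` and `e₄`. The horizontal connection is the projection of the Levi-Civita connection. Below, `ς` is
given in Kerr coordinates. -/

/-- The component `ς_A = ς(e_A)`. -/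
def comp (a : ℝ) (ς : OneForm) (A : Fin 2) (q : R4) : ℝ := ς q (frame a A q)

/-- `(∇̸_X ς)(e_B) = X(ς(e_B)) - ∑_C g(∇_X e_B, e_C) ς(e_C)`. -/
def nablaH (a M : ℝ) (ς : OneForm) (q X : R4) (B : Fin 2) : ℝ :=
  fderiv ℝ (comp a ς B) q X
    - ∑ C : Fin 2, leviCivita a M q X (frame a B) (frame a C q) * comp a ς C q

def divH (a M : ℝ) (ς : OneForm) (q : R4) : ℝ := ∑ A : Fin 2, nablaH a M ς q (frame a A q) A

/-- `ε^{AB} (∇̸_A ς)_B`. -/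
def curlH (a M : ℝ) (ς : OneForm) (q : R4) : ℝ :=
  nablaH a M ς q (frame a 0 q) 1 - nablaH a M ς q (frame a 1 q) 0

/-- The horizontal Hodge dual `(⋆v)_A = ε_A^B v_B`, on components. -/
def hodge (v : Fin 2 → ℝ) : Fin 2 → ℝ := ![v 1, -v 0]

/-- The pointwise squared norms of `ς`, `∇̸ς` and `∇̸₄ς`. -/
def normSq (a : ℝ) (ς : OneForm) (q : R4) : ℝ := ∑ A : Fin 2, comp a ς A q ^ 2

def nablaNormSq (a M : ℝ) (ς : OneForm) (q : R4) : ℝ :=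
  ∑ A : Fin 2, ∑ B : Fin 2, nablaH a M ς q (frame a A q) B ^ 2

def nabla4NormSq (a M : ℝ) (ς : OneForm) (q : R4) : ℝ :=
  ∑ B : Fin 2, nablaH a M ς q (e4 a M q) B ^ 2

/-- The components of `𝔗(α) = ½ Σ (∇̸₃ α + χ̲^♯₂ · α)`. -/
def fT (a M : ℝ) (α : OneForm) (q : R4) (A : Fin 2) : ℝ :=
  (1 / 2) * Sig a q * (nablaH a M α q (e3 q) A + ∑ B : Fin 2, chiBar a M q A B * comp a α B q)

/-- The components of `𝔗̲(α̲) = ½ Σ (∇̸₄ α̲ + χ^♯₂ · α̲ + ω̂ α̲)`. -/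
def fTBar (a M : ℝ) (αb : OneForm) (q : R4) (A : Fin 2) : ℝ :=
  (1 / 2) * Sig a q * (nablaH a M αb q (e4 a M q) A + ∑ B : Fin 2, chi a M q A B * comp a αb B q
    + omegaHat a M q * comp a αb A q)

/-! ## Hyperboloidal time, the horizon spheres and the initial hypersurface -/

/-- The cut-off `ι` used to define the Kerr-star time. -/
structure IsStarCutoff (a M : ℝ) (ι : ℝ → ℝ) : Prop where
  smooth : ContDiff ℝ ∞ ι
  mem_Icc : ∀ r, ι r ∈ Set.Icc (0 : ℝ) 1
  eq_one : ∀ r, r ≤ 17 * M / 8 → ι r = 1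
  eq_zero : ∀ r, 9 * M / 4 ≤ r → ι r = 0
  pos : ∀ r, rPlus a M < r →
    0 < (r ^ 2 + a ^ 2) / Del a M r - ι r * ((r ^ 2 + a ^ 2) / Del a M r - 1)
  spacelike : ∀ r θ, rPlus a M < r →
    0 < 2 - (1 - 2 * M * r / (r ^ 2 + a ^ 2 * Real.cos θ ^ 2))
      * ((r ^ 2 + a ^ 2) / Del a M r - ι r * ((r ^ 2 + a ^ 2) / Del a M r - 1))

/-- The cut-off `ζ` used to define the hyperboloidal time. -/
structure IsHyperboloidalCutoff (M : ℝ) (ζ : ℝ → ℝ) : Prop where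
  smooth : ContDiff ℝ ∞ ζ
  mem_Icc : ∀ r, ζ r ∈ Set.Icc (0 : ℝ) 1
  eq_zero : ∀ r, r ≤ 3 * M → ζ r = 0
  eq_one : ∀ r, 4 * M ≤ r → ζ r = 1

/-- The height function `h` with `t̃* = t - h(r)`. The integral gives the Kerr-star time, the other term
makes the level sets of `t̃*` hyperboloidal. -/
def height (a M : ℝ) (ι ζ : ℝ → ℝ) (r : ℝ) : ℝ :=
  (∫ s in (9 * M / 4)..r, ((1 - ι s) * ((s ^ 2 + a ^ 2) / Del a M s) + ι s))
    + ζ r * (r + 2 * M * Real.log r - 3 * M ^ 2 / r)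

/-- The future `{t̃* ≥ 0}` in the exterior (horizon included) of the initial hypersurface, in the global
chart. -/
def futureRegion (a M : ℝ) (ι ζ : ℝ → ℝ) : Set R4 :=
  {p | rPlus a M ≤ radius p ∧ 0 ≤ p 0 - height a M ι ζ (radius p)}

/-- The initial hypersurface `Σ₀ = {t̃* = 0}`, in the global chart. -/
def initialSurface (a M : ℝ) (ι ζ : ℝ → ℝ) : Set R4 :=
  {p | rPlus a M ≤ radius p ∧ p 0 - height a M ι ζ (radius p) = 0}

/-- The initial horizon sphere `Σ₀ ∩ {r = r₊}`, in the global chart. -/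
def initialSphere (a M : ℝ) (ι ζ : ℝ → ℝ) : Set R4 :=
  {p | radius p = rPlus a M ∧ p 0 - height a M ι ζ (radius p) = 0}

/-- The Kerr coordinates of the points of the horizon sphere `{t̃* = τ, r = r₊}`. -/
def horizonPoint (a M : ℝ) (ι ζ : ℝ → ℝ) (τ θ φ : ℝ) : R4 :=
  ![τ + height a M ι ζ (rPlus a M), rPlus a M, θ, φ]

/-- `∫ f dΩ`, with `dΩ = sin θ dθ dφ`. -/
def sphereIntegral (f : ℝ → ℝ → ℝ) : ℝ :=
  ∫ φ in (0 : ℝ)..2 * Real.pi, ∫ θ in (0 : ℝ)..Real.pi, f θ φ * Real.sin θ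

/-- The area density `√(det)` of the metric induced by the Kerr metric on the spheres of constant
`t̃*` and `r`, in the coordinates `(θ, φ)`. -/
def areaDensity (a M : ℝ) (q : R4) : ℝ :=
  Real.sqrt (kerrMetric a M q 2 2 * kerrMetric a M q 3 3 - kerrMetric a M q 2 3 ^ 2)

/-- The squared `L²` norm on the horizon sphere at time `τ` of a function of the Kerr coordinates, for
the induced area form rescaled to total mass `4π`. -/
def horizonL2Sq (a M : ℝ) (ι ζ : ℝ → ℝ) (f : R4 → ℝ) (τ : ℝ) : ℝ :=
  4 * Real.pi
    / (∫ φ in (0 : ℝ)..2 * Real.pi, ∫ θ in (0 : ℝ)..Real.pi,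
        areaDensity a M (horizonPoint a M ι ζ τ θ φ))
    * ∫ φ in (0 : ℝ)..2 * Real.pi, ∫ θ in (0 : ℝ)..Real.pi,
        f (horizonPoint a M ι ζ τ θ φ) ^ 2 * areaDensity a M (horizonPoint a M ι ζ τ θ φ)

/-- The horizon energy flux
`∫_{τ₁}^{τ₂} ∫_{S²} (|ς|² + |∇̸ς|² + |∇̸₄ς|²) dΩ dt̃*`, for `ς` given in Kerr coordinates. -/
def horizonFlux (a M : ℝ) (ι ζ : ℝ → ℝ) (ς : OneForm) (τ₁ : ℝ) (τ₂ : EReal) : ℝ≥0∞ :=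
  ∫⁻ s in {s : ℝ | τ₁ < s ∧ (s : EReal) < τ₂}, ENNReal.ofReal (sphereIntegral fun θ φ =>
    normSq a ς (horizonPoint a M ι ζ s θ φ)
      + nablaNormSq a M ς (horizonPoint a M ι ζ s θ φ)
      + nabla4NormSq a M ς (horizonPoint a M ι ζ s θ φ))

/-! ## The modified Maxwell equations -/

/-- A quadruple `(α, α̲, ρ̂, σ̂)` of fields in the global chart. -/
@[ext]
structure Fields where
  al : OneForm
  alb : OneForm
  rho : R4 → ℝ
  sigma : R4 → ℝ

instance : Sub Fields :=
  ⟨fun S S' => ⟨S.al - S'.al, S.alb - S'.alb, S.rho - S'.rho, S.sigma - S'.sigma⟩⟩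

/-- The modified stationary solution with charges `q₁`, `q₂`. -/
def stationary (q₁ q₂ : ℝ) : Fields := ⟨0, 0, fun _ => q₁, fun _ => q₂⟩

/-- `¼ Σ ((tr χ̲)² - (ε · χ̲)²)`. -/
def coefC (a M : ℝ) (q : R4) : ℝ :=
  (1 / 4) * Sig a q * (trChiBar a M q ^ 2 - epsChiBar a M q ^ 2)

/-- `½ Σ (ε · χ̲) (tr χ̲)`. -/
def coefD (a M : ℝ) (q : R4) : ℝ := (1 / 2) * Sig a q * (epsChiBar a M q * trChiBar a M q)

/-- The modified Maxwell equations at the point with Kerr coordinates `q` (off the axis), for one-forms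
`α`, `α̲` and functions `ρ̂`, `σ̂` given in Kerr coordinates. -/
structure ModifiedMaxwellAt (a M : ℝ) (α αb : OneForm) (ρ σ : R4 → ℝ) (q : R4) : Prop where
  e3_sigma : fderiv ℝ σ q (e3 q)
    = Sig a q * coefD a M q * divH a M αb q - Sig a q * coefC a M q * curlH a M αb q
  e3_rho : fderiv ℝ ρ q (e3 q)
    = -(Sig a q * coefC a M q * divH a M αb q) - Sig a q * coefD a M q * curlH a M αb q
  e4_sigma : fderiv ℝ σ q (e4 a M q)
    = -(coefD a M q * divH a M (fun q' => Sig a q' • α q') q)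
      - coefC a M q * curlH a M (fun q' => Sig a q' • α q') q
  e4_rho : fderiv ℝ ρ q (e4 a M q)
    = coefC a M q * divH a M (fun q' => Sig a q' • α q') q
      - coefD a M q * curlH a M (fun q' => Sig a q' • α q') q
  eA_sigma : ∀ A : Fin 2, fderiv ℝ σ q (frame a A q)
    = -(coefD a M q * (fT a M α q A - fTBar a M αb q A))
      - coefC a M q * (hodge (fT a M α q) A + hodge (fTBar a M αb q) A)
  eA_rho : ∀ A : Fin 2, fderiv ℝ ρ q (frame a A q)
    = coefC a M q * (fT a M α q A - fTBar a M αb q A)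
      - coefD a M q * (hodge (fT a M α q) A + hodge (fTBar a M αb q) A)

/-- Smooth solutions of the modified Maxwell equations on the future of the initial hypersurface.
Smoothness on this closed region means smoothness on an open neighbourhood of it (in the global chart).
The horizontality conditions and the equations are imposed off the axis; they extend to the axis in the
frame-independent sense by continuity. -/
structure IsModifiedSolution (a M : ℝ) (ι ζ : ℝ → ℝ) (S : Fields) : Prop where
  smooth : ∃ U : Set R4, IsOpen U ∧ futureRegion a M ι ζ ⊆ U ∧ ContDiffOn ℝ ∞ S.al U ∧
    ContDiffOn ℝ ∞ S.alb U ∧ ContDiffOn ℝ ∞ S.rho U ∧ ContDiffOn ℝ ∞ S.sigma U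
  horizontal : ∀ q : R4, rPlus a M ≤ q 1 → 0 ≤ q 0 - height a M ι ζ (q 1) →
    q 2 ∈ Set.Ioo 0 Real.pi →
      pullback S.al q (e3 q) = 0 ∧ pullback S.al q (e4 a M q) = 0 ∧
      pullback S.alb q (e3 q) = 0 ∧ pullback S.alb q (e4 a M q) = 0
  maxwell : ∀ q : R4, rPlus a M ≤ q 1 → 0 ≤ q 0 - height a M ι ζ (q 1) →
    q 2 ∈ Set.Ioo 0 Real.pi →
      ModifiedMaxwellAt a M (pullback S.al) (pullback S.alb) (S.rho ∘ chart) (S.sigma ∘ chart) q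

/-! ## Seed initial data -/

/-- The part of the seed data that lives on the initial horizon sphere: `α`, `ρ̂` and `σ̂`. -/
structure HorizonSeed (a M : ℝ) (ι ζ : ℝ → ℝ) where
  al : initialSphere a M ι ζ → R4 →L[ℝ] ℝ
  rho : initialSphere a M ι ζ → ℝ
  sigma : initialSphere a M ι ζ → ℝ

/-- Seed data: `α`, `α̲` along `Σ₀` and `ρ̂`, `σ̂` on the initial horizon sphere. -/
structure SeedData (a M : ℝ) (ι ζ : ℝ → ℝ) where
  al : initialSurface a M ι ζ → R4 →L[ℝ] ℝ
  alb : initialSurface a M ι ζ → R4 →L[ℝ] ℝ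
  rho : initialSphere a M ι ζ → ℝ
  sigma : initialSphere a M ι ζ → ℝ

/-- The seed data of a quadruple of fields. -/
def Fields.seed (S : Fields) (a M : ℝ) (ι ζ : ℝ → ℝ) : SeedData a M ι ζ where
  al p := S.al p
  alb p := S.alb p
  rho p := S.rho p
  sigma p := S.sigma p

/-- The restriction of seed data to the initial horizon sphere. -/
def SeedData.onHorizon {a M : ℝ} {ι ζ : ℝ → ℝ} (D : SeedData a M ι ζ) : HorizonSeed a M ι ζ where
  al p := D.al ⟨p.1, p.2.1.ge, p.2.2⟩
  rho := D.rho
  sigma := D.sigma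

/-! ## The quantities in the statement -/

/-- `∫ ρ̂ dΩ` over the horizon sphere at time `τ`. -/
def rhoMode (a M : ℝ) (ι ζ : ℝ → ℝ) (S : Fields) (τ : ℝ) : ℝ :=
  sphereIntegral fun θ φ => S.rho (chart (horizonPoint a M ι ζ τ θ φ))

/-- `∫ σ̂ dΩ` over the horizon sphere at time `τ`. -/
def sigmaMode (a M : ℝ) (ι ζ : ℝ → ℝ) (S : Fields) (τ : ℝ) : ℝ :=
  sphereIntegral fun θ φ => S.sigma (chart (horizonPoint a M ι ζ τ θ φ))

/-- `∫ (|𝔗(α)|² + |𝔗̲(α̲)|²) dΩ` over the horizon sphere at time `τ`. -/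
def transversalL2Sq (a M : ℝ) (ι ζ : ℝ → ℝ) (S : Fields) (τ : ℝ) : ℝ :=
  sphereIntegral fun θ φ =>
    (∑ A : Fin 2, fT a M (pullback S.al) (horizonPoint a M ι ζ τ θ φ) A ^ 2)
      + ∑ A : Fin 2, fTBar a M (pullback S.alb) (horizonPoint a M ι ζ τ θ φ) A ^ 2

/-- The horizon energy flux of `r² α` between the times `τ₁` and `τ₂`. -/
def alphaFlux (a M : ℝ) (ι ζ : ℝ → ℝ) (S : Fields) (τ₁ : ℝ) (τ₂ : EReal) : ℝ≥0∞ :=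
  horizonFlux a M ι ζ (fun q => q 1 ^ 2 • pullback S.al q) τ₁ τ₂

/-- `I_{a,M}`, the integral of `(1 - γ² cos² θ) / (1 + γ² cos² θ)` over the sphere, `γ = a / r₊`. -/
def chargeConstant (a M : ℝ) : ℝ :=
  sphereIntegral fun θ _ =>
    (1 - (a / rPlus a M) ^ 2 * Real.cos θ ^ 2) / (1 + (a / rPlus a M) ^ 2 * Real.cos θ ^ 2)

end

end KerrMaxwell

namespace KerrMaxwell

open MeasureTheory Set Filter

/-! ## Integrals over the sphere -/

/-! On the horizon Δ = 0, so e₄ = (2/Σ)((r² + a²)∂_t + a∂_φ) is tangent to the horizon, and e₁, e₂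
are tangent too: only derivatives in t, θ, φ occur. The coefficients satisfy c² + d² = 1, so the two
e₄ equations can be inverted (`genDeriv_eqs`): c e₄ρ̂ - d e₄σ̂ = div(Σα) and c e₄σ̂ + d e₄ρ̂ =
-curl(Σα).

Convergence of the means. The φ-derivative integrates to zero over a sphere, so d/dτ ∫ρ̂ = ∫ Σ/(2(r²
+ a²)) e₄ρ̂. By Cauchy–Schwarz the square of this is bounded by the sphere integral of |div(Σα)|² +
|curl(Σα)|², hence by the energy density of r²α (`divSig_sq_add_curlSig_sq_le`). Integrating over
dyadic time intervals, the decay (1 + τ)^(-1-p) of the flux gives |∫ρ̂(T) - ∫ρ̂(τ)| ≲ √D (1 +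
τ)^(-p/2) for T ≥ τ (`abs_sub_le_of_energy_decay`, `abs_sphereIntegral_sub_le`). With τ = 0 this
yields (1).

Identification of the limit. Put T = α(∂_θ) and W = α(a sin θ ∂_t + (sin θ)⁻¹ ∂_φ). Then sin θ
div(Σα) = ∂_θ(sin θ T) + ∂_φ W + a sin²θ ∂_t W, so the first inverted equation is a conservation
law: Q = ∫ [2(r² + a²)/Σ (cρ̂ - dσ̂) - a sin θ W] dΩ does not depend on τ
(`sphereIntegral_chargeDensity_eq`). The weight of ρ̂ has mean 2 and that of σ̂ has mean 0.
Integrating by parts in θ therefore writes Q - 2∫ρ̂ in terms of ∂_θρ̂, ∂_θσ̂ and W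
(`sphereIntegral_chargeDensity_sub`). The gradients tend to zero in L² because |𝔗(α)|² + |𝔗̲(α̲)|² =
½(|∇̸ρ̂|² + |∇̸σ̂|²) (`transversalL2Sq_eq`), and W is small at arbitrarily late times because the
flux is finite. Thus ∫ρ̂ → Q/2, at the rate above (`abs_charge_sub_le`). As Q is read off at τ = 0
from α, ρ̂, σ̂ on the initial sphere, 𝔮₁ = Q/(8π) proves (2). The equations are invariant under (ρ̂,
σ̂; T, W) ↦ (σ̂, -ρ̂; -W, T), which treats σ̂.

The frame (e₁, e₂) is singular on the axis, whereas T and W are smooth there. All integrands are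
therefore rewritten in terms of T, W and their derivatives, which makes them continuous on whole
spheres. Part (0) is an independent explicit integral. -/

theorem sphereIntegral_congr {f g : ℝ → ℝ → ℝ}
    (h : ∀ θ ∈ Ioo 0 Real.pi, ∀ φ, f θ φ = g θ φ) : sphereIntegral f = sphereIntegral g := by
  unfold sphereIntegral
  refine intervalIntegral.integral_congr fun φ _ => intervalIntegral.integral_congr fun θ hθ => ?_
  rw [uIcc_of_le Real.pi_pos.le] at hθ
  -- At the poles both integrands vanish with sin θ, so identities of integrands are needed only off
  -- the axis.
  rcases hθ.1.eq_or_lt with h0 | h0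
  · simp [← h0]
  rcases hθ.2.eq_or_lt with h1 | h1
  · simp [h1]
  simp only [h θ ⟨h0, h1⟩ φ]

theorem continuous_integrand {f : ℝ → ℝ → ℝ} (hf : Continuous fun x : ℝ × ℝ => f x.1 x.2) :
    Continuous fun x : ℝ × ℝ => f x.2 x.1 * Real.sin x.2 :=
  (hf.comp continuous_swap).mul (Real.continuous_sin.comp continuous_snd)

theorem intervalIntegrable_inner {f : ℝ → ℝ → ℝ} (hf : Continuous fun x : ℝ × ℝ => f x.1 x.2)
    (φ : ℝ) : IntervalIntegrable (fun θ => f θ φ * Real.sin θ) volume 0 Real.pi :=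
  ((continuous_integrand hf).comp (continuous_const.prodMk continuous_id)).intervalIntegrable _ _

theorem intervalIntegrable_outer {f : ℝ → ℝ → ℝ} (hf : Continuous fun x : ℝ × ℝ => f x.1 x.2) :
    IntervalIntegrable (fun φ => ∫ θ in (0 : ℝ)..Real.pi, f θ φ * Real.sin θ) volume
      0 (2 * Real.pi) :=
  (intervalIntegral.continuous_parametric_intervalIntegral_of_continuous'
    (f := fun φ θ => f θ φ * Real.sin θ) (continuous_integrand hf) _ _).intervalIntegrable _ _

theorem sphereIntegral_add {f g : ℝ → ℝ → ℝ} (hf : Continuous fun x : ℝ × ℝ => f x.1 x.2)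
    (hg : Continuous fun x : ℝ × ℝ => g x.1 x.2) :
    sphereIntegral (fun θ φ => f θ φ + g θ φ) = sphereIntegral f + sphereIntegral g := by
  unfold sphereIntegral
  rw [← intervalIntegral.integral_add (intervalIntegrable_outer hf) (intervalIntegrable_outer hg)]
  refine intervalIntegral.integral_congr fun φ _ => ?_
  simp only [add_mul]
  exact intervalIntegral.integral_add (intervalIntegrable_inner hf φ) (intervalIntegrable_inner hg φ)

theorem sphereIntegral_const_mul (k : ℝ) (f : ℝ → ℝ → ℝ) :
    sphereIntegral (fun θ φ => k * f θ φ) = k * sphereIntegral f := by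
  unfold sphereIntegral
  simp only [mul_assoc, intervalIntegral.integral_const_mul]

theorem sphereIntegral_neg (f : ℝ → ℝ → ℝ) :
    sphereIntegral (fun θ φ => -f θ φ) = -sphereIntegral f := by
  simpa using sphereIntegral_const_mul (-1) f

theorem sphereIntegral_sub {f g : ℝ → ℝ → ℝ} (hf : Continuous fun x : ℝ × ℝ => f x.1 x.2)
    (hg : Continuous fun x : ℝ × ℝ => g x.1 x.2) :
    sphereIntegral (fun θ φ => f θ φ - g θ φ) = sphereIntegral f - sphereIntegral g := by
  simp only [sub_eq_add_neg]
  rw [sphereIntegral_add hf hg.neg, sphereIntegral_neg]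

theorem sphereIntegral_const (k : ℝ) : sphereIntegral (fun _ _ => k) = 4 * Real.pi * k := by
  unfold sphereIntegral
  simp [integral_sin]
  ring

theorem sphereIntegral_mono {f g : ℝ → ℝ → ℝ} (hf : Continuous fun x : ℝ × ℝ => f x.1 x.2)
    (hg : Continuous fun x : ℝ × ℝ => g x.1 x.2)
    (h : ∀ θ ∈ Ioo 0 Real.pi, ∀ φ, f θ φ ≤ g θ φ) : sphereIntegral f ≤ sphereIntegral g := by
  unfold sphereIntegral
  refine intervalIntegral.integral_mono_on (by positivity) (intervalIntegrable_outer hf)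
    (intervalIntegrable_outer hg) fun φ _ => ?_
  refine intervalIntegral.integral_mono_on_of_le_Ioo Real.pi_pos.le (intervalIntegrable_inner hf φ)
    (intervalIntegrable_inner hg φ) fun θ hθ => ?_
  exact mul_le_mul_of_nonneg_right (h θ hθ φ) (Real.sin_nonneg_of_mem_Icc (Ioo_subset_Icc_self hθ))

theorem sphereIntegral_nonneg {f : ℝ → ℝ → ℝ} (hf : Continuous fun x : ℝ × ℝ => f x.1 x.2)
    (h : ∀ θ ∈ Ioo 0 Real.pi, ∀ φ, 0 ≤ f θ φ) : 0 ≤ sphereIntegral f := by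
  have := sphereIntegral_mono (f := fun _ _ => 0) continuous_const hf h
  rwa [sphereIntegral_const, mul_zero] at this

/-- The Cauchy–Schwarz inequality on the sphere. -/
theorem sphereIntegral_sq_le {f : ℝ → ℝ → ℝ} (hf : Continuous fun x : ℝ × ℝ => f x.1 x.2) :
    sphereIntegral f ^ 2 ≤ 4 * Real.pi * sphereIntegral (fun θ φ => f θ φ ^ 2) := by
  -- `m` is the mean of `f`; the inequality is nonnegativity of the variance.
  set m := sphereIntegral f / (4 * Real.pi) with hm
  have h := sphereIntegral_nonneg (f := fun θ φ => (f θ φ ^ 2 - 2 * m * f θ φ) + m ^ 2)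
    (by fun_prop) (fun θ _ φ => by nlinarith [sq_nonneg (f θ φ - m)])
  rw [sphereIntegral_add (by fun_prop) (by fun_prop), sphereIntegral_const,
    sphereIntegral_sub (by fun_prop) (by fun_prop), sphereIntegral_const_mul] at h
  have hpi := Real.pi_pos
  have h1 : sphereIntegral f = m * (4 * Real.pi) := by rw [hm]; field_simp
  rw [h1] at h ⊢
  nlinarith

/-- The divergence theorem on the sphere, in spherical coordinates. -/
theorem sphereIntegral_eq_zero_of_divergence {f Y Y' Z Z' : ℝ → ℝ → ℝ}
    (hY : ∀ θ φ, HasDerivAt (fun t => Y t φ) (Y' θ φ) θ)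
    (hZ : ∀ θ φ, HasDerivAt (fun t => Z θ t) (Z' θ φ) φ)
    (hYc : Continuous fun x : ℝ × ℝ => Y' x.1 x.2) (hZc : Continuous fun x : ℝ × ℝ => Z' x.1 x.2)
    (hY0 : ∀ φ, Y 0 φ = Y Real.pi φ) (hZ0 : ∀ θ, Z θ (2 * Real.pi) = Z θ 0)
    (h : ∀ θ ∈ Ioo 0 Real.pi, ∀ φ, f θ φ * Real.sin θ = Y' θ φ + Z' θ φ) :
    sphereIntegral f = 0 := by
  have hYi : ∀ φ, Continuous fun θ => Y' θ φ := fun φ => by fun_prop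
  have hZi : ∀ φ, Continuous fun θ => Z' θ φ := fun φ => by fun_prop
  have hZj : ∀ θ, Continuous fun φ => Z' θ φ := fun φ => by fun_prop
  -- The `Y'` part is integrated in θ first. The order of integration is then exchanged so that the
  -- `Z'` part can be integrated in φ.
  have h1 : sphereIntegral f
      = ∫ φ in (0 : ℝ)..2 * Real.pi, ∫ θ in (0 : ℝ)..Real.pi, Z' θ φ := by
    unfold sphereIntegral
    refine intervalIntegral.integral_congr fun φ _ => ?_
    have h2 : ∫ θ in (0 : ℝ)..Real.pi, Y' θ φ = 0 := by
      rw [intervalIntegral.integral_eq_sub_of_hasDerivAt (fun θ _ => hY θ φ)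
        ((hYi φ).intervalIntegrable _ _), hY0, sub_self]
    have h3 : ∫ θ in (0 : ℝ)..Real.pi, f θ φ * Real.sin θ
        = ∫ θ in (0 : ℝ)..Real.pi, (Y' θ φ + Z' θ φ) := by
      rw [intervalIntegral.integral_of_le Real.pi_pos.le,
        intervalIntegral.integral_of_le Real.pi_pos.le, integral_Ioc_eq_integral_Ioo,
        integral_Ioc_eq_integral_Ioo]
      exact setIntegral_congr_fun measurableSet_Ioo fun θ hθ => h θ hθ φ
    rw [h3, intervalIntegral.integral_add ((hYi φ).intervalIntegrable _ _)
      ((hZi φ).intervalIntegrable _ _), h2, zero_add]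
  rw [h1, intervalIntegral_intervalIntegral_swap]
  · have : ∀ θ, ∫ φ in (0 : ℝ)..2 * Real.pi, Z' θ φ = 0 := fun θ => by
      rw [intervalIntegral.integral_eq_sub_of_hasDerivAt (fun φ _ => hZ θ φ)
        ((hZj θ).intervalIntegrable _ _), hZ0, sub_self]
    simp [this]
  · have : Continuous (Function.uncurry fun φ θ => Z' θ φ) := hZc.comp continuous_swap
    exact (this.continuousOn.integrableOn_compact (isCompact_uIcc.prod isCompact_uIcc)).mono_set
        (prod_mono uIoc_subset_uIcc uIoc_subset_uIcc)

theorem continuous_sphereIntegral {f : ℝ → ℝ → ℝ → ℝ}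
    (hf : Continuous fun x : ℝ × ℝ × ℝ => f x.1 x.2.1 x.2.2) :
    Continuous fun s => sphereIntegral (f s) := by
  unfold sphereIntegral
  refine intervalIntegral.continuous_parametric_intervalIntegral_of_continuous'
    (f := fun s φ => ∫ θ in (0 : ℝ)..Real.pi, f s θ φ * Real.sin θ) ?_ _ _
  refine intervalIntegral.continuous_parametric_intervalIntegral_of_continuous'
    (f := fun (x : ℝ × ℝ) θ => f x.1 θ x.2 * Real.sin θ) ?_ _ _
  exact (hf.comp (by fun_prop : Continuous fun x : (ℝ × ℝ) × ℝ => (x.1.1, x.2, x.1.2))).mul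
    (by fun_prop)

/-- The fields are controlled only for τ ≥ 0. Freezing the time at 0 for negative arguments gives a
globally continuous function without changing the values that matter, so that the theorems on
parametric integrals apply. -/
theorem continuous_clamp {f : ℝ → ℝ → ℝ → ℝ}
    (hf : ContinuousOn (fun x : ℝ × ℝ × ℝ => f x.1 x.2.1 x.2.2) {x | 0 ≤ x.1}) :
    Continuous fun x : ℝ × ℝ × ℝ => f (max x.1 0) x.2.1 x.2.2 :=
  hf.comp_continuous (f := fun x : ℝ × ℝ × ℝ => (max x.1 0, x.2)) (by fun_prop)
    fun x => le_max_right x.1 0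

theorem continuous_slice {f : ℝ → ℝ → ℝ → ℝ}
    (hf : ContinuousOn (fun x : ℝ × ℝ × ℝ => f x.1 x.2.1 x.2.2) {x | 0 ≤ x.1}) {s : ℝ}
    (hs : 0 ≤ s) : Continuous fun x : ℝ × ℝ => f s x.1 x.2 :=
  hf.comp_continuous (f := fun x : ℝ × ℝ => (s, x)) (by fun_prop) fun _ => hs

theorem intervalIntegral_sphereIntegral_swap {g : ℝ → ℝ → ℝ → ℝ}
    (hg : Continuous fun x : ℝ × ℝ × ℝ => g x.1 x.2.1 x.2.2) (τ T : ℝ) :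
    ∫ s in τ..T, sphereIntegral (g s) = sphereIntegral fun θ φ => ∫ s in τ..T, g s θ φ := by
  unfold sphereIntegral
  rw [intervalIntegral_intervalIntegral_swap]
  · refine intervalIntegral.integral_congr fun φ _ => ?_
    simp only
    rw [intervalIntegral_intervalIntegral_swap]
    · simp only [intervalIntegral.integral_mul_const]
    · have : Continuous (Function.uncurry fun s θ => g s θ φ * Real.sin θ) :=
        (hg.comp (by fun_prop : Continuous fun x : ℝ × ℝ => (x.1, x.2, φ))).mul (by fun_prop)
      exact (this.continuousOn.integrableOn_compact (isCompact_uIcc.prod isCompact_uIcc)).mono_set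
        (prod_mono uIoc_subset_uIcc uIoc_subset_uIcc)
  · have : Continuous (Function.uncurry fun s φ => ∫ θ in (0 : ℝ)..Real.pi, g s θ φ * Real.sin θ) :=
      intervalIntegral.continuous_parametric_intervalIntegral_of_continuous'
        (f := fun (x : ℝ × ℝ) θ => g x.1 θ x.2 * Real.sin θ)
        ((hg.comp (by fun_prop : Continuous fun x : (ℝ × ℝ) × ℝ => (x.1.1, x.2, x.1.2))).mul
          (by fun_prop)) _ _
    exact (this.continuousOn.integrableOn_compact (isCompact_uIcc.prod isCompact_uIcc)).mono_set
        (prod_mono uIoc_subset_uIcc uIoc_subset_uIcc)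

/-- The fundamental theorem of calculus for sphere integrals depending on time. -/
theorem sphereIntegral_sub_eq_intervalIntegral {f f' : ℝ → ℝ → ℝ → ℝ}
    (hf : ContinuousOn (fun x : ℝ × ℝ × ℝ => f x.1 x.2.1 x.2.2) {x | 0 ≤ x.1})
    (hf' : ContinuousOn (fun x : ℝ × ℝ × ℝ => f' x.1 x.2.1 x.2.2) {x | 0 ≤ x.1})
    (hd : ∀ t, 0 ≤ t → ∀ θ φ, HasDerivAt (fun s => f s θ φ) (f' t θ φ) t)
    {τ T : ℝ} (hτ : 0 ≤ τ) (hT : 0 ≤ T) :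
    sphereIntegral (f T) - sphereIntegral (f τ) = ∫ s in τ..T, sphereIntegral (f' s) := by
  have hpos : ∀ s ∈ uIcc τ T, 0 ≤ s := fun s hs => (le_min hτ hT).trans hs.1
  have h1 : ∫ s in τ..T, sphereIntegral (f' s)
      = ∫ s in τ..T, sphereIntegral (f' (max s 0)) :=
    intervalIntegral.integral_congr fun s hs => by simp only [max_eq_left (hpos s hs)]
  rw [h1, intervalIntegral_sphereIntegral_swap (continuous_clamp hf'),
    ← sphereIntegral_sub (continuous_slice hf hT) (continuous_slice hf hτ)]
  congr 1
  ext θ φ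
  refine (intervalIntegral.integral_eq_sub_of_hasDerivAt (f := fun s => f s θ φ) (fun s hs => ?_)
    ?_).symm
  · rw [max_eq_left (hpos s hs)]
    exact hd s (hpos s hs) θ φ
  · exact ((continuous_clamp hf').comp
      (by fun_prop : Continuous fun s : ℝ => (s, θ, φ))).intervalIntegrable _ _

/-! ## Decay of a function from decay of the energy of its derivative -/

/-- On [τ, 2τ + 1] the length is at most 1 + τ, so the hypothesis gives √K (1 + τ)^(-p/2). The step
τ ↦ 2τ + 1 doubles 1 + τ and shrinks this bound by the factor 2^(-p/2); the bounds over successive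
dyadic intervals sum to a geometric series. -/
theorem abs_sub_le_of_energy_decay {m : ℝ → ℝ} {K p : ℝ} (hK : 0 ≤ K) (hp : 0 < p)
    (hm : ∀ τ T, 0 ≤ τ → τ ≤ T → (m T - m τ) ^ 2 ≤ (T - τ) * (K / (1 + τ) ^ (1 + p)))
    {τ T : ℝ} (hτ : 0 ≤ τ) (hT : τ ≤ T) :
    |m T - m τ| ≤ (1 - 2 ^ (-(p / 2)))⁻¹ * (√K * (1 + τ) ^ (-(p / 2))) := by
  set ε : ℝ := 2 ^ (-(p / 2)) with hε
  have hε0 : 0 < ε := by positivity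
  have hε1 : ε < 1 := Real.rpow_lt_one_of_one_lt_of_neg (by norm_num) (by linarith)
  set L := (1 - ε)⁻¹ with hL
  -- `L` is the sum of the geometric series. This identity closes the induction: one more dyadic
  -- interval costs 1, the remaining ones cost `L * ε`.
  have hLε : 1 + L * ε = L := by
    have : 1 - ε ≠ 0 := by linarith
    rw [hL]; field_simp; ring
  have hL0 : 0 ≤ L := inv_nonneg.2 (by linarith)
  have hL1 : 1 ≤ L := by nlinarith [mul_nonneg hL0 hε0.le]
  have base : ∀ τ T, 0 ≤ τ → τ ≤ T → T ≤ 2 * τ + 1 →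
      |m T - m τ| ≤ √K * (1 + τ) ^ (-(p / 2)) := by
    intro τ T h0 h1 h2
    have hpos : 0 < 1 + τ := by linarith
    refine abs_le_of_sq_le_sq (?_) (by positivity)
    refine (hm τ T h0 h1).trans ?_
    rw [mul_pow, Real.sq_sqrt hK, ← Real.rpow_natCast, ← Real.rpow_mul hpos.le,
      show (-(p / 2) * ((2 : ℕ) : ℝ)) = 1 - (1 + p) by push_cast; ring, Real.rpow_sub hpos,
      Real.rpow_one]
    calc (T - τ) * (K / (1 + τ) ^ (1 + p)) ≤ (1 + τ) * (K / (1 + τ) ^ (1 + p)) := by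
          gcongr; linarith
      _ = _ := by ring
  have key : ∀ n : ℕ, ∀ τ T, 0 ≤ τ → τ ≤ T → 1 + T ≤ 2 ^ n * (1 + τ) →
      |m T - m τ| ≤ L * (√K * (1 + τ) ^ (-(p / 2))) := by
    intro n
    induction n with
    | zero =>
      intro τ T h0 h1 h2
      have hpos : 0 < 1 + τ := by linarith
      refine (base τ T h0 h1 (by linarith)).trans (le_mul_of_one_le_left (by positivity) hL1)
    | succ n ih =>
      intro τ T h0 h1 h2
      have hpos : 0 < 1 + τ := by linarith
      rcases le_total T (2 * τ + 1) with h3 | h3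
      · exact (base τ T h0 h1 h3).trans (le_mul_of_one_le_left (by positivity) hL1)
      · have e1 := base τ (2 * τ + 1) h0 (by linarith) le_rfl
        have e2 := ih (2 * τ + 1) T (by linarith) h3 (by rw [pow_succ] at h2; linarith)
        rw [show 1 + (2 * τ + 1) = 2 * (1 + τ) by ring,
          Real.mul_rpow (by norm_num) hpos.le, ← hε] at e2
        calc |m T - m τ| ≤ |m T - m (2 * τ + 1)| + |m (2 * τ + 1) - m τ| := abs_sub_le _ _ _
          _ ≤ _ := add_le_add e2 e1
          _ = (1 + L * ε) * (√K * (1 + τ) ^ (-(p / 2))) := by ring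
          _ = _ := by rw [hLε]
  obtain ⟨n, hn⟩ := pow_unbounded_of_one_lt (1 + T) (one_lt_two)
  exact key n τ T hτ hT (hn.le.trans (le_mul_of_one_le_right (by positivity) (by linarith)))

/-- The Cauchy–Schwarz inequality for an interval integral. -/
theorem sq_intervalIntegral_le {u : ℝ → ℝ} {τ T : ℝ} (h : τ ≤ T) (hu : Continuous u) :
    (∫ s in τ..T, u s) ^ 2 ≤ (T - τ) * ∫ s in τ..T, u s ^ 2 := by
  rcases h.eq_or_lt with rfl | h
  · simp
  set I := ∫ s in τ..T, u s with hI
  have hpos : 0 < T - τ := by linarith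
  -- Again the variance about the mean is nonnegative.
  set m := I / (T - τ) with hm
  have h0 : 0 ≤ ∫ s in τ..T, (u s - m) ^ 2 :=
    intervalIntegral.integral_nonneg h.le fun s _ => sq_nonneg _
  have h1 : ∫ s in τ..T, (u s - m) ^ 2
      = (∫ s in τ..T, u s ^ 2) - 2 * m * I + m ^ 2 * (T - τ) := by
    have : ∀ s, (u s - m) ^ 2 = u s ^ 2 - 2 * m * u s + m ^ 2 := fun s => by ring
    simp only [this]
    rw [intervalIntegral.integral_add, intervalIntegral.integral_sub,
      intervalIntegral.integral_const_mul]
    · simp; ring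
    all_goals exact Continuous.intervalIntegrable (by fun_prop) _ _
  have h2 : I = m * (T - τ) := by rw [hm]; field_simp
  rw [h1] at h0
  rw [h2] at h0 ⊢
  nlinarith

/-- Transfers a bound on a lower integral over [τ, ∞) to an ordinary integral over [τ, T]. The
comparison is made between extended nonnegative integrals, so nothing has to be known about the
measurability of `F`. -/
theorem energy_le_of_flux {F u : ℝ → ℝ} {K D p τ T : ℝ} (hu : Continuous u) (hK : 0 ≤ K)
    (h : ∀ s, 0 ≤ s → u s ^ 2 ≤ K * F s) (hD : 0 ≤ D)
    (hF : ∀ τ : ℝ, 0 ≤ τ → ∫⁻ s in Ioi τ, ENNReal.ofReal (F s)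
      ≤ ENNReal.ofReal (D / (1 + τ) ^ (1 + p)))
    (hτ : 0 ≤ τ) (hT : τ ≤ T) :
    ∫ s in τ..T, u s ^ 2 ≤ K * (D / (1 + τ) ^ (1 + p)) := by
  have hpos : 0 < 1 + τ := by linarith
  have hu2 : Continuous fun s => u s ^ 2 := by fun_prop
  refine (ENNReal.ofReal_le_ofReal_iff (by positivity)).1 ?_
  rw [intervalIntegral.integral_of_le hT, ofReal_integral_eq_lintegral_ofReal
    hu2.integrableOn_Ioc (ae_of_all _ fun s => sq_nonneg _), ENNReal.ofReal_mul hK]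
  calc ∫⁻ s in Ioc τ T, ENNReal.ofReal (u s ^ 2)
      ≤ ∫⁻ s in Ioc τ T, ENNReal.ofReal K * ENNReal.ofReal (F s) := by
        refine setLIntegral_mono' measurableSet_Ioc fun s hs => ?_
        rw [← ENNReal.ofReal_mul hK]
        exact ENNReal.ofReal_le_ofReal (h s (hτ.trans hs.1.le))
    _ ≤ ∫⁻ s in Ioi τ, ENNReal.ofReal K * ENNReal.ofReal (F s) :=
        lintegral_mono_set Ioc_subset_Ioi_self
    _ = ENNReal.ofReal K * ∫⁻ s in Ioi τ, ENNReal.ofReal (F s) :=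
        lintegral_const_mul' _ _ ENNReal.ofReal_ne_top
    _ ≤ _ := mul_le_mul_right (hF τ hτ) _

/-- Otherwise the flux would dominate the integral of a positive constant over a half-line. Finite
flux gives smallness at some late time only, not at every late time. -/
theorem exists_flux_lt {F : ℝ → ℝ} {N ε : ℝ} (hε : 0 < ε)
    (hF : ∫⁻ s in Ioi N, ENNReal.ofReal (F s) ≠ ⊤) : ∃ s, N < s ∧ F s < ε := by
  by_contra! hcon
  refine hF (top_le_iff.1 ?_)
  calc (⊤ : ℝ≥0∞) = ∫⁻ _ in Ioi N, ENNReal.ofReal ε := by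
        rw [setLIntegral_const, Real.volume_Ioi, ENNReal.mul_top (by simpa using hε)]
    _ ≤ _ := setLIntegral_mono' measurableSet_Ioi fun s hs =>
        ENNReal.ofReal_le_ofReal (hcon s hs)

/-! ## The charge constant -/

theorem rPlus_ge {a M : ℝ} : M ≤ rPlus a M := le_add_of_nonneg_right (Real.sqrt_nonneg _)

theorem sphereIntegral_of_hasDerivAt {g G : ℝ → ℝ} (hg : Continuous g)
    (hG : ∀ θ, HasDerivAt G (g θ * Real.sin θ) θ) :
    sphereIntegral (fun θ _ => g θ) = 2 * Real.pi * (G Real.pi - G 0) := by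
  unfold sphereIntegral
  simp only
  rw [intervalIntegral.integral_eq_sub_of_hasDerivAt (fun θ _ => hG θ)
    (Continuous.intervalIntegrable (by fun_prop) _ _)]
  simp
  ring

/-- With x = cos θ the integrand is 2/(1 + γ²x²) - 1, which an arctangent integrates. -/
theorem chargeConstant_of_ne_zero {a M : ℝ} (hM : 0 < M) (ha : a ≠ 0) :
    chargeConstant a M
      = 4 * Real.pi * (2 * Real.arctan (a / rPlus a M) / (a / rPlus a M) - 1) := by
  have hr : 0 < rPlus a M := hM.trans_le rPlus_ge
  unfold chargeConstant
  set γ := a / rPlus a M with hγ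
  have hγ0 : γ ≠ 0 := div_ne_zero ha hr.ne'
  have hpos : ∀ θ : ℝ, 0 < 1 + γ ^ 2 * Real.cos θ ^ 2 := fun θ => by positivity
  rw [sphereIntegral_of_hasDerivAt
    (g := fun θ => (1 - γ ^ 2 * Real.cos θ ^ 2) / (1 + γ ^ 2 * Real.cos θ ^ 2))
    (G := fun θ => Real.cos θ - 2 * Real.arctan (γ * Real.cos θ) / γ)
    (Continuous.div (by fun_prop) (by fun_prop) fun θ => (hpos θ).ne')]
  · simp [Real.arctan_neg]
    ring
  · intro θ
    have h1 := ((Real.hasDerivAt_cos θ).const_mul γ).arctan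
    refine ((Real.hasDerivAt_cos θ).sub ((h1.const_mul 2).div_const γ)).congr_deriv ?_
    have := (hpos θ).ne'
    rw [mul_pow]
    field_simp
    ring

theorem chargeConstant_zero {M : ℝ} : chargeConstant 0 M = 4 * Real.pi := by
  unfold chargeConstant
  simpa using sphereIntegral_const 1

/-- Since |γ| ≤ 1, the claim reduces to x < 2 arctan x on (0, 1]. This follows from sin y < y at y =
arctan x, where sin y = x/√(1 + x²) ≥ x/2. -/
theorem chargeConstant_ne_zero {a M : ℝ} (hM : 0 < M) (ha : |a| ≤ M) :
    chargeConstant a M ≠ 0 := by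
  by_cases h0 : a = 0
  · subst h0
    rw [chargeConstant_zero]
    positivity
  rw [chargeConstant_of_ne_zero hM h0]
  have hr : 0 < rPlus a M := hM.trans_le rPlus_ge
  set γ := a / rPlus a M with hγ
  have hγ0 : γ ≠ 0 := div_ne_zero h0 hr.ne'
  have hγ1 : |γ| ≤ 1 := by
    rw [hγ, abs_div, abs_of_pos hr, div_le_one hr]
    exact ha.trans rPlus_ge
  have key : ∀ x : ℝ, 0 < x → x ≤ 1 → x < 2 * Real.arctan x := by
    intro x hx hx1
    have h1 := Real.sin_lt (Real.arctan_pos.2 hx)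
    rw [Real.sin_arctan] at h1
    have h2 : √(1 + x ^ 2) ≤ 2 := Real.sqrt_le_iff.2 ⟨by norm_num, by nlinarith⟩
    have h3 : x / 2 ≤ x / √(1 + x ^ 2) := by gcongr
    linarith
  have : 1 < 2 * Real.arctan γ / γ := by
    rcases lt_or_gt_of_ne hγ0 with h | h
    · have := key (-γ) (by linarith) (by rwa [← abs_of_neg h])
      rw [Real.arctan_neg] at this
      rw [one_lt_div_of_neg h]
      linarith
    · rw [one_lt_div h]
      exact key γ h (by rwa [← abs_of_pos h])
  have : 0 < 2 * Real.arctan γ / γ - 1 := by linarith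
  positivity

/-! ## The metric and the frame -/

theorem Del_eq {a M : ℝ} (ha : |a| ≤ M) (r : ℝ) : Del a M r = r ^ 2 - 2 * M * r + a ^ 2 := by
  have h : 0 ≤ M ^ 2 - a ^ 2 := by
    have := sq_le_sq' (by linarith [neg_abs_le a, le_abs_self a]) ((le_abs_self a).trans ha)
    linarith
  have := Real.sq_sqrt h
  unfold Del rPlus rMinus
  linear_combination -this

theorem Del_rPlus {a M : ℝ} : Del a M (rPlus a M) = 0 := by simp [Del]

theorem Sig_pos {a : ℝ} {q : R4} (h : 0 < q 1) : 0 < Sig a q := by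
  unfold Sig; positivity

/-- Directional derivatives of the metric and of the frame are computed along straight coordinate
lines; along a direction with no ∂_r component r stays fixed. -/
theorem fderiv_eq_of_hasDerivAt_line {E : Type*} [NormedAddCommGroup E] [NormedSpace ℝ E]
    {F : R4 → E} {q X : R4} {d : E} (hF : DifferentiableAt ℝ F q)
    (hd : HasDerivAt (fun s : ℝ => F (q + s • X)) d 0) : fderiv ℝ F q X = d := by
  have := hF.hasFDerivAt.hasLineDerivAt X
  exact HasDerivAt.unique this hd

theorem hasDerivAt_line {E : Type*} [NormedAddCommGroup E] [NormedSpace ℝ E]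
    {F : R4 → E} {q : R4} (hF : DifferentiableAt ℝ F q) (X : R4) :
    HasDerivAt (fun s : ℝ => F (q + s • X)) (fderiv ℝ F q X) 0 :=
  hF.hasFDerivAt.hasLineDerivAt X

theorem kerrInner_eq_sum (a M : ℝ) (q u v : R4) :
    kerrInner a M q u v = ∑ i, ∑ j, u i * (kerrMetric a M q i j * v j) := by
  simp only [kerrInner, dotProduct, Matrix.mulVec, Finset.mul_sum]

theorem kerrMetric_symm (a M : ℝ) (q : R4) (i j : Fin 4) :
    kerrMetric a M q i j = kerrMetric a M q j i := by
  fin_cases i <;> fin_cases j <;> simp [kerrMetric]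

theorem kerrInner_symm (a M : ℝ) (q u v : R4) : kerrInner a M q u v = kerrInner a M q v u := by
  rw [kerrInner_eq_sum, kerrInner_eq_sum, Finset.sum_comm]
  refine Finset.sum_congr rfl fun i _ => Finset.sum_congr rfl fun j _ => ?_
  rw [kerrMetric_symm a M q j i]
  ring

theorem kerrInner_sub_left (a M : ℝ) (q u u' v : R4) :
    kerrInner a M q (u - u') v = kerrInner a M q u v - kerrInner a M q u' v := by
  simp [kerrInner, sub_dotProduct]

theorem differentiableAt_Sig {a : ℝ} {q : R4} : DifferentiableAt ℝ (Sig a) q := by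
  unfold Sig; fun_prop

theorem differentiableAt_kerrMetric {a M : ℝ} {q : R4} (hq : 0 < q 1) (i j : Fin 4) :
    DifferentiableAt ℝ (fun q' => kerrMetric a M q' i j) q := by
  have h : Sig a q ≠ 0 := (Sig_pos hq).ne'
  have h1 : DifferentiableAt ℝ (Sig a) q := differentiableAt_Sig
  fin_cases i <;> fin_cases j <;> simp [kerrMetric, Del] <;> fun_prop (disch := assumption)

theorem differentiableAt_kerrInner {a M : ℝ} {q : R4} (hq : 0 < q 1) (u v : R4) :
    DifferentiableAt ℝ (fun q' => kerrInner a M q' u v) q := by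
  simp only [kerrInner_eq_sum]
  have := fun i j => differentiableAt_kerrMetric (a := a) (M := M) hq i j
  fun_prop

/-- The metric on vectors without `∂_r` component, in Carter's form. -/
theorem kerrInner_eq_carter {a M : ℝ} (ha : |a| ≤ M) {q u v : R4} (hq : 0 < q 1)
    (hu : u 1 = 0) (hv : v 1 = 0) :
    kerrInner a M q u v
      = -(Del a M (q 1) / Sig a q) * (u 0 - a * Real.sin (q 2) ^ 2 * u 3)
          * (v 0 - a * Real.sin (q 2) ^ 2 * v 3)
        + Real.sin (q 2) ^ 2 / Sig a q * (a * u 0 - (q 1 ^ 2 + a ^ 2) * u 3)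
          * (a * v 0 - (q 1 ^ 2 + a ^ 2) * v 3)
        + Sig a q * u 2 * v 2 := by
  have h := (Sig_pos (a := a) hq).ne'
  have hS : Sig a q = q 1 ^ 2 + a ^ 2 * (1 - Real.sin (q 2) ^ 2) := by
    rw [Sig, Real.cos_sq']
  simp only [kerrInner, kerrMetric, dotProduct, Matrix.mulVec, Fin.sum_univ_four, hu, hv]
  simp only [Matrix.of_apply, Matrix.cons_val', Matrix.cons_val_zero, Matrix.cons_val_one,
    Matrix.cons_val, Matrix.cons_val_fin_one, Del_eq ha]
  field_simp
  rw [hS]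
  ring

theorem frame_one (a : ℝ) (A : Fin 2) (q : R4) : frame a A q 1 = 0 := by
  fin_cases A <;> simp [frame]

/-- The covector dt - a sin²θ dφ multiplies Δ in Carter's form. As it annihilates the frame, inner
products with frame vectors involve neither Δ nor M. -/
theorem frame_null (a : ℝ) (A : Fin 2) (q : R4) :
    frame a A q 0 - a * Real.sin (q 2) ^ 2 * frame a A q 3 = 0 := by
  fin_cases A <;> simp [frame] <;> field_simp <;> simp

theorem frame_theta_zero {a : ℝ} {q : R4} (hq : 0 < q 1) (hs : Real.sin (q 2) ≠ 0) :
    a * frame a 0 q 0 - (q 1 ^ 2 + a ^ 2) * frame a 0 q 3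
      = -(a * Real.cos (q 2) / Real.sin (q 2)) := by
  have h := (Sig_pos (a := a) hq).ne'
  have hS : Sig a q = q 1 ^ 2 + a ^ 2 * (1 - Real.sin (q 2) ^ 2) := by
    rw [Sig, Real.cos_sq']
  simp [frame]
  field_simp
  rw [hS]
  ring

theorem frame_theta_one {a : ℝ} {q : R4} (hq : 0 < q 1) (hs : Real.sin (q 2) ≠ 0) :
    a * frame a 1 q 0 - (q 1 ^ 2 + a ^ 2) * frame a 1 q 3 = -(q 1 / Real.sin (q 2)) := by
  have h := (Sig_pos (a := a) hq).ne'
  have hS : Sig a q = q 1 ^ 2 + a ^ 2 * (1 - Real.sin (q 2) ^ 2) := by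
    rw [Sig, Real.cos_sq']
  simp [frame]
  field_simp
  rw [hS]
  ring

theorem kerrInner_frame_right {a M : ℝ} (ha : |a| ≤ M) {q u : R4} (hq : 0 < q 1)
    (hu : u 1 = 0) (B : Fin 2) :
    kerrInner a M q u (frame a B q)
      = Real.sin (q 2) ^ 2 / Sig a q * (a * u 0 - (q 1 ^ 2 + a ^ 2) * u 3)
          * (a * frame a B q 0 - (q 1 ^ 2 + a ^ 2) * frame a B q 3)
        + Sig a q * u 2 * frame a B q 2 := by
  rw [kerrInner_eq_carter ha hq hu (frame_one a B q), frame_null a B q]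
  ring

theorem frame_orthonormal {a M : ℝ} (ha : |a| ≤ M) {q : R4} (hq : 0 < q 1)
    (hs : Real.sin (q 2) ≠ 0) (A B : Fin 2) :
    kerrInner a M q (frame a A q) (frame a B q) = if A = B then 1 else 0 := by
  have h := (Sig_pos (a := a) hq).ne'
  rw [kerrInner_frame_right ha hq (frame_one a A q)]
  fin_cases A <;> fin_cases B <;>
    (simp only [Fin.zero_eta, Fin.mk_one, frame_theta_zero hq hs, frame_theta_one hq hs]
     simp [frame]
     field_simp
     simp [Sig]
     try ring)

theorem differentiableAt_frame {a : ℝ} {q : R4} (hq : 0 < q 1) (hs : Real.sin (q 2) ≠ 0)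
    (A : Fin 2) : DifferentiableAt ℝ (frame a A) q := by
  have h : Sig a q ≠ 0 := (Sig_pos hq).ne'
  have h2 : Sig a q * Real.sin (q 2) ≠ 0 := mul_ne_zero h hs
  have h1 : DifferentiableAt ℝ (Sig a) q := differentiableAt_Sig
  refine differentiableAt_pi.2 fun i => ?_
  fin_cases A <;> fin_cases i <;> simp [frame] <;> fun_prop (disch := assumption)

/-! ## The Levi-Civita connection -/

/-- The Levi-Civita connection is compatible with the metric. -/
theorem leviCivita_compat {a M : ℝ} {q : R4} (hq : 0 < q 1) (X : R4) {Y Z : R4 → R4}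
    (hY : DifferentiableAt ℝ Y q) (hZ : DifferentiableAt ℝ Z q) :
    leviCivita a M q X Y (Z q) + leviCivita a M q X Z (Y q)
      = fderiv ℝ (fun q' => kerrInner a M q' (Y q') (Z q')) q X := by
  have hg := fun i j => differentiableAt_kerrMetric (a := a) (M := M) hq i j
  have hYi : ∀ i, HasDerivAt (fun s : ℝ => Y (q + s • X) i) (fderiv ℝ Y q X i) 0 :=
    fun i => hasDerivAt_pi.1 (hasDerivAt_line hY X) i
  have hZi : ∀ i, HasDerivAt (fun s : ℝ => Z (q + s • X) i) (fderiv ℝ Z q X i) 0 :=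
    fun i => hasDerivAt_pi.1 (hasDerivAt_line hZ X) i
  have hgi := fun i j => hasDerivAt_line (hg i j) X
  -- The product rule isolates the derivative of the metric on frozen vectors. In the sum of the two
  -- Christoffel expressions exactly this term survives and the others cancel in pairs.
  have h1 : fderiv ℝ (fun q' => kerrInner a M q' (Y q') (Z q')) q X
      = kerrInner a M q (fderiv ℝ Y q X) (Z q) + kerrInner a M q (Y q) (fderiv ℝ Z q X)
        + fderiv ℝ (fun q' => kerrInner a M q' (Y q) (Z q)) q X := by
    have e1 : fderiv ℝ (fun q' => kerrInner a M q' (Y q) (Z q)) q X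
        = ∑ i, ∑ j, Y q i * (fderiv ℝ (fun q' => kerrMetric a M q' i j) q X * Z q j) := by
      refine fderiv_eq_of_hasDerivAt_line (differentiableAt_kerrInner hq _ _) ?_
      simp only [kerrInner_eq_sum]
      exact HasDerivAt.fun_sum fun i _ => HasDerivAt.fun_sum fun j _ =>
        ((hgi i j).mul_const _).const_mul _
    rw [e1]
    refine fderiv_eq_of_hasDerivAt_line ?_ ?_
    · simp only [kerrInner_eq_sum]
      fun_prop
    simp only [kerrInner_eq_sum]
    refine (HasDerivAt.fun_sum fun i _ => HasDerivAt.fun_sum fun j _ =>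
        (hYi i).mul ((hgi i j).mul (hZi j))).congr_deriv ?_
    simp only [← Finset.sum_add_distrib]
    refine Finset.sum_congr rfl fun i _ => Finset.sum_congr rfl fun j _ => ?_
    simp
    ring
  rw [h1]
  unfold leviCivita
  simp only [kerrInner_symm a M _ (Z q) (Y q), kerrInner_symm a M q (fderiv ℝ Z q X) (Y q)]
  ring

/-- The Levi-Civita connection is torsion-free. -/
theorem leviCivita_torsion {a M : ℝ} {q : R4} (X Y : R4 → R4) (Z : R4) :
    leviCivita a M q (X q) Y Z - leviCivita a M q (Y q) X Z
      = kerrInner a M q (fderiv ℝ Y q (X q) - fderiv ℝ X q (Y q)) Z := by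
  rw [kerrInner_sub_left]
  unfold leviCivita
  simp only [kerrInner_symm a M _ (Y q) (X q)]
  ring

theorem eventually_regular {q : R4} (hq : 0 < q 1) (hs : Real.sin (q 2) ≠ 0) :
    ∀ᶠ q' : R4 in 𝓝 q, 0 < q' 1 ∧ Real.sin (q' 2) ≠ 0 := by
  have h1 : Continuous fun q' : R4 => q' 1 := by fun_prop
  have h2 : Continuous fun q' : R4 => Real.sin (q' 2) := by fun_prop
  exact (h1.continuousAt.eventually_const_lt hq).and (h2.continuousAt.eventually_ne hs)

/-- Metric compatibility applied to g(e_A, e_B), which is constant near any point off the axis. The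
horizontal connection is thus a rotation, with a single coefficient in each direction. -/
theorem leviCivita_frame_antisymm {a M : ℝ} (ha : |a| ≤ M) {q : R4} (hq : 0 < q 1)
    (hs : Real.sin (q 2) ≠ 0) (X : R4) (A B : Fin 2) :
    leviCivita a M q X (frame a A) (frame a B q) + leviCivita a M q X (frame a B) (frame a A q)
      = 0 := by
  rw [leviCivita_compat hq X (differentiableAt_frame hq hs A) (differentiableAt_frame hq hs B)]
  have : (fun q' => kerrInner a M q' (frame a A q') (frame a B q'))
      =ᶠ[𝓝 q] fun _ => if A = B then 1 else 0 :=
    (eventually_regular hq hs).mono fun q' h => frame_orthonormal ha h.1 h.2 A B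
  rw [this.fderiv_eq]
  simp

theorem leviCivita_frame_self {a M : ℝ} (ha : |a| ≤ M) {q : R4} (hq : 0 < q 1)
    (hs : Real.sin (q 2) ≠ 0) (X : R4) (A : Fin 2) :
    leviCivita a M q X (frame a A) (frame a A q) = 0 := by
  linarith [leviCivita_frame_antisymm ha hq hs X A A]

/-- The derivative of the frame in the direction `∂_θ`. -/
noncomputable def frameDeriv (a : ℝ) (A : Fin 2) (q : R4) : R4 :=
  if A = 0 then
    ![a ^ 2 * (Real.cos (q 2) ^ 2 - Real.sin (q 2) ^ 2) / Sig a q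
        + 2 * a ^ 4 * Real.sin (q 2) ^ 2 * Real.cos (q 2) ^ 2 / Sig a q ^ 2, 0,
      2 * a ^ 2 * q 1 * Real.sin (q 2) * Real.cos (q 2) / Sig a q ^ 2,
      -(a / Sig a q) + a * Real.cos (q 2) ^ 2
        * (2 * a ^ 2 * Real.sin (q 2) ^ 2 - Sig a q) / (Sig a q * Real.sin (q 2)) ^ 2]
  else
    ![a * q 1 * Real.cos (q 2) / Sig a q
        + 2 * a ^ 3 * q 1 * Real.sin (q 2) ^ 2 * Real.cos (q 2) / Sig a q ^ 2, 0,
      a * Real.sin (q 2) / Sig a q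
        - 2 * a ^ 3 * Real.sin (q 2) * Real.cos (q 2) ^ 2 / Sig a q ^ 2,
      q 1 * Real.cos (q 2) * (2 * a ^ 2 * Real.sin (q 2) ^ 2 - Sig a q)
        / (Sig a q * Real.sin (q 2)) ^ 2]

theorem hasDerivAt_Sig_line (a : ℝ) {q X : R4} (hX : X 1 = 0) :
    HasDerivAt (fun s : ℝ => Sig a (q + s • X))
      (X 2 * (-2 * a ^ 2 * Real.sin (q 2) * Real.cos (q 2))) 0 := by
  have h : HasDerivAt (fun s : ℝ => q 2 + s * X 2) (X 2) 0 := by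
    simpa using ((hasDerivAt_id (0 : ℝ)).mul_const (X 2)).const_add (q 2)
  have := ((h.cos.pow 2).const_mul (a ^ 2)).const_add (q 1 ^ 2)
  simp only [Sig, Pi.add_apply, Pi.smul_apply, smul_eq_mul, hX, mul_zero, add_zero]
  refine this.congr_deriv ?_
  simp
  ring

/-- The frame components depend on r and θ alone, so a direction without ∂_r sees only the θ
derivative. -/
theorem fderiv_frame {a : ℝ} {q X : R4} (hq : 0 < q 1) (hs : Real.sin (q 2) ≠ 0) (hX : X 1 = 0)
    (A : Fin 2) : fderiv ℝ (frame a A) q X = X 2 • frameDeriv a A q := by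
  have h0 := (Sig_pos (a := a) hq).ne'
  refine fderiv_eq_of_hasDerivAt_line (differentiableAt_frame hq hs A) ?_
  have h : HasDerivAt (fun s : ℝ => q 2 + s * X 2) (X 2) 0 := by
    simpa using ((hasDerivAt_id (0 : ℝ)).mul_const (X 2)).const_add (q 2)
  have hS := hasDerivAt_Sig_line a (q := q) hX
  have e0 : Sig a (q + (0 : ℝ) • X) ≠ 0 := by simpa using h0
  have e1 : Sig a (q + (0 : ℝ) • X) * Real.sin (q 2 + 0 * X 2) ≠ 0 := by
    simpa using And.intro h0 hs
  refine hasDerivAt_pi.2 fun i => ?_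
  fin_cases A <;> fin_cases i <;>
    simp only [frame, frameDeriv, Fin.zero_eta, Fin.mk_one, Fin.reduceFinMk, if_true,
      one_ne_zero, if_false, Matrix.cons_val_zero, Matrix.cons_val_one,
      Matrix.cons_val, Pi.add_apply, Pi.smul_apply, smul_eq_mul, hX, mul_zero, add_zero]
  · refine (((h.sin.const_mul (a ^ 2)).mul h.cos).div hS e0).congr_deriv ?_
    simp; field_simp; ring
  · exact hasDerivAt_const _ _
  · refine ((hasDerivAt_const _ (q 1)).div hS e0).congr_deriv ?_
    simp; field_simp
  · refine ((h.cos.const_mul a).div (hS.mul h.sin) e1).congr_deriv ?_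
    simp; field_simp; ring
  · refine ((h.sin.const_mul (a * q 1)).div hS e0).congr_deriv ?_
    simp; field_simp
  · exact hasDerivAt_const _ _
  · refine ((h.cos.const_mul a).neg.div hS e0).congr_deriv ?_
    simp; field_simp
  · refine ((hasDerivAt_const _ (q 1)).div (hS.mul h.sin) e1).congr_deriv ?_
    simp; field_simp; ring

/-- The commutator of the horizontal frame vectors. -/
theorem frame_commutator_inner {a M : ℝ} (ha : |a| ≤ M) {q : R4} (hq : 0 < q 1)
    (hs : Real.sin (q 2) ≠ 0) :
    kerrInner a M q (fderiv ℝ (frame a 1) q (frame a 0 q) - fderiv ℝ (frame a 0) q (frame a 1 q))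
        (frame a 0 q)
      = -(a / (Real.sin (q 2) * Sig a q ^ 2) * (Real.cos (q 2) ^ 2 * (q 1 ^ 2 + a ^ 2)
          - q 1 ^ 2 * Real.sin (q 2) ^ 2)) ∧
    kerrInner a M q (fderiv ℝ (frame a 1) q (frame a 0 q) - fderiv ℝ (frame a 0) q (frame a 1 q))
        (frame a 1 q)
      = -(q 1 * Real.cos (q 2) / (Real.sin (q 2) * Sig a q ^ 2)
          * (a ^ 2 * Real.sin (q 2) ^ 2 + q 1 ^ 2 + a ^ 2)) := by
  have h0 := (Sig_pos (a := a) hq).ne'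
  have hS : Sig a q = q 1 ^ 2 + a ^ 2 * Real.cos (q 2) ^ 2 := rfl
  have hsc := Real.sin_sq_add_cos_sq (q 2)
  rw [fderiv_frame hq hs (frame_one a 0 q), fderiv_frame hq hs (frame_one a 1 q)]
  have h1 : (frame a 0 q 2 • frameDeriv a 1 q - frame a 1 q 2 • frameDeriv a 0 q) 1 = 0 := by
    simp [frameDeriv]
  rw [kerrInner_frame_right ha hq h1, kerrInner_frame_right ha hq h1,
    frame_theta_zero hq hs, frame_theta_one hq hs]
  simp only [Pi.sub_apply, Pi.smul_apply, smul_eq_mul]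
  simp only [frame, frameDeriv, if_true, one_ne_zero, if_false, Matrix.cons_val_zero,
    Matrix.cons_val]
  generalize Real.sin (q 2) = s at *
  generalize Real.cos (q 2) = c at *
  generalize Sig a q = S at *
  generalize q 1 = r at *
  have hs2 : s ^ 2 = 1 - c ^ 2 := by linarith
  constructor
  · field_simp
    subst hS
    grind
  · field_simp
    subst hS
    grind

/-- Koszul's argument: pairing the torsion identity with e₁ leaves only g(∇₁e₂, e₁), because g(∇₂e₁,
e₁) = 0, and antisymmetry turns it into -g(∇₁e₁, e₂). The rotation coefficients are therefore read
off from the commutator of the frame. -/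
theorem leviCivita_frame_zero {a M : ℝ} (ha : |a| ≤ M) {q : R4} (hq : 0 < q 1)
    (hs : Real.sin (q 2) ≠ 0) :
    leviCivita a M q (frame a 0 q) (frame a 0) (frame a 1 q)
      = a / (Real.sin (q 2) * Sig a q ^ 2) * (Real.cos (q 2) ^ 2 * (q 1 ^ 2 + a ^ 2)
          - q 1 ^ 2 * Real.sin (q 2) ^ 2) := by
  have h1 := leviCivita_frame_antisymm ha hq hs (frame a 0 q) 0 1
  have h2 := leviCivita_torsion (a := a) (M := M) (frame a 0) (frame a 1) (q := q) (frame a 0 q)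
  rw [leviCivita_frame_self ha hq hs, (frame_commutator_inner ha hq hs).1] at h2
  linarith

theorem leviCivita_frame_one {a M : ℝ} (ha : |a| ≤ M) {q : R4} (hq : 0 < q 1)
    (hs : Real.sin (q 2) ≠ 0) :
    leviCivita a M q (frame a 1 q) (frame a 0) (frame a 1 q)
      = q 1 * Real.cos (q 2) / (Real.sin (q 2) * Sig a q ^ 2)
          * (a ^ 2 * Real.sin (q 2) ^ 2 + q 1 ^ 2 + a ^ 2) := by
  have h2 := leviCivita_torsion (a := a) (M := M) (frame a 0) (frame a 1) (q := q) (frame a 1 q)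
  rw [leviCivita_frame_self ha hq hs, (frame_commutator_inner ha hq hs).2] at h2
  linarith

/-- On the horizon the frame is parallel along the null generators. -/
theorem leviCivita_e4_frame {a M : ℝ} (ha : |a| ≤ M) {q : R4} (hq : 0 < q 1)
    (hr : q 1 = rPlus a M) (hs : Real.sin (q 2) ≠ 0) :
    leviCivita a M q (e4 a M q) (frame a 0) (frame a 1 q) = 0 := by
  have hD : Del a M (q 1) = 0 := by rw [hr, Del_rPlus]
  have h1 : e4 a M q 1 = 0 := by simp [e4, hD]
  have h2 : e4 a M q 2 = 0 := by simp [e4]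
  have h3 : a * e4 a M q 0 - (q 1 ^ 2 + a ^ 2) * e4 a M q 3 = 0 := by simp [e4]; ring
  -- The components of e₄ frozen at `q` are a constant multiple of those of (r₊² + a²)∂_t + a∂_φ,
  -- which is null and normal to the horizon at each of its points with r > 0. Its product with any
  -- tangent vector thus vanishes along the whole horizon.
  have key : ∀ X v : R4, X 1 = 0 → v 1 = 0 →
      fderiv ℝ (fun q' => kerrInner a M q' (e4 a M q) v) q X = 0 := by
    intro X v hX hv
    refine fderiv_eq_of_hasDerivAt_line (differentiableAt_kerrInner hq _ _) ?_
    have : (fun s : ℝ => kerrInner a M (q + s • X) (e4 a M q) v) = fun _ => 0 := by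
      ext s
      have e1 : (q + s • X) 1 = q 1 := by simp [hX]
      rw [kerrInner_eq_carter ha (e1 ▸ hq) h1 hv, e1, hD, h2, h3]
      simp
    rw [this]
    exact hasDerivAt_const _ _
  -- On the horizon e₄ is a combination of ∂_t and ∂_φ, along which the metric components do not
  -- change.
  have key2 : fderiv ℝ (fun q' => kerrInner a M q' (frame a 0 q) (frame a 1 q)) q (e4 a M q)
      = 0 := by
    refine fderiv_eq_of_hasDerivAt_line (differentiableAt_kerrInner hq _ _) ?_
    have : (fun s : ℝ => kerrInner a M (q + s • e4 a M q) (frame a 0 q) (frame a 1 q))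
        = fun _ => kerrInner a M q (frame a 0 q) (frame a 1 q) := by
      ext s
      simp [kerrInner, kerrMetric, Sig, h1, h2]
    rw [this]
    exact hasDerivAt_const _ _
  unfold leviCivita
  rw [fderiv_frame hq hs h1, h2, key2, key _ _ (frame_one a 0 q) (frame_one a 1 q)]
  simp only [kerrInner_symm a M _ (e4 a M q)] at key ⊢
  rw [key _ _ (frame_one a 1 q) (frame_one a 0 q)]
  simp [kerrInner]

/-- Lowering the index of e₃ gives -(dt - a sin²θ dφ), a covector that depends on the point only
through θ. -/
theorem kerrInner_e3 (a M : ℝ) (q q' v : R4) :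
    kerrInner a M q' (e3 q) v = -(v 0 - a * Real.sin (q' 2) ^ 2 * v 3) := by
  simp [kerrInner, kerrMetric, e3, dotProduct, Matrix.mulVec, Fin.sum_univ_four]
  ring

theorem fderiv_kerrInner_e3 {a M : ℝ} {q X : R4} (hq : 0 < q 1) (v : R4) :
    fderiv ℝ (fun q' => kerrInner a M q' (e3 q) v) q X
      = 2 * a * Real.sin (q 2) * Real.cos (q 2) * X 2 * v 3 := by
  refine fderiv_eq_of_hasDerivAt_line (differentiableAt_kerrInner hq _ _) ?_
  have h : HasDerivAt (fun s : ℝ => q 2 + s * X 2) (X 2) 0 := by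
    simpa using ((hasDerivAt_id (0 : ℝ)).mul_const (X 2)).const_add (q 2)
  simp only [kerrInner_e3, Pi.add_apply, Pi.smul_apply, smul_eq_mul]
  refine ((((h.sin.pow 2).const_mul a).mul_const (v 3)).const_sub (v 0)).neg.congr_deriv ?_
  norm_num [-mul_eq_mul_right_iff]
  ring

theorem fderiv_kerrInner_frame_e3 {a M : ℝ} (ha : |a| ≤ M) {q : R4} (hq : 0 < q 1)
    (A : Fin 2) :
    fderiv ℝ (fun q' => kerrInner a M q' (frame a A q) (frame a A q)) q (e3 q)
      = -(Real.sin (q 2) ^ 2 * (-(2 * q 1 / Sig a q ^ 2)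
          * (a * frame a A q 0 - (q 1 ^ 2 + a ^ 2) * frame a A q 3) ^ 2
          - 4 * q 1 / Sig a q * (a * frame a A q 0 - (q 1 ^ 2 + a ^ 2) * frame a A q 3)
            * frame a A q 3)
        + 2 * q 1 * frame a A q 2 ^ 2) := by
  have h0 := (Sig_pos (a := a) hq).ne'
  refine fderiv_eq_of_hasDerivAt_line (differentiableAt_kerrInner hq _ _) ?_
  have hr : HasDerivAt (fun s : ℝ => q 1 - s) (-1) 0 := by
    simpa using (hasDerivAt_id (0 : ℝ)).const_sub (q 1)
  have hS : HasDerivAt (fun s : ℝ => (q 1 - s) ^ 2 + a ^ 2 * Real.cos (q 2) ^ 2) (-(2 * q 1)) 0 := by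
    refine ((hr.pow 2).add_const _).congr_deriv ?_
    simp
  have e0 : (q 1 - 0) ^ 2 + a ^ 2 * Real.cos (q 2) ^ 2 ≠ 0 := by simpa [Sig] using h0
  have hT : HasDerivAt (fun s : ℝ => a * frame a A q 0 - ((q 1 - s) ^ 2 + a ^ 2) * frame a A q 3)
      (2 * q 1 * frame a A q 3) 0 := by
    refine ((((hr.pow 2).add_const _).mul_const _).const_sub _).congr_deriv ?_
    simp
  have key : (fun s : ℝ => kerrInner a M (q + s • e3 q) (frame a A q) (frame a A q)) =ᶠ[𝓝 0]
      fun s => Real.sin (q 2) ^ 2 / ((q 1 - s) ^ 2 + a ^ 2 * Real.cos (q 2) ^ 2)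
          * (a * frame a A q 0 - ((q 1 - s) ^ 2 + a ^ 2) * frame a A q 3) ^ 2
        + ((q 1 - s) ^ 2 + a ^ 2 * Real.cos (q 2) ^ 2) * frame a A q 2 ^ 2 := by
    -- Carter's form needs r > 0, so the two functions of `s` are compared only near 0.
    have : ∀ᶠ s : ℝ in 𝓝 0, s < q 1 := eventually_lt_nhds hq
    filter_upwards [this] with s hs'
    have e1 : (q + s • e3 q) 1 = q 1 - s := by simp [e3]; ring
    have e2 : (q + s • e3 q) 2 = q 2 := by simp [e3]
    rw [kerrInner_eq_carter ha (by rw [e1]; linarith) (frame_one a A q) (frame_one a A q), e1, e2,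
      frame_null a A q, Sig, e1, e2]
    ring
  refine HasDerivAt.congr_of_eventuallyEq ?_ key
  refine ((((hasDerivAt_const (0 : ℝ) (Real.sin (q 2) ^ 2)).div hS e0).mul (hT.pow 2)).add
    (hS.mul_const _)).congr_deriv ?_
  simp [Sig]
  field_simp
  ring

/-- The components of e₃ are constant, so χ̲ consists of Christoffel terms only. On the diagonal two
of them cancel and ½ e₃(g)(e_A, e_A) remains, with the vectors frozen. -/
theorem trChiBar_eq {a M : ℝ} (ha : |a| ≤ M) {q : R4} (hq : 0 < q 1)
    (hs : Real.sin (q 2) ≠ 0) : trChiBar a M q = -(2 * q 1 / Sig a q) := by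
  have h0 := (Sig_pos (a := a) hq).ne'
  have hS : Sig a q = q 1 ^ 2 + a ^ 2 * Real.cos (q 2) ^ 2 := rfl
  have hc : ∀ v : R4, fderiv ℝ e3 q v = 0 := fun v => by
    have : e3 = fun _ => ![0, -1, 0, 0] := rfl
    rw [this]; simp
  have hz : ∀ v : R4, kerrInner a M q 0 v = 0 := fun v => by simp [kerrInner]
  unfold trChiBar chiBar leviCivita
  simp only [hc, hz, kerrInner_symm a M _ _ (e3 q), fderiv_kerrInner_e3 hq,
    fderiv_kerrInner_frame_e3 ha hq, frame_theta_zero hq hs, frame_theta_one hq hs]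
  simp only [frame, if_true, one_ne_zero, if_false, Matrix.cons_val]
  generalize Real.sin (q 2) = s at *
  generalize Real.cos (q 2) = c at *
  generalize Sig a q = S at *
  generalize q 1 = r at *
  field_simp
  subst hS
  ring

/-- The antisymmetric part of χ̲ is the exterior derivative of the covector e₃♭ evaluated on (e₁,
e₂); the symmetric term e₃(g) drops out. -/
theorem epsChiBar_eq {a M : ℝ} {q : R4} (hq : 0 < q 1)
    (hs : Real.sin (q 2) ≠ 0) : epsChiBar a M q = 2 * a * Real.cos (q 2) / Sig a q := by
  have h0 := (Sig_pos (a := a) hq).ne'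
  have hS : Sig a q = q 1 ^ 2 + a ^ 2 * Real.cos (q 2) ^ 2 := rfl
  unfold epsChiBar chiBar leviCivita
  have hc : ∀ v : R4, fderiv ℝ e3 q v = 0 := fun v => by
    have : e3 = fun _ => ![0, -1, 0, 0] := rfl
    rw [this]; simp
  have hz : ∀ v : R4, kerrInner a M q 0 v = 0 := fun v => by simp [kerrInner]
  simp only [hc, hz, kerrInner_symm a M _ _ (e3 q), fderiv_kerrInner_e3 hq,
    kerrInner_symm a M _ (frame a 1 q) (frame a 0 q)]
  simp only [frame, if_true, one_ne_zero, if_false, Matrix.cons_val]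
  generalize Real.sin (q 2) = s at *
  generalize Real.cos (q 2) = c at *
  generalize Sig a q = S at *
  generalize q 1 = r at *
  field_simp
  subst hS
  ring

theorem coefC_eq {a M : ℝ} (ha : |a| ≤ M) {q : R4} (hq : 0 < q 1) (hs : Real.sin (q 2) ≠ 0) :
    coefC a M q = (q 1 ^ 2 - a ^ 2 * Real.cos (q 2) ^ 2) / Sig a q := by
  have h0 := (Sig_pos (a := a) hq).ne'
  rw [coefC, trChiBar_eq ha hq hs, epsChiBar_eq hq hs]
  field_simp
  ring

theorem coefD_eq {a M : ℝ} (ha : |a| ≤ M) {q : R4} (hq : 0 < q 1) (hs : Real.sin (q 2) ≠ 0) :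
    coefD a M q = -(2 * a * q 1 * Real.cos (q 2) / Sig a q) := by
  have h0 := (Sig_pos (a := a) hq).ne'
  rw [coefD, trChiBar_eq ha hq hs, epsChiBar_eq hq hs]
  field_simp

/-- In complex form c + i d = (r - i a cos θ)²/Σ and Σ = |r - i a cos θ|², so (c, d) acts as a
rotation on pairs such as (ρ̂, σ̂). -/
theorem coefC_sq_add_coefD_sq {a M : ℝ} (ha : |a| ≤ M) {q : R4} (hq : 0 < q 1)
    (hs : Real.sin (q 2) ≠ 0) : coefC a M q ^ 2 + coefD a M q ^ 2 = 1 := by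
  have h0 := (Sig_pos (a := a) hq).ne'
  have hS : Sig a q = q 1 ^ 2 + a ^ 2 * Real.cos (q 2) ^ 2 := rfl
  rw [coefC_eq ha hq hs, coefD_eq ha hq hs]
  field_simp
  rw [hS]
  ring

/-! ## Fields along the horizon -/

/-- The point with Kerr coordinates `(τ + k, r, θ, φ)`. -/
def kerrPoint (k r τ θ φ : ℝ) : R4 := ![τ + k, r, θ, φ]

/-- The coordinate vector `∂_t` in the global chart. -/
def vecT : R4 := ![1, 0, 0, 0]

/-- The coordinate vector `∂_θ` in the global chart. -/
noncomputable def vecTheta (r θ φ : ℝ) : R4 :=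
  ![0, r * Real.cos θ * Real.cos φ, r * Real.cos θ * Real.sin φ, -(r * Real.sin θ)]

/-- The coordinate vector `∂_φ` in the global chart. -/
noncomputable def vecPhi (r θ φ : ℝ) : R4 :=
  ![0, -(r * Real.sin θ * Real.sin φ), r * Real.sin θ * Real.cos φ, 0]

/-- The vector `a sin θ ∂_t + (sin θ)⁻¹ ∂_φ` in the global chart; it is regular on the axis. -/
noncomputable def vecW (a r θ φ : ℝ) : R4 :=
  ![a * Real.sin θ, -(r * Real.sin φ), r * Real.cos φ, 0]

/-- The vector `r ∂_r` in the global chart. -/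
noncomputable def vecN (r θ φ : ℝ) : R4 :=
  ![0, r * Real.sin θ * Real.cos φ, r * Real.sin θ * Real.sin φ, r * Real.cos θ]

theorem contDiff_chart : ContDiff ℝ ∞ chart := by
  refine contDiff_pi.2 fun i => ?_
  fin_cases i <;> simp [chart] <;> fun_prop

theorem hasDerivAt_line_apply (q X : R4) (i : Fin 4) :
    HasDerivAt (fun s : ℝ => q i + s * X i) (X i) 0 := by
  simpa using ((hasDerivAt_id (0 : ℝ)).mul_const (X i)).const_add (q i)

theorem fderiv_chart {q X : R4} (hX : X 1 = 0) :
    fderiv ℝ chart q X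
      = X 0 • vecT + X 2 • vecTheta (q 1) (q 2) (q 3) + X 3 • vecPhi (q 1) (q 2) (q 3) := by
  refine fderiv_eq_of_hasDerivAt_line
    (contDiff_chart.contDiffAt.differentiableAt (by simp)) ?_
  have h := hasDerivAt_line_apply q X
  refine hasDerivAt_pi.2 fun i => ?_
  fin_cases i <;> simp [chart, vecT, vecTheta, vecPhi, hX]
  · simpa using h 0
  · refine ((((h 2).sin.const_mul (q 1)).mul (h 3).cos)).congr_deriv ?_
    simp; ring
  · refine ((((h 2).sin.const_mul (q 1)).mul (h 3).sin)).congr_deriv ?_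
    simp; ring
  · refine ((h 2).cos.const_mul (q 1)).congr_deriv ?_
    simp; ring

theorem hasDerivAt_chart_t (k r τ θ φ : ℝ) :
    HasDerivAt (fun t => chart (kerrPoint k r t θ φ)) vecT τ := by
  refine hasDerivAt_pi.2 fun i => ?_
  fin_cases i <;> simp [chart, kerrPoint, vecT]
  · exact hasDerivAt_id τ
  all_goals exact hasDerivAt_const _ _

theorem hasDerivAt_chart_theta (k r τ θ φ : ℝ) :
    HasDerivAt (fun t => chart (kerrPoint k r τ t φ)) (vecTheta r θ φ) θ := by
  refine hasDerivAt_pi.2 fun i => ?_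
  fin_cases i <;> simp [chart, kerrPoint, vecTheta]
  · exact hasDerivAt_const _ _
  · exact ((Real.hasDerivAt_sin θ).const_mul r).mul_const _
  · exact ((Real.hasDerivAt_sin θ).const_mul r).mul_const _
  · exact ((Real.hasDerivAt_cos θ).const_mul r).congr_deriv (by ring)

theorem hasDerivAt_chart_phi (k r τ θ φ : ℝ) :
    HasDerivAt (fun t => chart (kerrPoint k r τ θ t)) (vecPhi r θ φ) φ := by
  refine hasDerivAt_pi.2 fun i => ?_
  fin_cases i <;> simp [chart, kerrPoint, vecPhi]
  · exact hasDerivAt_const _ _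
  · exact ((Real.hasDerivAt_cos φ).const_mul (r * Real.sin θ)).congr_deriv (by ring)
  · exact ((Real.hasDerivAt_sin φ).const_mul (r * Real.sin θ)).congr_deriv (by ring)
  · exact hasDerivAt_const _ _

theorem hasDerivAt_vecTheta_theta (r θ φ : ℝ) :
    HasDerivAt (fun t => vecTheta r t φ) (-vecN r θ φ) θ := by
  refine hasDerivAt_pi.2 fun i => ?_
  fin_cases i <;> simp [vecTheta, vecN]
  · exact hasDerivAt_const _ _
  · exact (((Real.hasDerivAt_cos θ).const_mul r).mul_const _).congr_deriv (by ring)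
  · exact (((Real.hasDerivAt_cos θ).const_mul r).mul_const _).congr_deriv (by ring)
  · exact ((Real.hasDerivAt_sin θ).const_mul r).neg

theorem hasDerivAt_vecTheta_phi (a r θ φ : ℝ) :
    HasDerivAt (fun t => vecTheta r θ t)
      (Real.cos θ • (vecW a r θ φ - (a * Real.sin θ) • vecT)) φ := by
  refine hasDerivAt_pi.2 fun i => ?_
  fin_cases i <;> simp [vecTheta, vecW, vecT]
  · exact hasDerivAt_const _ _
  · exact ((Real.hasDerivAt_cos φ).const_mul _).congr_deriv (by ring)
  · exact ((Real.hasDerivAt_sin φ).const_mul _).congr_deriv (by ring)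
  · exact hasDerivAt_const _ _

theorem hasDerivAt_vecW_theta (a r θ φ : ℝ) :
    HasDerivAt (fun t => vecW a r t φ) ((a * Real.cos θ) • vecT) θ := by
  refine hasDerivAt_pi.2 fun i => ?_
  fin_cases i <;> simp [vecW, vecT]
  · exact (Real.hasDerivAt_sin θ).const_mul a
  all_goals exact hasDerivAt_const _ _

theorem hasDerivAt_vecW_phi (a r θ φ : ℝ) :
    HasDerivAt (fun t => vecW a r θ t)
      (-(Real.cos θ • vecTheta r θ φ) - Real.sin θ • vecN r θ φ) φ := by
  have h := Real.sin_sq_add_cos_sq θ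
  refine hasDerivAt_pi.2 fun i => ?_
  fin_cases i <;> simp [vecW, vecTheta, vecN]
  · exact hasDerivAt_const _ _
  · exact ((Real.hasDerivAt_sin φ).const_mul r).neg.congr_deriv
      (by linear_combination (r * Real.cos φ) * h)
  · exact ((Real.hasDerivAt_cos φ).const_mul r).congr_deriv
      (by linear_combination (r * Real.sin φ) * h)
  · exact (hasDerivAt_const _ _).congr_deriv (by ring)

/-- Exhibits the factor sin θ in ∂_φ, which absorbs the (sin θ)⁻¹ in the frame. -/
theorem vecPhi_eq (a r θ φ : ℝ) :
    vecPhi r θ φ = Real.sin θ • (vecW a r θ φ - (a * Real.sin θ) • vecT) := by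
  ext i
  fin_cases i <;> simp [vecPhi, vecW, vecT] <;> ring

/-- A continuously differentiable function of `τ ≥ 0`, `θ` and `φ`, with its partial derivatives. -/
structure IsHorizonJet (f ft fθ fφ : ℝ → ℝ → ℝ → ℝ) : Prop where
  cont : ContinuousOn (fun x : ℝ × ℝ × ℝ => f x.1 x.2.1 x.2.2) {x | 0 ≤ x.1}
  cont_t : ContinuousOn (fun x : ℝ × ℝ × ℝ => ft x.1 x.2.1 x.2.2) {x | 0 ≤ x.1}
  cont_θ : ContinuousOn (fun x : ℝ × ℝ × ℝ => fθ x.1 x.2.1 x.2.2) {x | 0 ≤ x.1}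
  cont_φ : ContinuousOn (fun x : ℝ × ℝ × ℝ => fφ x.1 x.2.1 x.2.2) {x | 0 ≤ x.1}
  deriv_t : ∀ τ, 0 ≤ τ → ∀ θ φ, HasDerivAt (fun t => f t θ φ) (ft τ θ φ) τ
  deriv_θ : ∀ τ, 0 ≤ τ → ∀ θ φ, HasDerivAt (fun t => f τ t φ) (fθ τ θ φ) θ
  deriv_φ : ∀ τ, 0 ≤ τ → ∀ θ φ, HasDerivAt (fun t => f τ θ t) (fφ τ θ φ) φ
  periodic : ∀ τ θ, f τ θ (2 * Real.pi) = f τ θ 0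

theorem continuous_chart_kerrPoint (k r : ℝ) :
    Continuous fun x : ℝ × ℝ × ℝ => chart (kerrPoint k r x.1 x.2.1 x.2.2) := by
  refine continuous_pi fun i => ?_
  fin_cases i <;> simp [chart, kerrPoint] <;> fun_prop

theorem continuous_vecTheta (r : ℝ) :
    Continuous fun x : ℝ × ℝ × ℝ => vecTheta r x.2.1 x.2.2 := by
  refine continuous_pi fun i => ?_
  fin_cases i <;> simp [vecTheta] <;> fun_prop

theorem continuous_vecPhi (r : ℝ) :
    Continuous fun x : ℝ × ℝ × ℝ => vecPhi r x.2.1 x.2.2 := by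
  refine continuous_pi fun i => ?_
  fin_cases i <;> simp [vecPhi] <;> fun_prop

theorem continuous_vecW (a r : ℝ) :
    Continuous fun x : ℝ × ℝ × ℝ => vecW a r x.2.1 x.2.2 := by
  refine continuous_pi fun i => ?_
  fin_cases i <;> simp [vecW] <;> fun_prop

theorem continuous_vecN (r : ℝ) :
    Continuous fun x : ℝ × ℝ × ℝ => vecN r x.2.1 x.2.2 := by
  refine continuous_pi fun i => ?_
  fin_cases i <;> simp [vecN] <;> fun_prop

section Jets

variable {k r : ℝ} {U : Set R4}

theorem continuousOn_along {E : Type*} [TopologicalSpace E] {F : R4 → E} (hF : ContinuousOn F U)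
    (hmem : ∀ τ, 0 ≤ τ → ∀ θ φ, chart (kerrPoint k r τ θ φ) ∈ U) :
    ContinuousOn (fun x : ℝ × ℝ × ℝ => F (chart (kerrPoint k r x.1 x.2.1 x.2.2)))
      {x | 0 ≤ x.1} :=
  hF.comp (continuous_chart_kerrPoint k r).continuousOn fun x hx => hmem x.1 hx _ _

theorem isHorizonJet_scalar {f : R4 → ℝ} (hU : IsOpen U) (hf : ContDiffOn ℝ ∞ f U)
    (hmem : ∀ τ, 0 ≤ τ → ∀ θ φ, chart (kerrPoint k r τ θ φ) ∈ U) :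
    IsHorizonJet (fun τ θ φ => f (chart (kerrPoint k r τ θ φ)))
      (fun τ θ φ => fderiv ℝ f (chart (kerrPoint k r τ θ φ)) vecT)
      (fun τ θ φ => fderiv ℝ f (chart (kerrPoint k r τ θ φ)) (vecTheta r θ φ))
      (fun τ θ φ => fderiv ℝ f (chart (kerrPoint k r τ θ φ)) (vecPhi r θ φ)) := by
  have hD := continuousOn_along (hf.continuousOn_fderiv_of_isOpen hU (by simp)) hmem
  have hd : ∀ τ, 0 ≤ τ → ∀ θ φ, HasFDerivAt f (fderiv ℝ f (chart (kerrPoint k r τ θ φ)))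
      (chart (kerrPoint k r τ θ φ)) := fun τ hτ θ φ =>
    ((hf.contDiffAt (hU.mem_nhds (hmem τ hτ θ φ))).differentiableAt (by simp)).hasFDerivAt
  refine ⟨continuousOn_along hf.continuousOn hmem, hD.clm_apply continuousOn_const,
    hD.clm_apply (continuous_vecTheta r).continuousOn,
    hD.clm_apply (continuous_vecPhi r).continuousOn, fun τ hτ θ φ => ?_, fun τ hτ θ φ => ?_,
    fun τ hτ θ φ => ?_, fun τ θ => ?_⟩
  · exact (hd τ hτ θ φ).comp_hasDerivAt τ (hasDerivAt_chart_t k r τ θ φ)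
  · exact (hd τ hτ θ φ).comp_hasDerivAt θ (hasDerivAt_chart_theta k r τ θ φ)
  · exact (hd τ hτ θ φ).comp_hasDerivAt φ (hasDerivAt_chart_phi k r τ θ φ)
  · simp [kerrPoint, chart]

/-- The covector field is contracted with a vector `v` that itself turns with θ and φ, so the
product rule adds the terms with `vθ` and `vφ`. -/
theorem isHorizonJet_covector {al : OneForm} (hU : IsOpen U) (hf : ContDiffOn ℝ ∞ al U)
    (hmem : ∀ τ, 0 ≤ τ → ∀ θ φ, chart (kerrPoint k r τ θ φ) ∈ U) {v vθ vφ : ℝ → ℝ → R4}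
    (hv : Continuous fun x : ℝ × ℝ × ℝ => v x.2.1 x.2.2)
    (hvθ : Continuous fun x : ℝ × ℝ × ℝ => vθ x.2.1 x.2.2)
    (hvφ : Continuous fun x : ℝ × ℝ × ℝ => vφ x.2.1 x.2.2)
    (hdθ : ∀ θ φ, HasDerivAt (fun t => v t φ) (vθ θ φ) θ)
    (hdφ : ∀ θ φ, HasDerivAt (fun t => v θ t) (vφ θ φ) φ)
    (hper : ∀ θ, v θ (2 * Real.pi) = v θ 0) :
    IsHorizonJet (fun τ θ φ => al (chart (kerrPoint k r τ θ φ)) (v θ φ))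
      (fun τ θ φ => fderiv ℝ al (chart (kerrPoint k r τ θ φ)) vecT (v θ φ))
      (fun τ θ φ => fderiv ℝ al (chart (kerrPoint k r τ θ φ)) (vecTheta r θ φ) (v θ φ)
        + al (chart (kerrPoint k r τ θ φ)) (vθ θ φ))
      (fun τ θ φ => fderiv ℝ al (chart (kerrPoint k r τ θ φ)) (vecPhi r θ φ) (v θ φ)
        + al (chart (kerrPoint k r τ θ φ)) (vφ θ φ)) := by
  have hD := continuousOn_along (hf.continuousOn_fderiv_of_isOpen hU (by simp)) hmem
  have hC := continuousOn_along hf.continuousOn hmem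
  have hd : ∀ τ, 0 ≤ τ → ∀ θ φ, HasFDerivAt al (fderiv ℝ al (chart (kerrPoint k r τ θ φ)))
      (chart (kerrPoint k r τ θ φ)) := fun τ hτ θ φ =>
    ((hf.contDiffAt (hU.mem_nhds (hmem τ hτ θ φ))).differentiableAt (by simp)).hasFDerivAt
  have hDt : ContinuousOn (fun x : ℝ × ℝ × ℝ =>
      fderiv ℝ al (chart (kerrPoint k r x.1 x.2.1 x.2.2)) vecT) {x | 0 ≤ x.1} :=
    hD.clm_apply continuousOn_const
  have hDθ : ContinuousOn (fun x : ℝ × ℝ × ℝ =>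
      fderiv ℝ al (chart (kerrPoint k r x.1 x.2.1 x.2.2)) (vecTheta r x.2.1 x.2.2))
      {x | 0 ≤ x.1} := hD.clm_apply (continuous_vecTheta r).continuousOn
  have hDφ : ContinuousOn (fun x : ℝ × ℝ × ℝ =>
      fderiv ℝ al (chart (kerrPoint k r x.1 x.2.1 x.2.2)) (vecPhi r x.2.1 x.2.2))
      {x | 0 ≤ x.1} := hD.clm_apply (continuous_vecPhi r).continuousOn
  refine ⟨hC.clm_apply hv.continuousOn, hDt.clm_apply hv.continuousOn,
    (hDθ.clm_apply hv.continuousOn).add (hC.clm_apply hvθ.continuousOn),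
    (hDφ.clm_apply hv.continuousOn).add (hC.clm_apply hvφ.continuousOn),
    fun τ hτ θ φ => ?_, fun τ hτ θ φ => ?_, fun τ hτ θ φ => ?_, fun τ θ => ?_⟩
  · have h1 : HasDerivAt (fun t => al (chart (kerrPoint k r t θ φ)))
        (fderiv ℝ al (chart (kerrPoint k r τ θ φ)) vecT) τ :=
      (hd τ hτ θ φ).comp_hasDerivAt τ (hasDerivAt_chart_t k r τ θ φ)
    have h2 := h1.clm_apply (hasDerivAt_const τ (v θ φ))
    rwa [map_zero, add_zero] at h2
  · have h1 : HasDerivAt (fun t => al (chart (kerrPoint k r τ t φ)))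
        (fderiv ℝ al (chart (kerrPoint k r τ θ φ)) (vecTheta r θ φ)) θ :=
      (hd τ hτ θ φ).comp_hasDerivAt θ (hasDerivAt_chart_theta k r τ θ φ)
    exact h1.clm_apply (hdθ θ φ)
  · have h1 : HasDerivAt (fun t => al (chart (kerrPoint k r τ θ t)))
        (fderiv ℝ al (chart (kerrPoint k r τ θ φ)) (vecPhi r θ φ)) φ :=
      (hd τ hτ θ φ).comp_hasDerivAt φ (hasDerivAt_chart_phi k r τ θ φ)
    exact h1.clm_apply (hdφ θ φ)
  · have h1 : chart (kerrPoint k r τ θ (2 * Real.pi)) = chart (kerrPoint k r τ θ 0) := by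
      simp [kerrPoint, chart]
    simp only [h1, hper]

end Jets

/-! ## The horizontal connection in components -/

theorem nablaH_zero {a M : ℝ} (ha : |a| ≤ M) {q : R4} (hq : 0 < q 1) (hs : Real.sin (q 2) ≠ 0)
    (ς : OneForm) (X : R4) :
    nablaH a M ς q X 0 = fderiv ℝ (comp a ς 0) q X
      - leviCivita a M q X (frame a 0) (frame a 1 q) * comp a ς 1 q := by
  simp [nablaH, leviCivita_frame_self ha hq hs]

theorem nablaH_one {a M : ℝ} (ha : |a| ≤ M) {q : R4} (hq : 0 < q 1) (hs : Real.sin (q 2) ≠ 0)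
    (ς : OneForm) (X : R4) :
    nablaH a M ς q X 1 = fderiv ℝ (comp a ς 1) q X
      + leviCivita a M q X (frame a 0) (frame a 1 q) * comp a ς 0 q := by
  have := leviCivita_frame_antisymm ha hq hs X 0 1
  simp [nablaH, leviCivita_frame_self ha hq hs, eq_neg_of_add_eq_zero_right this]

theorem nablaH_smul (a M : ℝ) {ς : OneForm} {f : R4 → ℝ} {q X : R4} {B : Fin 2}
    (hf : DifferentiableAt ℝ f q) (hς : DifferentiableAt ℝ (comp a ς B) q) :
    nablaH a M (fun q' => f q' • ς q') q X B
      = f q * nablaH a M ς q X B + fderiv ℝ f q X * comp a ς B q := by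
  have h1 : ∀ C, comp a (fun q' => f q' • ς q') C = fun q' => f q' * comp a ς C q' := fun C => by
    ext q'; simp [comp]
  unfold nablaH
  simp only [h1]
  rw [fderiv_fun_mul hf hς]
  simp [mul_left_comm, mul_add, mul_sub]
  ring

theorem differentiableAt_comp_pullback {a : ℝ} {al : OneForm} {q : R4} (hq : 0 < q 1)
    (hs : Real.sin (q 2) ≠ 0) (hal : DifferentiableAt ℝ al (chart q)) (B : Fin 2) :
    DifferentiableAt ℝ (comp a (pullback al) B) q := by
  have h1 : DifferentiableAt ℝ chart q := contDiff_chart.contDiffAt.differentiableAt (by simp)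
  have h2 : DifferentiableAt ℝ (fderiv ℝ chart) q :=
    (contDiff_infty_iff_fderiv.1 contDiff_chart).2.contDiffAt.differentiableAt (by simp)
  exact (hal.comp q h1).clm_apply (h2.clm_apply (differentiableAt_frame hq hs B))

/-- Components of the fields are computed only as functions of (τ, θ, φ) at fixed r. This determines
their derivatives in every direction without ∂_r. -/
theorem fderiv_eq_of_partial {F : R4 → ℝ} {k r τ θ φ dt dθ dφ : ℝ} {X : R4}
    (hF : DifferentiableAt ℝ F (kerrPoint k r τ θ φ)) (hX : X 1 = 0)
    (ht : HasDerivAt (fun t => F (kerrPoint k r t θ φ)) dt τ)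
    (hθ : HasDerivAt (fun t => F (kerrPoint k r τ t φ)) dθ θ)
    (hφ : HasDerivAt (fun t => F (kerrPoint k r τ θ t)) dφ φ) :
    fderiv ℝ F (kerrPoint k r τ θ φ) X = X 0 * dt + X 2 * dθ + X 3 * dφ := by
  have e1 : HasDerivAt (fun t => kerrPoint k r t θ φ) ![1, 0, 0, 0] τ := by
    refine hasDerivAt_pi.2 fun i => ?_
    fin_cases i <;> simp [kerrPoint]
    · exact hasDerivAt_id τ
    all_goals exact hasDerivAt_const _ _
  have e2 : HasDerivAt (fun t => kerrPoint k r τ t φ) ![0, 0, 1, 0] θ := by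
    refine hasDerivAt_pi.2 fun i => ?_
    fin_cases i <;> simp [kerrPoint]
    any_goals exact hasDerivAt_const _ _
    exact hasDerivAt_id θ
  have e3 : HasDerivAt (fun t => kerrPoint k r τ θ t) ![0, 0, 0, 1] φ := by
    refine hasDerivAt_pi.2 fun i => ?_
    fin_cases i <;> simp [kerrPoint]
    any_goals exact hasDerivAt_const _ _
    exact hasDerivAt_id φ
  have hX' : X = X 0 • ![1, 0, 0, 0] + X 2 • ![0, 0, 1, 0] + X 3 • (![0, 0, 0, 1] : R4) := by
    ext i
    fin_cases i <;> simp [hX]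
  rw [← (hF.hasFDerivAt.comp_hasDerivAt τ e1).unique ht,
    ← (hF.hasFDerivAt.comp_hasDerivAt θ e2).unique hθ,
    ← (hF.hasFDerivAt.comp_hasDerivAt φ e3).unique hφ]
  conv_lhs => rw [hX']
  simp only [map_add, map_smul, smul_eq_mul]

/-! ## A horizontal one-form along the horizon -/

section Covector

variable (a k r : ℝ) (al : OneForm) (τ θ φ : ℝ)

/-- The contraction of the covector field with `∂_θ`, followed by its partial derivatives. -/
noncomputable def alT : ℝ := al (chart (kerrPoint k r τ θ φ)) (vecTheta r θ φ)

noncomputable def alTt : ℝ :=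
  fderiv ℝ al (chart (kerrPoint k r τ θ φ)) vecT (vecTheta r θ φ)

noncomputable def alTθ : ℝ :=
  fderiv ℝ al (chart (kerrPoint k r τ θ φ)) (vecTheta r θ φ) (vecTheta r θ φ)
    + al (chart (kerrPoint k r τ θ φ)) (-vecN r θ φ)

noncomputable def alTφ : ℝ :=
  fderiv ℝ al (chart (kerrPoint k r τ θ φ)) (vecPhi r θ φ) (vecTheta r θ φ)
    + al (chart (kerrPoint k r τ θ φ)) (Real.cos θ • (vecW a r θ φ - (a * Real.sin θ) • vecT))

/-- The contraction of the covector field with `a sin θ ∂_t + (sin θ)⁻¹ ∂_φ`, followed by its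
partial derivatives. -/
noncomputable def alW : ℝ := al (chart (kerrPoint k r τ θ φ)) (vecW a r θ φ)

noncomputable def alWt : ℝ :=
  fderiv ℝ al (chart (kerrPoint k r τ θ φ)) vecT (vecW a r θ φ)

noncomputable def alWθ : ℝ :=
  fderiv ℝ al (chart (kerrPoint k r τ θ φ)) (vecTheta r θ φ) (vecW a r θ φ)
    + al (chart (kerrPoint k r τ θ φ)) ((a * Real.cos θ) • vecT)

noncomputable def alWφ : ℝ :=
  fderiv ℝ al (chart (kerrPoint k r τ θ φ)) (vecPhi r θ φ) (vecW a r θ φ)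
    + al (chart (kerrPoint k r τ θ φ)) (-(Real.cos θ • vecTheta r θ φ) - Real.sin θ • vecN r θ φ)

/-- The part of `alTφ` that is divisible by `sin θ`. -/
noncomputable def alTb : ℝ :=
  fderiv ℝ al (chart (kerrPoint k r τ θ φ)) (vecW a r θ φ - (a * Real.sin θ) • vecT)
      (vecTheta r θ φ)
    - a * Real.cos θ * al (chart (kerrPoint k r τ θ φ)) vecT

/-- The part of `alWφ` that is divisible by `sin θ`. -/
noncomputable def alWb : ℝ :=
  fderiv ℝ al (chart (kerrPoint k r τ θ φ)) (vecW a r θ φ - (a * Real.sin θ) • vecT)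
      (vecW a r θ φ)
    - al (chart (kerrPoint k r τ θ φ)) (vecN r θ φ)

/-- The vector ∂_θ turns as φ varies, at the rate cos θ. This rotation does not vanish on the axis
and is split off; everything else inherits the factor sin θ of ∂_φ. -/
theorem alTφ_eq : alTφ a k r al τ θ φ
    = Real.sin θ * alTb a k r al τ θ φ + Real.cos θ * alW a k r al τ θ φ := by
  unfold alTφ alTb alW
  rw [vecPhi_eq a]
  simp only [map_smul, map_sub, smul_apply, sub_apply,
    smul_eq_mul]
  ring

theorem alWφ_eq : alWφ a k r al τ θ φ
    = Real.sin θ * alWb a k r al τ θ φ - Real.cos θ * alT k r al τ θ φ := by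
  unfold alWφ alWb alT
  rw [vecPhi_eq a]
  simp only [map_smul, map_sub, map_neg, smul_apply,
    sub_apply, smul_eq_mul]
  ring

end Covector

section

variable {a k r : ℝ} {al : OneForm} {U : Set R4}

theorem continuous_theta_sin : Continuous fun x : ℝ × ℝ × ℝ => Real.sin x.2.1 := by fun_prop

theorem continuous_theta_cos : Continuous fun x : ℝ × ℝ × ℝ => Real.cos x.2.1 := by fun_prop

theorem isHorizonJet_alT (hU : IsOpen U) (hf : ContDiffOn ℝ ∞ al U)
    (hmem : ∀ τ, 0 ≤ τ → ∀ θ φ, chart (kerrPoint k r τ θ φ) ∈ U) :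
    IsHorizonJet (alT k r al) (alTt k r al) (alTθ k r al) (alTφ a k r al) :=
  isHorizonJet_covector hU hf hmem (continuous_vecTheta r) (continuous_vecN r).neg
    (continuous_theta_cos.smul
      ((continuous_vecW a r).sub ((continuous_theta_sin.const_mul a).smul continuous_const)))
    (hasDerivAt_vecTheta_theta r) (hasDerivAt_vecTheta_phi a r) (fun θ => by simp [vecTheta])

theorem isHorizonJet_alW (hU : IsOpen U) (hf : ContDiffOn ℝ ∞ al U)
    (hmem : ∀ τ, 0 ≤ τ → ∀ θ φ, chart (kerrPoint k r τ θ φ) ∈ U) :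
    IsHorizonJet (alW a k r al) (alWt a k r al) (alWθ a k r al) (alWφ a k r al) :=
  isHorizonJet_covector hU hf hmem (continuous_vecW a r)
    ((continuous_theta_cos.const_mul a).smul continuous_const)
    ((continuous_theta_cos.smul (continuous_vecTheta r)).neg.sub
      (continuous_theta_sin.smul (continuous_vecN r)))
    (hasDerivAt_vecW_theta a r) (hasDerivAt_vecW_phi a r) (fun θ => by simp [vecW])

theorem continuousOn_alTb_alWb (hU : IsOpen U) (hf : ContDiffOn ℝ ∞ al U)
    (hmem : ∀ τ, 0 ≤ τ → ∀ θ φ, chart (kerrPoint k r τ θ φ) ∈ U) :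
    ContinuousOn (fun x : ℝ × ℝ × ℝ => alTb a k r al x.1 x.2.1 x.2.2) {x | 0 ≤ x.1} ∧
    ContinuousOn (fun x : ℝ × ℝ × ℝ => alWb a k r al x.1 x.2.1 x.2.2) {x | 0 ≤ x.1} := by
  have hD := continuousOn_along (hf.continuousOn_fderiv_of_isOpen hU (by simp)) hmem
  have hC := continuousOn_along hf.continuousOn hmem
  have hv : Continuous fun x : ℝ × ℝ × ℝ => vecW a r x.2.1 x.2.2 - (a * Real.sin x.2.1) • vecT :=
    (continuous_vecW a r).sub ((continuous_theta_sin.const_mul a).smul continuous_const)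
  have hDv : ContinuousOn (fun x : ℝ × ℝ × ℝ =>
      fderiv ℝ al (chart (kerrPoint k r x.1 x.2.1 x.2.2))
        (vecW a r x.2.1 x.2.2 - (a * Real.sin x.2.1) • vecT)) {x | 0 ≤ x.1} :=
    hD.clm_apply hv.continuousOn
  exact ⟨(hDv.clm_apply (continuous_vecTheta r).continuousOn).sub
      ((continuous_theta_cos.const_mul a).continuousOn.mul (hC.clm_apply continuousOn_const)),
    (hDv.clm_apply (continuous_vecW a r).continuousOn).sub
      (hC.clm_apply (continuous_vecN r).continuousOn)⟩

end

/-- A linear combination of two functions with coefficients that depend on `θ` only. -/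
def comb (u v : ℝ → ℝ) (f g : ℝ → ℝ → ℝ → ℝ) (τ θ φ : ℝ) : ℝ := u θ * f τ θ φ + v θ * g τ θ φ

theorem continuousOn_comb {u v : ℝ → ℝ} {f g : ℝ → ℝ → ℝ → ℝ} (hu : Continuous u)
    (hv : Continuous v)
    (hf : ContinuousOn (fun x : ℝ × ℝ × ℝ => f x.1 x.2.1 x.2.2) {x | 0 ≤ x.1})
    (hg : ContinuousOn (fun x : ℝ × ℝ × ℝ => g x.1 x.2.1 x.2.2) {x | 0 ≤ x.1}) :
    ContinuousOn (fun x : ℝ × ℝ × ℝ => comb u v f g x.1 x.2.1 x.2.2) {x | 0 ≤ x.1} := by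
  unfold comb
  exact ((by fun_prop : Continuous fun x : ℝ × ℝ × ℝ => u x.2.1).continuousOn.mul hf).add
    ((by fun_prop : Continuous fun x : ℝ × ℝ × ℝ => v x.2.1).continuousOn.mul hg)

theorem IsHorizonJet.comb {f ft fθ fφ g gt gθ gφ : ℝ → ℝ → ℝ → ℝ} {u u' v v' : ℝ → ℝ}
    (hf : IsHorizonJet f ft fθ fφ) (hg : IsHorizonJet g gt gθ gφ)
    (hu : ∀ θ, HasDerivAt u (u' θ) θ) (hv : ∀ θ, HasDerivAt v (v' θ) θ)
    (hu' : Continuous u') (hv' : Continuous v') :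
    IsHorizonJet (comb u v f g) (comb u v ft gt)
      (fun τ θ φ => KerrMaxwell.comb u' v' f g τ θ φ + KerrMaxwell.comb u v fθ gθ τ θ φ)
      (comb u v fφ gφ) := by
  have hu0 : Continuous u := continuous_iff_continuousAt.2 fun θ => (hu θ).continuousAt
  have hv0 : Continuous v := continuous_iff_continuousAt.2 fun θ => (hv θ).continuousAt
  refine ⟨continuousOn_comb hu0 hv0 hf.cont hg.cont, continuousOn_comb hu0 hv0 hf.cont_t hg.cont_t,
    (continuousOn_comb hu' hv' hf.cont hg.cont).add (continuousOn_comb hu0 hv0 hf.cont_θ hg.cont_θ),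
    continuousOn_comb hu0 hv0 hf.cont_φ hg.cont_φ, fun τ hτ θ φ => ?_, fun τ hτ θ φ => ?_,
    fun τ hτ θ φ => ?_, fun τ θ => ?_⟩
  · exact ((hf.deriv_t τ hτ θ φ).const_mul _).add ((hg.deriv_t τ hτ θ φ).const_mul _)
  · refine (((hu θ).mul (hf.deriv_θ τ hτ θ φ)).add ((hv θ).mul (hg.deriv_θ τ hτ θ φ))).congr_deriv ?_
    simp only [KerrMaxwell.comb]
    ring
  · exact ((hf.deriv_φ τ hτ θ φ).const_mul _).add ((hg.deriv_φ τ hτ θ φ).const_mul _)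
  · simp only [KerrMaxwell.comb, hf.periodic, hg.periodic]

/-! ### Coefficients on the horizon sphere -/

/-- `Σ` on a sphere of radius `r`. -/
noncomputable def sigH (a r θ : ℝ) : ℝ := r ^ 2 + a ^ 2 * Real.cos θ ^ 2

theorem sigH_pos {a r : ℝ} (hr : 0 < r) (θ : ℝ) : 0 < sigH a r θ := by
  unfold sigH; positivity

@[fun_prop]
theorem continuous_sigH {a r : ℝ} : Continuous (sigH a r) := by unfold sigH; fun_prop

theorem hasDerivAt_sigH (a r θ : ℝ) :
    HasDerivAt (sigH a r) (-(2 * a ^ 2 * Real.sin θ * Real.cos θ)) θ := by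
  refine ((((Real.hasDerivAt_cos θ).pow 2).const_mul (a ^ 2)).const_add (r ^ 2)).congr_deriv ?_
  simp
  ring

/-- The `∂_θ` coefficients of the frame, and their derivatives. -/
noncomputable def coX (a r θ : ℝ) : ℝ := r / sigH a r θ
noncomputable def coY (a r θ : ℝ) : ℝ := a * Real.cos θ / sigH a r θ
noncomputable def coX' (a r θ : ℝ) : ℝ := 2 * a ^ 2 * r * Real.sin θ * Real.cos θ / sigH a r θ ^ 2
noncomputable def coY' (a r θ : ℝ) : ℝ := -(a * Real.sin θ) / sigH a r θ
  + 2 * a ^ 3 * Real.sin θ * Real.cos θ ^ 2 / sigH a r θ ^ 2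

section

variable {a r : ℝ}

theorem hasDerivAt_coX (hr : 0 < r) (θ : ℝ) : HasDerivAt (coX a r) (coX' a r θ) θ := by
  have h := (sigH_pos (a := a) hr θ).ne'
  refine ((hasDerivAt_const θ r).div (hasDerivAt_sigH a r θ) h).congr_deriv ?_
  unfold coX'
  field_simp
  ring

theorem hasDerivAt_coY (hr : 0 < r) (θ : ℝ) : HasDerivAt (coY a r) (coY' a r θ) θ := by
  have h := (sigH_pos (a := a) hr θ).ne'
  refine (((Real.hasDerivAt_cos θ).const_mul a).div (hasDerivAt_sigH a r θ) h).congr_deriv ?_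
  unfold coY'
  field_simp
  ring

theorem continuous_coX (hr : 0 < r) : Continuous (coX a r) :=
  continuous_iff_continuousAt.2 fun θ => (hasDerivAt_coX hr θ).continuousAt

theorem continuous_coY (hr : 0 < r) : Continuous (coY a r) :=
  continuous_iff_continuousAt.2 fun θ => (hasDerivAt_coY hr θ).continuousAt

theorem continuous_coX' (hr : 0 < r) : Continuous (coX' a r) :=
  Continuous.div (by fun_prop) (by fun_prop) fun θ => pow_ne_zero 2 (sigH_pos hr θ).ne'

theorem continuous_coY' (hr : 0 < r) : Continuous (coY' a r) :=
  (Continuous.div (by fun_prop) (by fun_prop) fun θ => (sigH_pos hr θ).ne').add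
    (Continuous.div (by fun_prop) (by fun_prop) fun θ => pow_ne_zero 2 (sigH_pos hr θ).ne')

end

section Components

variable (a k r : ℝ) (al : OneForm)

/-- The component `α₁` on the horizon, its partial derivatives, and the part of its `φ` derivative
that is divisible by `sin θ`. -/
noncomputable def alP := comb (coX a r) (coY a r) (alT k r al) (alW a k r al)
noncomputable def alPt := comb (coX a r) (coY a r) (alTt k r al) (alWt a k r al)
noncomputable def alPθ (τ θ φ : ℝ) : ℝ :=
  comb (coX' a r) (coY' a r) (alT k r al) (alW a k r al) τ θ φ
    + comb (coX a r) (coY a r) (alTθ k r al) (alWθ a k r al) τ θ φ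
noncomputable def alPφ := comb (coX a r) (coY a r) (alTφ a k r al) (alWφ a k r al)
noncomputable def alPb := comb (coX a r) (coY a r) (alTb a k r al) (alWb a k r al)

/-- The component `α₂` on the horizon, its partial derivatives, and the part of its `φ` derivative
that is divisible by `sin θ`. -/
noncomputable def alQ := comb (fun θ => -coY a r θ) (coX a r) (alT k r al) (alW a k r al)
noncomputable def alQt := comb (fun θ => -coY a r θ) (coX a r) (alTt k r al) (alWt a k r al)
noncomputable def alQθ (τ θ φ : ℝ) : ℝ :=
  comb (fun θ => -coY' a r θ) (coX' a r) (alT k r al) (alW a k r al) τ θ φ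
    + comb (fun θ => -coY a r θ) (coX a r) (alTθ k r al) (alWθ a k r al) τ θ φ
noncomputable def alQφ := comb (fun θ => -coY a r θ) (coX a r) (alTφ a k r al) (alWφ a k r al)
noncomputable def alQb := comb (fun θ => -coY a r θ) (coX a r) (alTb a k r al) (alWb a k r al)

end Components

section

variable {a k r : ℝ} {al : OneForm} {U : Set R4}

theorem isHorizonJet_alP (hr : 0 < r) (hU : IsOpen U) (hf : ContDiffOn ℝ ∞ al U)
    (hmem : ∀ τ, 0 ≤ τ → ∀ θ φ, chart (kerrPoint k r τ θ φ) ∈ U) :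
    IsHorizonJet (alP a k r al) (alPt a k r al) (alPθ a k r al) (alPφ a k r al) :=
  (isHorizonJet_alT hU hf hmem).comb (isHorizonJet_alW hU hf hmem) (hasDerivAt_coX hr)
    (hasDerivAt_coY hr) (continuous_coX' hr) (continuous_coY' hr)

theorem isHorizonJet_alQ (hr : 0 < r) (hU : IsOpen U) (hf : ContDiffOn ℝ ∞ al U)
    (hmem : ∀ τ, 0 ≤ τ → ∀ θ φ, chart (kerrPoint k r τ θ φ) ∈ U) :
    IsHorizonJet (alQ a k r al) (alQt a k r al) (alQθ a k r al) (alQφ a k r al) :=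
  (isHorizonJet_alT hU hf hmem).comb (isHorizonJet_alW hU hf hmem)
    (fun θ => (hasDerivAt_coY hr θ).neg) (hasDerivAt_coX hr) (continuous_coY' hr).neg
    (continuous_coX' hr)

theorem alPφ_eq (τ θ φ : ℝ) : alPφ a k r al τ θ φ
    = Real.sin θ * alPb a k r al τ θ φ + Real.cos θ * alQ a k r al τ θ φ := by
  simp only [alPφ, alPb, alQ, comb, alTφ_eq, alWφ_eq]
  ring

theorem alQφ_eq (τ θ φ : ℝ) : alQφ a k r al τ θ φ
    = Real.sin θ * alQb a k r al τ θ φ - Real.cos θ * alP a k r al τ θ φ := by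
  simp only [alQφ, alQb, alP, comb, alTφ_eq, alWφ_eq]
  ring

/-- In the global chart the frame is obtained from the two vectors contracted in `alT` and `alW` by
a matrix that is smooth on the whole sphere, a rotation scaled by Σ^(-1/2). -/
theorem fderiv_chart_frame_zero {q : R4} (hq : 0 < q 1) (hs : Real.sin (q 2) ≠ 0) :
    fderiv ℝ chart q (frame a 0 q) = coX a (q 1) (q 2) • vecTheta (q 1) (q 2) (q 3)
      + coY a (q 1) (q 2) • vecW a (q 1) (q 2) (q 3) := by
  have h := (sigH_pos (a := a) hq (q 2)).ne'
  rw [fderiv_chart (frame_one a 0 q), vecPhi_eq a]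
  have h1 : Sig a q = sigH a (q 1) (q 2) := rfl
  have e0 : frame a 0 q 0 = a * Real.sin (q 2) * coY a (q 1) (q 2) := by
    simp [frame, coY, h1]; ring
  have e3 : frame a 0 q 3 * Real.sin (q 2) = coY a (q 1) (q 2) := by
    simp [frame, coY, h1]; field_simp
  have e2 : frame a 0 q 2 = coX a (q 1) (q 2) := by simp [frame, coX, h1]
  rw [smul_smul, e0, e2, e3]
  module

theorem fderiv_chart_frame_one {q : R4} (hq : 0 < q 1) (hs : Real.sin (q 2) ≠ 0) :
    fderiv ℝ chart q (frame a 1 q) = -coY a (q 1) (q 2) • vecTheta (q 1) (q 2) (q 3)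
      + coX a (q 1) (q 2) • vecW a (q 1) (q 2) (q 3) := by
  have h := (sigH_pos (a := a) hq (q 2)).ne'
  rw [fderiv_chart (frame_one a 1 q), vecPhi_eq a]
  have h1 : Sig a q = sigH a (q 1) (q 2) := rfl
  have e0 : frame a 1 q 0 = a * Real.sin (q 2) * coX a (q 1) (q 2) := by
    simp [frame, coX, h1]; ring
  have e3 : frame a 1 q 3 * Real.sin (q 2) = coX a (q 1) (q 2) := by
    simp [frame, coX, h1]; field_simp
  have e2 : frame a 1 q 2 = -coY a (q 1) (q 2) := by simp [frame, coY, h1]; ring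
  rw [smul_smul, e0, e2, e3]
  module

theorem comp_pullback_zero (hr : 0 < r) {θ : ℝ} (hs : Real.sin θ ≠ 0) (τ φ : ℝ) :
    comp a (pullback al) 0 (kerrPoint k r τ θ φ) = alP a k r al τ θ φ := by
  simp only [comp, pullback, ContinuousLinearMap.comp_apply]
  rw [fderiv_chart_frame_zero (q := kerrPoint k r τ θ φ) hr hs]
  simp [alP, KerrMaxwell.comb, alT, alW, kerrPoint]

theorem comp_pullback_one (hr : 0 < r) {θ : ℝ} (hs : Real.sin θ ≠ 0) (τ φ : ℝ) :
    comp a (pullback al) 1 (kerrPoint k r τ θ φ) = alQ a k r al τ θ φ := by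
  simp only [comp, pullback, ContinuousLinearMap.comp_apply]
  rw [fderiv_chart_frame_one (q := kerrPoint k r τ θ φ) hr hs]
  simp [alQ, KerrMaxwell.comb, alT, alW, kerrPoint]

theorem fderiv_comp_pullback (hr : 0 < r) (hU : IsOpen U) (hf : ContDiffOn ℝ ∞ al U)
    (hmem : ∀ τ, 0 ≤ τ → ∀ θ φ, chart (kerrPoint k r τ θ φ) ∈ U) {τ θ : ℝ} (hτ : 0 ≤ τ)
    (hs : Real.sin θ ≠ 0) (φ : ℝ) {X : R4} (hX : X 1 = 0) :
    fderiv ℝ (comp a (pullback al) 0) (kerrPoint k r τ θ φ) X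
        = X 0 * alPt a k r al τ θ φ + X 2 * alPθ a k r al τ θ φ + X 3 * alPφ a k r al τ θ φ ∧
    fderiv ℝ (comp a (pullback al) 1) (kerrPoint k r τ θ φ) X
        = X 0 * alQt a k r al τ θ φ + X 2 * alQθ a k r al τ θ φ + X 3 * alQφ a k r al τ θ φ := by
  have hd : DifferentiableAt ℝ al (chart (kerrPoint k r τ θ φ)) :=
    (hf.contDiffAt (hU.mem_nhds (hmem τ hτ θ φ))).differentiableAt (by simp)
  -- The formulas for the components hold off the axis only. In t and φ the angle θ is fixed, but
  -- for the θ derivative they are needed on a neighbourhood of θ.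
  have hev : ∀ᶠ t in 𝓝 θ, Real.sin t ≠ 0 := Real.continuous_sin.continuousAt.eventually_ne hs
  have hP := isHorizonJet_alP (a := a) hr hU hf hmem
  have hQ := isHorizonJet_alQ (a := a) hr hU hf hmem
  constructor
  · refine fderiv_eq_of_partial
      (differentiableAt_comp_pullback (q := kerrPoint k r τ θ φ) hr hs hd 0) hX ?_ ?_ ?_
    · simp only [comp_pullback_zero hr hs]
      exact hP.deriv_t τ hτ θ φ
    · exact (hP.deriv_θ τ hτ θ φ).congr_of_eventuallyEq
        (hev.mono fun t ht => comp_pullback_zero hr ht τ φ)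
    · simp only [comp_pullback_zero hr hs]
      exact hP.deriv_φ τ hτ θ φ
  · refine fderiv_eq_of_partial
      (differentiableAt_comp_pullback (q := kerrPoint k r τ θ φ) hr hs hd 1) hX ?_ ?_ ?_
    · simp only [comp_pullback_one hr hs]
      exact hQ.deriv_t τ hτ θ φ
    · exact (hQ.deriv_θ τ hτ θ φ).congr_of_eventuallyEq
        (hev.mono fun t ht => comp_pullback_one hr ht τ φ)
    · simp only [comp_pullback_one hr hs]
      exact hQ.deriv_φ τ hτ θ φ

end

/-! ### The horizontal derivative along the horizon -/

/-- Along e₁ and e₂ the rotation coefficient of the connection has a pole on the axis, and so has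
the rotation term in the φ derivative of the components. The poles cancel, and sin θ times these
functions is what is left. -/
noncomputable def coMu (a r θ : ℝ) : ℝ := a * (r ^ 2 - a ^ 2 * Real.cos θ ^ 2) / sigH a r θ ^ 2
noncomputable def coNu (a r θ : ℝ) : ℝ := -(2 * a ^ 2 * r * Real.cos θ) / sigH a r θ ^ 2

/-- The derivative along the first frame vector of a component with partial derivatives `ft`, `fθ`
and `sin θ * fb` up to a rotation, where `g` is the other component. -/
noncomputable def covZero (a r : ℝ) (ft fθ fb g : ℝ → ℝ → ℝ → ℝ) (τ θ φ : ℝ) : ℝ :=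
  a * Real.sin θ * coY a r θ * ft τ θ φ + coX a r θ * fθ τ θ φ + coY a r θ * fb τ θ φ
    + Real.sin θ * coMu a r θ * g τ θ φ

/-- The derivative along the second frame vector, as in `covZero`. -/
noncomputable def covOne (a r : ℝ) (ft fθ fb g : ℝ → ℝ → ℝ → ℝ) (τ θ φ : ℝ) : ℝ :=
  a * Real.sin θ * coX a r θ * ft τ θ φ - coY a r θ * fθ τ θ φ + coX a r θ * fb τ θ φ
    + Real.sin θ * coNu a r θ * g τ θ φ

/-- The derivative along `e₄` on the horizon. -/
noncomputable def genDeriv (a r : ℝ) (ft fφ : ℝ → ℝ → ℝ → ℝ) (τ θ φ : ℝ) : ℝ :=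
  2 / sigH a r θ * ((r ^ 2 + a ^ 2) * ft τ θ φ + a * fφ τ θ φ)

section

variable (a k r : ℝ) (al : OneForm)

noncomputable def nab00 := covZero a r (alPt a k r al) (alPθ a k r al) (alPb a k r al) (alQ a k r al)
noncomputable def nab01 :=
  covZero a r (alQt a k r al) (alQθ a k r al) (alQb a k r al) (-alP a k r al)
noncomputable def nab10 := covOne a r (alPt a k r al) (alPθ a k r al) (alPb a k r al) (alQ a k r al)
noncomputable def nab11 :=
  covOne a r (alQt a k r al) (alQθ a k r al) (alQb a k r al) (-alP a k r al)

/-- The horizon energy density of `r² α`. -/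
noncomputable def fluxDensity (τ θ φ : ℝ) : ℝ :=
  r ^ 4 * ((alP a k r al τ θ φ ^ 2 + alQ a k r al τ θ φ ^ 2)
    + (nab00 a k r al τ θ φ ^ 2 + nab01 a k r al τ θ φ ^ 2
      + (nab10 a k r al τ θ φ ^ 2 + nab11 a k r al τ θ φ ^ 2))
    + (genDeriv a r (alPt a k r al) (alPφ a k r al) τ θ φ ^ 2
      + genDeriv a r (alQt a k r al) (alQφ a k r al) τ θ φ ^ 2))

/-- `div (Σ α)` on the horizon. -/
noncomputable def divSig (τ θ φ : ℝ) : ℝ :=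
  alTθ k r al τ θ φ + a * Real.sin θ * alWt a k r al τ θ φ + alWb a k r al τ θ φ

/-- `curl (Σ α)` on the horizon. -/
noncomputable def curlSig (τ θ φ : ℝ) : ℝ :=
  alWθ a k r al τ θ φ - a * Real.sin θ * alTt k r al τ θ φ - alTb a k r al τ θ φ

/-- Links the form used in the conservation law to the frame derivatives that the energy controls;
the second line on the right is the derivative of Σ in the Leibniz rule. With the weight Σ, sin θ
times the left-hand side is ∂_θ(sin θ T) + ∂_φ W + a sin²θ ∂_t W. -/
theorem divSig_eq (hr : 0 < r) (τ θ φ : ℝ) : divSig a k r al τ θ φ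
    = sigH a r θ * (nab00 a k r al τ θ φ + nab11 a k r al τ θ φ)
      - 2 * a ^ 2 * Real.sin θ * Real.cos θ
        * (coX a r θ * alP a k r al τ θ φ - coY a r θ * alQ a k r al τ θ φ) := by
  have h := (sigH_pos (a := a) hr θ).ne'
  have hS : sigH a r θ = r ^ 2 + a ^ 2 * Real.cos θ ^ 2 := rfl
  have hsc := Real.sin_sq_add_cos_sq θ
  simp only [divSig, nab00, nab11, covZero, covOne, alPt, alPθ, alPb, alQt, alQθ, alQb, alP, alQ,
    comb, coX, coY, coX', coY', coMu, coNu, Pi.neg_apply]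
  generalize alTθ k r al τ θ φ = x1
  generalize alWθ a k r al τ θ φ = x2
  generalize alTt k r al τ θ φ = x3
  generalize alWt a k r al τ θ φ = x4
  generalize alTb a k r al τ θ φ = x5
  generalize alWb a k r al τ θ φ = x6
  generalize alT k r al τ θ φ = x7
  generalize alW a k r al τ θ φ = x8
  generalize Real.sin θ = s at *
  generalize Real.cos θ = c at *
  generalize sigH a r θ = S at *
  field_simp
  subst hS
  ring

theorem curlSig_eq (hr : 0 < r) (τ θ φ : ℝ) : curlSig a k r al τ θ φ
    = sigH a r θ * (nab01 a k r al τ θ φ - nab10 a k r al τ θ φ)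
      - 2 * a ^ 2 * Real.sin θ * Real.cos θ
        * (coX a r θ * alQ a k r al τ θ φ + coY a r θ * alP a k r al τ θ φ) := by
  have h := (sigH_pos (a := a) hr θ).ne'
  have hS : sigH a r θ = r ^ 2 + a ^ 2 * Real.cos θ ^ 2 := rfl
  have hsc := Real.sin_sq_add_cos_sq θ
  simp only [curlSig, nab01, nab10, covZero, covOne, alPt, alPθ, alPb, alQt, alQθ, alQb, alP, alQ,
    comb, coX, coY, coX', coY', coMu, coNu, Pi.neg_apply]
  generalize alTθ k r al τ θ φ = x1
  generalize alWθ a k r al τ θ φ = x2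
  generalize alTt k r al τ θ φ = x3
  generalize alWt a k r al τ θ φ = x4
  generalize alTb a k r al τ θ φ = x5
  generalize alWb a k r al τ θ φ = x6
  generalize alT k r al τ θ φ = x7
  generalize alW a k r al τ θ φ = x8
  generalize Real.sin θ = s at *
  generalize Real.cos θ = c at *
  generalize sigH a r θ = S at *
  field_simp
  subst hS
  ring

end

section

variable {a M k : ℝ} {al : OneForm} {U : Set R4}

theorem frame_zero_components {k r τ θ φ : ℝ} (hs : Real.sin θ ≠ 0) :
    frame a 0 (kerrPoint k r τ θ φ) 0 = a * Real.sin θ * coY a r θ ∧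
    frame a 0 (kerrPoint k r τ θ φ) 2 = coX a r θ ∧
    frame a 0 (kerrPoint k r τ θ φ) 3 = coY a r θ / Real.sin θ := by
  refine ⟨?_, ?_, ?_⟩ <;> simp [frame, kerrPoint, coX, coY, Sig, sigH]
  · ring
  · field_simp

theorem frame_one_components {k r τ θ φ : ℝ} (hs : Real.sin θ ≠ 0) :
    frame a 1 (kerrPoint k r τ θ φ) 0 = a * Real.sin θ * coX a r θ ∧
    frame a 1 (kerrPoint k r τ θ φ) 2 = -coY a r θ ∧
    frame a 1 (kerrPoint k r τ θ φ) 3 = coX a r θ / Real.sin θ := by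
  refine ⟨?_, ?_, ?_⟩ <;> simp [frame, kerrPoint, coX, coY, Sig, sigH]
  · ring
  · ring
  · field_simp

theorem sin_mul_coMu {r θ : ℝ} (hr : 0 < r) (hs : Real.sin θ ≠ 0) :
    Real.sin θ * coMu a r θ = coY a r θ / Real.sin θ * Real.cos θ
      - a / (Real.sin θ * sigH a r θ ^ 2) * (Real.cos θ ^ 2 * (r ^ 2 + a ^ 2)
          - r ^ 2 * Real.sin θ ^ 2) := by
  have h := (sigH_pos (a := a) hr θ).ne'
  have hS : sigH a r θ = r ^ 2 + a ^ 2 * Real.cos θ ^ 2 := rfl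
  have hsc : Real.sin θ ^ 2 = 1 - Real.cos θ ^ 2 := Real.sin_sq θ
  unfold coMu coY
  generalize Real.sin θ = s at *
  generalize Real.cos θ = c at *
  generalize sigH a r θ = S at *
  field_simp
  rw [hsc, hS]
  ring

theorem sin_mul_coNu {r θ : ℝ} (hr : 0 < r) (hs : Real.sin θ ≠ 0) :
    Real.sin θ * coNu a r θ = coX a r θ / Real.sin θ * Real.cos θ
      - r * Real.cos θ / (Real.sin θ * sigH a r θ ^ 2)
          * (a ^ 2 * Real.sin θ ^ 2 + r ^ 2 + a ^ 2) := by
  have h := (sigH_pos (a := a) hr θ).ne'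
  have hS : sigH a r θ = r ^ 2 + a ^ 2 * Real.cos θ ^ 2 := rfl
  have hsc : Real.sin θ ^ 2 = 1 - Real.cos θ ^ 2 := Real.sin_sq θ
  unfold coNu coX
  generalize Real.sin θ = s at *
  generalize Real.cos θ = c at *
  generalize sigH a r θ = S at *
  field_simp
  rw [hsc, hS]
  ring

/-- Identifies the covariant derivatives, defined by the singular frame, with expressions that are
continuous across the axis. The rotation term of the φ derivative combines with the connection
coefficient through `sin_mul_coMu` and `sin_mul_coNu`. -/
theorem nablaH_pullback_frame (ha : |a| ≤ M) (hr : 0 < rPlus a M) (hU : IsOpen U)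
    (hf : ContDiffOn ℝ ∞ al U)
    (hmem : ∀ τ, 0 ≤ τ → ∀ θ φ, chart (kerrPoint k (rPlus a M) τ θ φ) ∈ U) {τ θ : ℝ} (hτ : 0 ≤ τ)
    (hs : Real.sin θ ≠ 0) (φ : ℝ) :
    nablaH a M (pullback al) (kerrPoint k (rPlus a M) τ θ φ)
        (frame a 0 (kerrPoint k (rPlus a M) τ θ φ)) 0 = nab00 a k (rPlus a M) al τ θ φ ∧
    nablaH a M (pullback al) (kerrPoint k (rPlus a M) τ θ φ)
        (frame a 0 (kerrPoint k (rPlus a M) τ θ φ)) 1 = nab01 a k (rPlus a M) al τ θ φ ∧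
    nablaH a M (pullback al) (kerrPoint k (rPlus a M) τ θ φ)
        (frame a 1 (kerrPoint k (rPlus a M) τ θ φ)) 0 = nab10 a k (rPlus a M) al τ θ φ ∧
    nablaH a M (pullback al) (kerrPoint k (rPlus a M) τ θ φ)
        (frame a 1 (kerrPoint k (rPlus a M) τ θ φ)) 1 = nab11 a k (rPlus a M) al τ θ φ := by
  set r := rPlus a M
  set q := kerrPoint k r τ θ φ with hqdef
  have hq : 0 < q 1 := hr
  have hsq : Real.sin (q 2) ≠ 0 := hs
  obtain ⟨d00, d01⟩ := fderiv_comp_pullback hr hU hf hmem hτ hs φ (frame_one a 0 q)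
  obtain ⟨d10, d11⟩ := fderiv_comp_pullback hr hU hf hmem hτ hs φ (frame_one a 1 q)
  obtain ⟨a1, a2, a3⟩ := frame_zero_components (a := a) (k := k) (r := r) (τ := τ) (φ := φ) hs
  obtain ⟨b1, b2, b3⟩ := frame_one_components (a := a) (k := k) (r := r) (τ := τ) (φ := φ) hs
  have c0 := comp_pullback_zero (a := a) (k := k) (al := al) hr hs τ φ
  have c1 := comp_pullback_one (a := a) (k := k) (al := al) hr hs τ φ
  have l0 := leviCivita_frame_zero ha hq hsq
  have l1 := leviCivita_frame_one ha hq hsq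
  have m0 := sin_mul_coMu (a := a) hr hs
  have m1 := sin_mul_coNu (a := a) hr hs
  have e1 : q 1 = r := rfl
  have e2 : q 2 = θ := rfl
  have e3 : Sig a q = sigH a r θ := rfl
  rw [e1, e2, e3] at l0 l1
  have hdiv : ∀ x y : ℝ, x / Real.sin θ * (Real.sin θ * y) = x * y := fun x y => by field_simp
  rw [← hqdef] at a1 a2 a3 b1 b2 b3 c0 c1
  refine ⟨?_, ?_, ?_, ?_⟩
  · rw [nablaH_zero ha hq hsq, d00, c1, l0, a1, a2, a3, alPφ_eq]
    simp only [nab00, covZero]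
    rw [m0, mul_add, hdiv]
    ring
  · rw [nablaH_one ha hq hsq, d01, c0, l0, a1, a2, a3, alQφ_eq]
    simp only [nab01, covZero, Pi.neg_apply]
    rw [m0, mul_sub, hdiv]
    ring
  · rw [nablaH_zero ha hq hsq, d10, c1, l1, b1, b2, b3, alPφ_eq]
    simp only [nab10, covOne]
    rw [m1, mul_add, hdiv]
    ring
  · rw [nablaH_one ha hq hsq, d11, c0, l1, b1, b2, b3, alQφ_eq]
    simp only [nab11, covOne, Pi.neg_apply]
    rw [m1, mul_sub, hdiv]
    ring

theorem e4_kerrPoint (k τ θ φ : ℝ) :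
    e4 a M (kerrPoint k (rPlus a M) τ θ φ)
      = ![2 * (rPlus a M ^ 2 + a ^ 2) / sigH a (rPlus a M) θ, 0, 0,
          2 * a / sigH a (rPlus a M) θ] := by
  simp [e4, kerrPoint, Del_rPlus, Sig, sigH]

/-- The connection coefficient along e₄ vanishes on the horizon, so only derivatives of components
remain. -/
theorem nablaH_pullback_e4 (ha : |a| ≤ M) (hr : 0 < rPlus a M) (hU : IsOpen U)
    (hf : ContDiffOn ℝ ∞ al U)
    (hmem : ∀ τ, 0 ≤ τ → ∀ θ φ, chart (kerrPoint k (rPlus a M) τ θ φ) ∈ U) {τ θ : ℝ} (hτ : 0 ≤ τ)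
    (hs : Real.sin θ ≠ 0) (φ : ℝ) :
    nablaH a M (pullback al) (kerrPoint k (rPlus a M) τ θ φ)
        (e4 a M (kerrPoint k (rPlus a M) τ θ φ)) 0
      = genDeriv a (rPlus a M) (alPt a k (rPlus a M) al) (alPφ a k (rPlus a M) al) τ θ φ ∧
    nablaH a M (pullback al) (kerrPoint k (rPlus a M) τ θ φ)
        (e4 a M (kerrPoint k (rPlus a M) τ θ φ)) 1
      = genDeriv a (rPlus a M) (alQt a k (rPlus a M) al) (alQφ a k (rPlus a M) al) τ θ φ := by
  have hX : e4 a M (kerrPoint k (rPlus a M) τ θ φ) 1 = 0 := by rw [e4_kerrPoint]; simp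
  obtain ⟨d0, d1⟩ := fderiv_comp_pullback hr hU hf hmem hτ hs φ hX
  constructor
  · rw [nablaH_zero (q := kerrPoint k (rPlus a M) τ θ φ) ha hr hs,
      leviCivita_e4_frame (q := kerrPoint k (rPlus a M) τ θ φ) ha hr rfl hs, d0, e4_kerrPoint]
    simp [genDeriv]
    ring
  · rw [nablaH_one (q := kerrPoint k (rPlus a M) τ θ φ) ha hr hs,
      leviCivita_e4_frame (q := kerrPoint k (rPlus a M) τ θ φ) ha hr rfl hs, d1, e4_kerrPoint]
    simp [genDeriv]
    ring

theorem divH_curlH_eq (ha : |a| ≤ M) (hr : 0 < rPlus a M) (hU : IsOpen U)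
    (hf : ContDiffOn ℝ ∞ al U)
    (hmem : ∀ τ, 0 ≤ τ → ∀ θ φ, chart (kerrPoint k (rPlus a M) τ θ φ) ∈ U) {τ θ : ℝ} (hτ : 0 ≤ τ)
    (hs : Real.sin θ ≠ 0) (φ : ℝ) :
    divH a M (fun q' => Sig a q' • pullback al q') (kerrPoint k (rPlus a M) τ θ φ)
      = divSig a k (rPlus a M) al τ θ φ ∧
    curlH a M (fun q' => Sig a q' • pullback al q') (kerrPoint k (rPlus a M) τ θ φ)
      = curlSig a k (rPlus a M) al τ θ φ := by
  set r := rPlus a M with hrdef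
  set q := kerrPoint k r τ θ φ with hqdef
  have hd : DifferentiableAt ℝ al (chart q) :=
    (hf.contDiffAt (hU.mem_nhds (hmem τ hτ θ φ))).differentiableAt (by simp)
  have hq : 0 < q 1 := hr
  have hsq : Real.sin (q 2) ≠ 0 := hs
  have hS : ∀ X : R4, X 1 = 0 →
      fderiv ℝ (Sig a) q X = X 2 * (-2 * a ^ 2 * Real.sin θ * Real.cos θ) := fun X hX =>
    fderiv_eq_of_hasDerivAt_line differentiableAt_Sig (hasDerivAt_Sig_line a (q := q) hX)
  have hn := fun X B => nablaH_smul a M (X := X) (differentiableAt_Sig (a := a) (q := q))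
    (differentiableAt_comp_pullback (a := a) hq hsq hd B)
  obtain ⟨n0, n1, n2, n3⟩ := nablaH_pullback_frame ha hr hU hf hmem hτ hs φ
  obtain ⟨-, a2, -⟩ := frame_zero_components (a := a) (k := k) (r := r) (τ := τ) (φ := φ) hs
  obtain ⟨-, b2, -⟩ := frame_one_components (a := a) (k := k) (r := r) (τ := τ) (φ := φ) hs
  have c0 := comp_pullback_zero (a := a) (k := k) (al := al) hr hs τ φ
  have c1 := comp_pullback_one (a := a) (k := k) (al := al) hr hs τ φ
  rw [← hrdef, ← hqdef] at n0 n1 n2 n3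
  rw [← hqdef] at a2 b2
  rw [← hqdef] at c0 c1
  have e3 : Sig a q = sigH a r θ := rfl
  constructor
  · rw [divSig_eq a k r al hr, divH, Fin.sum_univ_two, hn, hn, n0, n3, hS _ (frame_one a 0 q),
      hS _ (frame_one a 1 q), a2, b2, c0, c1, e3]
    ring
  · rw [curlSig_eq a k r al hr, curlH, hn, hn, n1, n2, hS _ (frame_one a 0 q),
      hS _ (frame_one a 1 q), a2, b2, c0, c1, e3]
    ring

/-- The vectors e₁, e₂, e₄ are tangent to the horizon, so the weight r² is constant along them and
comes out as r⁴. -/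
theorem fluxDensity_eq (ha : |a| ≤ M) (hr : 0 < rPlus a M) (hU : IsOpen U)
    (hf : ContDiffOn ℝ ∞ al U)
    (hmem : ∀ τ, 0 ≤ τ → ∀ θ φ, chart (kerrPoint k (rPlus a M) τ θ φ) ∈ U) {τ θ : ℝ} (hτ : 0 ≤ τ)
    (hs : Real.sin θ ≠ 0) (φ : ℝ) :
    normSq a (fun q' => q' 1 ^ 2 • pullback al q') (kerrPoint k (rPlus a M) τ θ φ)
      + nablaNormSq a M (fun q' => q' 1 ^ 2 • pullback al q') (kerrPoint k (rPlus a M) τ θ φ)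
      + nabla4NormSq a M (fun q' => q' 1 ^ 2 • pullback al q') (kerrPoint k (rPlus a M) τ θ φ)
      = fluxDensity a k (rPlus a M) al τ θ φ := by
  set r := rPlus a M with hrdef
  set q := kerrPoint k r τ θ φ with hqdef
  have hd : DifferentiableAt ℝ al (chart q) :=
    (hf.contDiffAt (hU.mem_nhds (hmem τ hτ θ φ))).differentiableAt (by simp)
  have hq : 0 < q 1 := hr
  have hsq : Real.sin (q 2) ≠ 0 := hs
  have hdr : DifferentiableAt ℝ (fun q' : R4 => q' 1 ^ 2) q := by fun_prop
  have hR : ∀ X : R4, X 1 = 0 → fderiv ℝ (fun q' : R4 => q' 1 ^ 2) q X = 0 := fun X hX => by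
    refine fderiv_eq_of_hasDerivAt_line hdr ?_
    simp only [Pi.add_apply, Pi.smul_apply, hX, smul_zero, add_zero]
    exact hasDerivAt_const _ _
  have hn : ∀ X : R4, X 1 = 0 → ∀ B,
      nablaH a M (fun q' => q' 1 ^ 2 • pullback al q') q X B
        = r ^ 2 * nablaH a M (pullback al) q X B := fun X hX B => by
    rw [nablaH_smul a M hdr (differentiableAt_comp_pullback (a := a) hq hsq hd B), hR X hX,
      zero_mul, add_zero]
    rfl
  have hc : ∀ B, comp a (fun q' => q' 1 ^ 2 • pullback al q') B q
      = r ^ 2 * comp a (pullback al) B q := fun B => by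
    simp [comp, hqdef, kerrPoint]
  obtain ⟨n0, n1, n2, n3⟩ := nablaH_pullback_frame ha hr hU hf hmem hτ hs φ
  obtain ⟨m0, m1⟩ := nablaH_pullback_e4 ha hr hU hf hmem hτ hs φ
  have c0 := comp_pullback_zero (a := a) (k := k) (al := al) hr hs τ φ
  have c1 := comp_pullback_one (a := a) (k := k) (al := al) hr hs τ φ
  rw [← hrdef, ← hqdef] at n0 n1 n2 n3 m0 m1
  rw [← hqdef] at c0 c1
  have h4 : e4 a M q 1 = 0 := by rw [hqdef, hrdef, e4_kerrPoint]; simp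
  simp only [normSq, nablaNormSq, nabla4NormSq, Fin.sum_univ_two, hc, hn _ (frame_one a _ q),
    hn _ h4, n0, n1, n2, n3, m0, m1, c0, c1, fluxDensity]
  ring

end

/-! ### Continuity and pointwise control by the energy density -/

section

variable {a k r : ℝ} {al : OneForm} {U : Set R4}

theorem continuous_coMu (hr : 0 < r) : Continuous (coMu a r) :=
  Continuous.div (by fun_prop) (by fun_prop) fun θ => pow_ne_zero 2 (sigH_pos hr θ).ne'

theorem continuous_coNu (hr : 0 < r) : Continuous (coNu a r) :=
  Continuous.div (by fun_prop) (by fun_prop) fun θ => pow_ne_zero 2 (sigH_pos hr θ).ne'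

theorem continuousOn_genDeriv (hr : 0 < r) {ft fφ : ℝ → ℝ → ℝ → ℝ}
    (ht : ContinuousOn (fun x : ℝ × ℝ × ℝ => ft x.1 x.2.1 x.2.2) {x | 0 ≤ x.1})
    (hφ : ContinuousOn (fun x : ℝ × ℝ × ℝ => fφ x.1 x.2.1 x.2.2) {x | 0 ≤ x.1}) :
    ContinuousOn (fun x : ℝ × ℝ × ℝ => genDeriv a r ft fφ x.1 x.2.1 x.2.2) {x | 0 ≤ x.1} := by
  have h : Continuous fun x : ℝ × ℝ × ℝ => 2 / sigH a r x.2.1 :=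
    continuous_const.div (by fun_prop) fun x => (sigH_pos hr _).ne'
  exact h.continuousOn.mul ((continuousOn_const.mul ht).add (continuousOn_const.mul hφ))

theorem continuousOn_cov (hr : 0 < r) {ft fθ fb g : ℝ → ℝ → ℝ → ℝ}
    (ht : ContinuousOn (fun x : ℝ × ℝ × ℝ => ft x.1 x.2.1 x.2.2) {x | 0 ≤ x.1})
    (hθ : ContinuousOn (fun x : ℝ × ℝ × ℝ => fθ x.1 x.2.1 x.2.2) {x | 0 ≤ x.1})
    (hb : ContinuousOn (fun x : ℝ × ℝ × ℝ => fb x.1 x.2.1 x.2.2) {x | 0 ≤ x.1})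
    (hg : ContinuousOn (fun x : ℝ × ℝ × ℝ => g x.1 x.2.1 x.2.2) {x | 0 ≤ x.1}) :
    ContinuousOn (fun x : ℝ × ℝ × ℝ => covZero a r ft fθ fb g x.1 x.2.1 x.2.2) {x | 0 ≤ x.1} ∧
    ContinuousOn (fun x : ℝ × ℝ × ℝ => covOne a r ft fθ fb g x.1 x.2.1 x.2.2) {x | 0 ≤ x.1} := by
  have h1 := continuous_coX (a := a) hr
  have h2 := continuous_coY (a := a) hr
  have h3 := continuous_coMu (a := a) hr
  have h4 := continuous_coNu (a := a) hr
  unfold covZero covOne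
  constructor <;> fun_prop

theorem continuousOn_fluxDensity (hr : 0 < r) (hU : IsOpen U) (hf : ContDiffOn ℝ ∞ al U)
    (hmem : ∀ τ, 0 ≤ τ → ∀ θ φ, chart (kerrPoint k r τ θ φ) ∈ U) :
    ContinuousOn (fun x : ℝ × ℝ × ℝ => fluxDensity a k r al x.1 x.2.1 x.2.2) {x | 0 ≤ x.1} := by
  have hP := isHorizonJet_alP (a := a) hr hU hf hmem
  have hQ := isHorizonJet_alQ (a := a) hr hU hf hmem
  obtain ⟨b1, b2⟩ := continuousOn_alTb_alWb (a := a) hU hf hmem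
  have hPb := continuousOn_comb (continuous_coX (a := a) hr) (continuous_coY (a := a) hr) b1 b2
  have hQb := continuousOn_comb (continuous_coY (a := a) hr).neg (continuous_coX (a := a) hr) b1 b2
  obtain ⟨n00, n10⟩ := continuousOn_cov (a := a) hr hP.cont_t hP.cont_θ hPb hQ.cont
  obtain ⟨n01, n11⟩ := continuousOn_cov (a := a) hr hQ.cont_t hQ.cont_θ hQb (g := -alP a k r al) hP.cont.neg
  have g0 := continuousOn_genDeriv (a := a) hr hP.cont_t hP.cont_φ
  have g1 := continuousOn_genDeriv (a := a) hr hQ.cont_t hQ.cont_φ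
  exact continuousOn_const.mul ((((hP.cont.pow 2).add (hQ.cont.pow 2)).add
    (((n00.pow 2).add (n01.pow 2)).add ((n10.pow 2).add (n11.pow 2)))).add
      ((g0.pow 2).add (g1.pow 2)))

/-- Pointwise control of `div (Σ α)` and `curl (Σ α)` by the energy density. -/
theorem divSig_sq_add_curlSig_sq_le (hr : 0 < r) (har : a ^ 2 ≤ r ^ 2) (τ θ φ : ℝ) :
    divSig a k r al τ θ φ ^ 2 + curlSig a k r al τ θ φ ^ 2
      ≤ 16 * (1 + 1 / r ^ 2) * fluxDensity a k r al τ θ φ := by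
  have hS0 := sigH_pos (a := a) hr θ
  have hS : sigH a r θ = r ^ 2 + a ^ 2 * Real.cos θ ^ 2 := rfl
  have hsc := Real.sin_sq_add_cos_sq θ
  have hxy : coX a r θ ^ 2 + coY a r θ ^ 2 = 1 / sigH a r θ := by
    unfold coX coY
    field_simp
    rw [hS]
  rw [divSig_eq a k r al hr, curlSig_eq a k r al hr]
  unfold fluxDensity
  set g := genDeriv a r (alPt a k r al) (alPφ a k r al) τ θ φ ^ 2
    + genDeriv a r (alQt a k r al) (alQφ a k r al) τ θ φ ^ 2 with hg
  have hg0 : 0 ≤ g := by positivity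
  generalize nab00 a k r al τ θ φ = n00
  generalize nab01 a k r al τ θ φ = n01
  generalize nab10 a k r al τ θ φ = n10
  generalize nab11 a k r al τ θ φ = n11
  generalize alP a k r al τ θ φ = P
  generalize alQ a k r al τ θ φ = Q
  set N := n00 ^ 2 + n01 ^ 2 + (n10 ^ 2 + n11 ^ 2) with hN
  have hN0 : 0 ≤ N := by positivity
  have hPQ : 0 ≤ P ^ 2 + Q ^ 2 := by positivity
  set E := 2 * a ^ 2 * Real.sin θ * Real.cos θ with hE
  have hS2 : sigH a r θ ≤ 2 * r ^ 2 := by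
    nlinarith [mul_nonneg (sq_nonneg a) (sq_nonneg (Real.sin θ))]
  have hES : E ^ 2 / sigH a r θ ≤ 4 * r ^ 2 := by
    rw [div_le_iff₀ hS0]
    have h1 : (a * Real.cos θ) ^ 2 ≤ sigH a r θ := by rw [hS]; nlinarith [sq_nonneg r]
    have h2 : (a * Real.sin θ) ^ 2 ≤ r ^ 2 := by
      nlinarith [mul_nonneg (sq_nonneg a) (sq_nonneg (Real.cos θ))]
    calc E ^ 2 = 4 * ((a * Real.sin θ) ^ 2 * (a * Real.cos θ) ^ 2) := by rw [hE]; ring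
      _ ≤ 4 * (r ^ 2 * sigH a r θ) := by gcongr
      _ = _ := by ring
  have hr4 : sigH a r θ ^ 2 ≤ 4 * r ^ 4 := by
    calc sigH a r θ ^ 2 ≤ (2 * r ^ 2) ^ 2 := by gcongr
      _ = _ := by ring
  -- From (x + y)² ≤ 2x² + 2y², applied to the derivative and zeroth-order parts. The latter combine
  -- exactly, since (XP - YQ)² + (XQ + YP)² = (X² + Y²)(P² + Q²).
  calc _ ≤ 4 * sigH a r θ ^ 2 * N
        + 2 * E ^ 2 * ((coX a r θ ^ 2 + coY a r θ ^ 2) * (P ^ 2 + Q ^ 2)) := by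
        have h1 := sq_nonneg (sigH a r θ * (n00 + n11) + E * (coX a r θ * P - coY a r θ * Q))
        have h2 := sq_nonneg (sigH a r θ * (n01 - n10) + E * (coX a r θ * Q + coY a r θ * P))
        have h3 := mul_nonneg (sq_nonneg (sigH a r θ)) (sq_nonneg (n00 - n11))
        have h4 := mul_nonneg (sq_nonneg (sigH a r θ)) (sq_nonneg (n01 + n10))
        rw [hN]
        linear_combination h1 + h2 + 2 * h3 + 2 * h4
    _ = 4 * sigH a r θ ^ 2 * N + 2 * (E ^ 2 / sigH a r θ) * (P ^ 2 + Q ^ 2) := by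
        rw [hxy]; ring
    _ ≤ 4 * (4 * r ^ 4) * N + 2 * (4 * r ^ 2) * (P ^ 2 + Q ^ 2) := by gcongr
    -- The flux density carries r⁴, and 16(r⁴ + r²) = 16(1 + 1/r²) r⁴; the summand 1/r² pays for the
    -- zeroth-order term.
    _ ≤ 16 * (r ^ 4 + r ^ 2) * ((P ^ 2 + Q ^ 2) + N + g) := by
        have : 0 ≤ r ^ 4 := by positivity
        have : 0 ≤ r ^ 2 := by positivity
        nlinarith [mul_nonneg ‹0 ≤ r ^ 4› hPQ, mul_nonneg ‹0 ≤ r ^ 2› hPQ,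
          mul_nonneg ‹0 ≤ r ^ 2› hN0, mul_nonneg ‹0 ≤ r ^ 2› hg0, mul_nonneg ‹0 ≤ r ^ 4› hg0]
    _ = _ := by field_simp

end

/-! ## The spherical means along the horizon -/

/-- The coefficients `c` and `d` on a sphere of radius `r`. -/
noncomputable def cH (a r θ : ℝ) : ℝ := (r ^ 2 - a ^ 2 * Real.cos θ ^ 2) / sigH a r θ
noncomputable def dH (a r θ : ℝ) : ℝ := -(2 * a * r * Real.cos θ / sigH a r θ)

section

variable {a r : ℝ}

theorem cH_sq_add_dH_sq (hr : 0 < r) (θ : ℝ) : cH a r θ ^ 2 + dH a r θ ^ 2 = 1 := by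
  have h := (sigH_pos (a := a) hr θ).ne'
  have hS : sigH a r θ = r ^ 2 + a ^ 2 * Real.cos θ ^ 2 := rfl
  unfold cH dH
  field_simp
  rw [hS]
  ring

theorem continuous_cH (hr : 0 < r) : Continuous (cH a r) :=
  Continuous.div (by fun_prop) (by fun_prop) fun θ => (sigH_pos hr θ).ne'

theorem continuous_dH (hr : 0 < r) : Continuous (dH a r) :=
  (Continuous.div (by fun_prop) (by fun_prop) fun θ => (sigH_pos hr θ).ne').neg

theorem sigH_le (har : a ^ 2 ≤ r ^ 2) (θ : ℝ) : sigH a r θ ≤ 2 * r ^ 2 := by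
  have := Real.sin_sq_add_cos_sq θ
  unfold sigH
  nlinarith [mul_nonneg (sq_nonneg a) (sq_nonneg (Real.sin θ))]

/-- The mean of the derivative along `∂_t` is controlled by the derivative along `e₄`. -/
theorem sphereIntegral_deriv_sq_le {R Rt Rθ Rφ : ℝ → ℝ → ℝ → ℝ} (hr : 0 < r)
    (hR : IsHorizonJet R Rt Rθ Rφ) {τ : ℝ} (hτ : 0 ≤ τ) :
    sphereIntegral (Rt τ) ^ 2
      ≤ 4 * Real.pi * sphereIntegral (fun θ φ => genDeriv a r Rt Rφ τ θ φ ^ 2) := by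
  have ct := continuous_slice hR.cont_t hτ
  have cφ := continuous_slice hR.cont_φ hτ
  have cg := continuous_slice (continuousOn_genDeriv (a := a) hr hR.cont_t hR.cont_φ) hτ
  have hh : 0 < r ^ 2 + a ^ 2 := by positivity
  have h0 : sphereIntegral (Rφ τ) = 0 := by
    refine sphereIntegral_eq_zero_of_divergence (Y := fun _ _ => 0) (Y' := fun _ _ => 0)
      (Z := fun θ φ => Real.sin θ * R τ θ φ) (Z' := fun θ φ => Real.sin θ * Rφ τ θ φ)
      (fun θ φ => hasDerivAt_const _ _) (fun θ φ => (hR.deriv_φ τ hτ θ φ).const_mul _)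
      continuous_const (by fun_prop) (fun _ => rfl) (fun θ => by rw [hR.periodic]) ?_
    intro θ _ φ
    ring
  -- Multiplying e₄ by Σ/(2(r² + a²)) gives ∂_t + a/(r² + a²) ∂_φ, whose φ part has constant
  -- coefficient and integrates to zero. The multiplier is at most 1.
  have h1 : sphereIntegral (Rt τ) = sphereIntegral (fun θ φ =>
      sigH a r θ / (2 * (r ^ 2 + a ^ 2)) * genDeriv a r Rt Rφ τ θ φ) := by
    have e : ∀ θ φ, sigH a r θ / (2 * (r ^ 2 + a ^ 2)) * genDeriv a r Rt Rφ τ θ φ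
        = Rt τ θ φ + a / (r ^ 2 + a ^ 2) * Rφ τ θ φ := fun θ φ => by
      have := (sigH_pos (a := a) hr θ).ne'
      unfold genDeriv
      field_simp
    simp only [e]
    rw [sphereIntegral_add ct (by fun_prop), sphereIntegral_const_mul, h0, mul_zero, add_zero]
  rw [h1]
  refine (sphereIntegral_sq_le (by fun_prop)).trans ?_
  refine mul_le_mul_of_nonneg_left ?_ (by positivity)
  refine sphereIntegral_mono (by fun_prop) (by fun_prop) fun θ _ φ => ?_
  rw [mul_pow]
  refine mul_le_of_le_one_left (sq_nonneg _) ?_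
  have hS := sigH_pos (a := a) hr θ
  have h2 : sigH a r θ / (2 * (r ^ 2 + a ^ 2)) ≤ 1 := by
    rw [div_le_one (by positivity)]
    have := Real.sin_sq_add_cos_sq θ
    unfold sigH
    nlinarith [mul_nonneg (sq_nonneg a) (sq_nonneg (Real.sin θ)), sq_nonneg r, sq_nonneg a]
  exact pow_le_one₀ (by positivity) h2

/-- Decay of the spherical mean towards its limit. -/
theorem abs_sphereIntegral_sub_le {R Rt Rθ Rφ dn : ℝ → ℝ → ℝ → ℝ} {K D p : ℝ} (hr : 0 < r)
    (hR : IsHorizonJet R Rt Rθ Rφ)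
    (hdn : ContinuousOn (fun x : ℝ × ℝ × ℝ => dn x.1 x.2.1 x.2.2) {x | 0 ≤ x.1})
    (hK : 0 ≤ K) (hD : 0 ≤ D) (hp : 0 < p)
    (hle : ∀ τ, 0 ≤ τ → ∀ θ ∈ Ioo 0 Real.pi, ∀ φ,
      genDeriv a r Rt Rφ τ θ φ ^ 2 ≤ K * dn τ θ φ)
    (hflux : ∀ τ : ℝ, 0 ≤ τ → ∫⁻ s in Ioi τ, ENNReal.ofReal (sphereIntegral (dn s))
      ≤ ENNReal.ofReal (D / (1 + τ) ^ (1 + p)))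
    {τ T : ℝ} (hτ : 0 ≤ τ) (hT : τ ≤ T) :
    |sphereIntegral (R T) - sphereIntegral (R τ)|
      ≤ (1 - 2 ^ (-(p / 2)))⁻¹ * (√(4 * Real.pi * K * D) * (1 + τ) ^ (-(p / 2))) := by
  have hu : Continuous fun s => sphereIntegral (Rt (max s 0)) :=
    continuous_sphereIntegral (f := fun s => Rt (max s 0)) (continuous_clamp hR.cont_t)
  have hK' : 0 ≤ 4 * Real.pi * K := by positivity
  have husq : ∀ s, 0 ≤ s →
      sphereIntegral (Rt (max s 0)) ^ 2 ≤ 4 * Real.pi * K * sphereIntegral (dn s) := by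
    intro s hs
    rw [max_eq_left hs]
    have cg := continuous_slice (continuousOn_genDeriv (a := a) hr hR.cont_t hR.cont_φ) hs
    have cd := continuous_slice hdn hs
    refine (sphereIntegral_deriv_sq_le (a := a) hr hR hs).trans ?_
    rw [mul_assoc (4 * Real.pi), ← sphereIntegral_const_mul K (dn s)]
    exact mul_le_mul_of_nonneg_left
      (sphereIntegral_mono (by fun_prop) (by fun_prop) (hle s hs)) (by positivity)
  refine abs_sub_le_of_energy_decay (m := fun s => sphereIntegral (R s)) (by positivity) hp
    (fun τ T hτ hT => ?_) hτ hT
  have h1 : sphereIntegral (R T) - sphereIntegral (R τ)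
      = ∫ s in τ..T, sphereIntegral (Rt (max s 0)) := by
    rw [sphereIntegral_sub_eq_intervalIntegral hR.cont hR.cont_t hR.deriv_t hτ (hτ.trans hT)]
    refine intervalIntegral.integral_congr fun s hs => ?_
    rw [uIcc_of_le hT] at hs
    simp only [max_eq_left (hτ.trans hs.1)]
  simp only [h1]
  refine (sq_intervalIntegral_le hT hu).trans ?_
  refine mul_le_mul_of_nonneg_left ?_ (by linarith)
  refine (energy_le_of_flux hu hK' husq hD hflux hτ hT).trans (le_of_eq ?_)
  ring

/-- The density of the conserved charge. -/
noncomputable def chargeDensity (a r : ℝ) (R S f : ℝ → ℝ → ℝ → ℝ) (τ θ φ : ℝ) : ℝ :=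
  2 * (r ^ 2 + a ^ 2) / sigH a r θ * (cH a r θ * R τ θ φ - dH a r θ * S τ θ φ)
    - a * Real.sin θ * f τ θ φ

theorem continuousOn_chargeDensity (hr : 0 < r) {R S f : ℝ → ℝ → ℝ → ℝ}
    (hR : ContinuousOn (fun x : ℝ × ℝ × ℝ => R x.1 x.2.1 x.2.2) {x | 0 ≤ x.1})
    (hS : ContinuousOn (fun x : ℝ × ℝ × ℝ => S x.1 x.2.1 x.2.2) {x | 0 ≤ x.1})
    (hf : ContinuousOn (fun x : ℝ × ℝ × ℝ => f x.1 x.2.1 x.2.2) {x | 0 ≤ x.1}) :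
    ContinuousOn (fun x : ℝ × ℝ × ℝ => chargeDensity a r R S f x.1 x.2.1 x.2.2) {x | 0 ≤ x.1} := by
  have h : Continuous fun x : ℝ × ℝ × ℝ => 2 * (r ^ 2 + a ^ 2) / sigH a r x.2.1 :=
    continuous_const.div (by fun_prop) fun x => (sigH_pos hr _).ne'
  have h1 := continuous_cH (a := a) hr
  have h2 := continuous_dH (a := a) hr
  have h1' : Continuous fun x : ℝ × ℝ × ℝ => cH a r x.2.1 := by fun_prop
  have h2' : Continuous fun x : ℝ × ℝ × ℝ => dH a r x.2.1 := by fun_prop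
  exact (h.continuousOn.mul ((h1'.continuousOn.mul hR).sub (h2'.continuousOn.mul hS))).sub
    ((continuous_theta_sin.const_mul a).continuousOn.mul hf)

/-- The charge is conserved along the horizon. -/
theorem sphereIntegral_chargeDensity_eq {R Rt Rθ Rφ S St Sθ Sφ f₁ f₁t f₁θ f₁φ f₂ f₂t f₂θ f₂φ fb :
      ℝ → ℝ → ℝ → ℝ} (hr : 0 < r)
    (hR : IsHorizonJet R Rt Rθ Rφ) (hS : IsHorizonJet S St Sθ Sφ)
    (h₁ : IsHorizonJet f₁ f₁t f₁θ f₁φ) (h₂ : IsHorizonJet f₂ f₂t f₂θ f₂φ)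
    (hb : ∀ τ θ φ, f₂φ τ θ φ = Real.sin θ * fb τ θ φ - Real.cos θ * f₁ τ θ φ)
    (heq : ∀ τ, 0 ≤ τ → ∀ θ ∈ Ioo 0 Real.pi, ∀ φ,
      cH a r θ * genDeriv a r Rt Rφ τ θ φ - dH a r θ * genDeriv a r St Sφ τ θ φ
        = f₁θ τ θ φ + a * Real.sin θ * f₂t τ θ φ + fb τ θ φ)
    {τ : ℝ} (hτ : 0 ≤ τ) :
    sphereIntegral (chargeDensity a r R S f₂ τ) = sphereIntegral (chargeDensity a r R S f₂ 0) := by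
  rw [← sub_eq_zero, sphereIntegral_sub_eq_intervalIntegral
    (continuousOn_chargeDensity hr hR.cont hS.cont h₂.cont)
    (f' := chargeDensity a r Rt St f₂t)
    (continuousOn_chargeDensity hr hR.cont_t hS.cont_t h₂.cont_t)
    (fun t ht θ φ => ?_) le_rfl hτ]
  · rw [intervalIntegral.integral_congr (g := fun _ => 0), intervalIntegral.integral_zero]
    intro s hs
    rw [uIcc_of_le hτ] at hs
    have hs0 := hs.1
    have cR := continuous_slice hR.cont_φ hs0
    have cS := continuous_slice hS.cont_φ hs0
    have c1 := continuous_slice h₁.cont hs0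
    have c2 := continuous_slice h₂.cont_φ hs0
    have c3 := continuous_slice h₁.cont_θ hs0
    have hc := continuous_cH (a := a) hr
    have hd := continuous_dH (a := a) hr
    have hw : Continuous fun x : ℝ × ℝ => 2 * a / sigH a r x.1 :=
      continuous_const.div (by fun_prop) fun x => (sigH_pos hr _).ne'
    refine sphereIntegral_eq_zero_of_divergence
      -- The current of the conservation law. The ∂_t part of e₄ has gone into the charge density,
      -- while its ∂_φ part is a total φ derivative because Σ, c and d depend on θ only.
      (Y := fun θ φ => Real.sin θ * f₁ s θ φ)
      (Y' := fun θ φ => Real.cos θ * f₁ s θ φ + Real.sin θ * f₁θ s θ φ)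
      (Z := fun θ φ => f₂ s θ φ - Real.sin θ * (2 * a / sigH a r θ)
        * (cH a r θ * R s θ φ - dH a r θ * S s θ φ))
      (Z' := fun θ φ => f₂φ s θ φ - Real.sin θ * (2 * a / sigH a r θ)
        * (cH a r θ * Rφ s θ φ - dH a r θ * Sφ s θ φ))
      (fun θ φ => (Real.hasDerivAt_sin θ).mul (h₁.deriv_θ s hs0 θ φ))
      (fun θ φ => (h₂.deriv_φ s hs0 θ φ).sub ((((hR.deriv_φ s hs0 θ φ).const_mul _).sub
        ((hS.deriv_φ s hs0 θ φ).const_mul _)).const_mul _))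
      (by fun_prop) (by fun_prop) (fun φ => by simp)
      (fun θ => by rw [hR.periodic, hS.periodic, h₂.periodic]) ?_
    intro θ hθ φ
    have h := heq s hs0 θ hθ φ
    have h0 := (sigH_pos (a := a) hr θ).ne'
    rw [hb]
    simp only [chargeDensity, genDeriv] at h ⊢
    linear_combination Real.sin θ * h
  · exact ((((hR.deriv_t t ht θ φ).const_mul _).sub ((hS.deriv_t t ht θ φ).const_mul _)).const_mul
      _).sub ((h₂.deriv_t t ht θ φ).const_mul _)

/-- The charge differs from twice the spherical mean by terms that decay. -/
theorem sphereIntegral_chargeDensity_sub {R Rt Rθ Rφ S St Sθ Sφ f : ℝ → ℝ → ℝ → ℝ} (hr : 0 < r)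
    (hR : IsHorizonJet R Rt Rθ Rφ) (hS : IsHorizonJet S St Sθ Sφ)
    (hf : ContinuousOn (fun x : ℝ × ℝ × ℝ => f x.1 x.2.1 x.2.2) {x | 0 ≤ x.1})
    {τ : ℝ} (hτ : 0 ≤ τ) :
    sphereIntegral (chargeDensity a r R S f τ) - 2 * sphereIntegral (R τ)
      = sphereIntegral (fun θ φ =>
          2 * a ^ 2 * Real.sin θ * Real.cos θ / sigH a r θ * Rθ τ θ φ
            - 2 * r * a * Real.sin θ / sigH a r θ * Sθ τ θ φ - a * Real.sin θ * f τ θ φ) := by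
  have cR := continuous_slice hR.cont hτ
  have cS := continuous_slice hS.cont hτ
  have cRθ := continuous_slice hR.cont_θ hτ
  have cSθ := continuous_slice hS.cont_θ hτ
  have cf := continuous_slice hf hτ
  have cq := continuous_slice (continuousOn_chargeDensity (a := a) hr hR.cont hS.cont hf) hτ
  have w1 : Continuous fun θ => 2 * a ^ 2 * Real.sin θ * Real.cos θ / sigH a r θ :=
    Continuous.div (by fun_prop) (by fun_prop) fun θ => (sigH_pos hr θ).ne'
  have w2 : Continuous fun θ => 2 * r * a * Real.sin θ / sigH a r θ :=
    Continuous.div (by fun_prop) (by fun_prop) fun θ => (sigH_pos hr θ).ne'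
  have w1' : Continuous fun x : ℝ × ℝ => 2 * a ^ 2 * Real.sin x.1 * Real.cos x.1 / sigH a r x.1 :=
    w1.comp continuous_fst
  have w2' : Continuous fun x : ℝ × ℝ => 2 * r * a * Real.sin x.1 / sigH a r x.1 :=
    w2.comp continuous_fst
  have hc := continuous_cH (a := a) hr
  have hd := continuous_dH (a := a) hr
  have v1 : Continuous fun θ => 2 * (r ^ 2 + a ^ 2) / sigH a r θ :=
    Continuous.div (by fun_prop) (by fun_prop) fun θ => (sigH_pos hr θ).ne'
  have v1' : Continuous fun x : ℝ × ℝ => 2 * (r ^ 2 + a ^ 2) / sigH a r x.1 :=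
    v1.comp continuous_fst
  rw [← sphereIntegral_const_mul, ← sphereIntegral_sub cq (by fun_prop), ← sub_eq_zero,
    ← sphereIntegral_sub (by fun_prop) (by fun_prop)]
  refine sphereIntegral_eq_zero_of_divergence
    -- Integration by parts in θ. The factors of `R` and `S` are primitives of (2(r² + a²)c/Σ - 2)
    -- sin θ and of -2(r² + a²)d/Σ sin θ. They vanish at both poles, which is why the weights have
    -- means 2 and 0.
    (Y := fun θ φ => -(2 * a ^ 2 * Real.sin θ * Real.cos θ / sigH a r θ) * Real.sin θ * R τ θ φ
      + 2 * r * a * Real.sin θ / sigH a r θ * Real.sin θ * S τ θ φ)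
    (Y' := fun θ φ =>
      ((2 * (r ^ 2 + a ^ 2) / sigH a r θ * cH a r θ - 2) * Real.sin θ * R τ θ φ
        + -(2 * a ^ 2 * Real.sin θ * Real.cos θ / sigH a r θ) * Real.sin θ * Rθ τ θ φ)
      + (-(2 * (r ^ 2 + a ^ 2) / sigH a r θ * dH a r θ) * Real.sin θ * S τ θ φ
        + 2 * r * a * Real.sin θ / sigH a r θ * Real.sin θ * Sθ τ θ φ))
    (Z := fun _ _ => 0) (Z' := fun _ _ => 0) (fun θ φ => ?_)
    (fun θ φ => hasDerivAt_const _ _) (by fun_prop) continuous_const (fun φ => by simp)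
    (fun _ => rfl) ?_
  · have h0 := (sigH_pos (a := a) hr θ).ne'
    have hS' : sigH a r θ = r ^ 2 + a ^ 2 * Real.cos θ ^ 2 := rfl
    have hsc : Real.sin θ ^ 2 = 1 - Real.cos θ ^ 2 := Real.sin_sq θ
    have d1 : HasDerivAt
        (fun θ => -(2 * a ^ 2 * Real.sin θ * Real.cos θ / sigH a r θ) * Real.sin θ)
        ((2 * (r ^ 2 + a ^ 2) / sigH a r θ * cH a r θ - 2) * Real.sin θ) θ := by
      refine ((((((Real.hasDerivAt_sin θ).const_mul (2 * a ^ 2)).mul (Real.hasDerivAt_cos θ)).div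
        (hasDerivAt_sigH a r θ) h0).neg).mul (Real.hasDerivAt_sin θ)).congr_deriv ?_
      simp only [cH, Pi.neg_apply, Pi.div_apply, Pi.mul_apply]
      generalize Real.sin θ = s at *
      generalize Real.cos θ = c at *
      generalize sigH a r θ = G at *
      field_simp
      subst hS'
      grind
    have d2 : HasDerivAt
        (fun θ => 2 * r * a * Real.sin θ / sigH a r θ * Real.sin θ)
        (-(2 * (r ^ 2 + a ^ 2) / sigH a r θ * dH a r θ) * Real.sin θ) θ := by
      refine ((((Real.hasDerivAt_sin θ).const_mul (2 * r * a)).div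
        (hasDerivAt_sigH a r θ) h0).mul (Real.hasDerivAt_sin θ)).congr_deriv ?_
      simp only [dH, Pi.div_apply]
      generalize Real.sin θ = s at *
      generalize Real.cos θ = c at *
      generalize sigH a r θ = G at *
      field_simp
      subst hS'
      grind
    exact (d1.mul (hR.deriv_θ τ hτ θ φ)).add (d2.mul (hS.deriv_θ τ hτ θ φ))
  · intro θ _ φ
    unfold chargeDensity
    ring

/-- Since a² ≤ r² ≤ Σ, the weights of the two θ derivatives are at most 2 and that of `f` at most r
in absolute value. With the factor 3 for three summands the constants are 3·4·4r² = 48r² and 3·2 =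
6. -/
theorem chargeDensity_error_sq_le {R Rt Rθ Rφ S St Sθ Sφ f tr dn : ℝ → ℝ → ℝ → ℝ} (hr : 0 < r)
    (har : a ^ 2 ≤ r ^ 2)
    (hR : IsHorizonJet R Rt Rθ Rφ) (hS : IsHorizonJet S St Sθ Sφ)
    (hf : ContinuousOn (fun x : ℝ × ℝ × ℝ => f x.1 x.2.1 x.2.2) {x | 0 ≤ x.1})
    (htr : ContinuousOn (fun x : ℝ × ℝ × ℝ => tr x.1 x.2.1 x.2.2) {x | 0 ≤ x.1})
    (hdn : ContinuousOn (fun x : ℝ × ℝ × ℝ => dn x.1 x.2.1 x.2.2) {x | 0 ≤ x.1})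
    {τ : ℝ} (hτ : 0 ≤ τ)
    (htle : ∀ θ φ, Rθ τ θ φ ^ 2 + Sθ τ θ φ ^ 2 ≤ 4 * r ^ 2 * tr τ θ φ)
    (hfle : ∀ θ φ, r ^ 2 * f τ θ φ ^ 2 ≤ 2 * dn τ θ φ) :
    (sphereIntegral (chargeDensity a r R S f τ) - 2 * sphereIntegral (R τ)) ^ 2
      ≤ 4 * Real.pi * (48 * r ^ 2 * sphereIntegral (tr τ) + 6 * sphereIntegral (dn τ)) := by
  have cRθ := continuous_slice hR.cont_θ hτ
  have cSθ := continuous_slice hS.cont_θ hτ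
  have cf := continuous_slice hf hτ
  have ct := continuous_slice htr hτ
  have cd := continuous_slice hdn hτ
  have w1 : Continuous fun θ => 2 * a ^ 2 * Real.sin θ * Real.cos θ / sigH a r θ :=
    Continuous.div (by fun_prop) (by fun_prop) fun θ => (sigH_pos hr θ).ne'
  have w2 : Continuous fun θ => 2 * r * a * Real.sin θ / sigH a r θ :=
    Continuous.div (by fun_prop) (by fun_prop) fun θ => (sigH_pos hr θ).ne'
  have w1' : Continuous fun x : ℝ × ℝ => 2 * a ^ 2 * Real.sin x.1 * Real.cos x.1 / sigH a r x.1 :=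
    w1.comp continuous_fst
  have w2' : Continuous fun x : ℝ × ℝ => 2 * r * a * Real.sin x.1 / sigH a r x.1 :=
    w2.comp continuous_fst
  rw [sphereIntegral_chargeDensity_sub hr hR hS hf hτ]
  refine (sphereIntegral_sq_le (by fun_prop)).trans ?_
  refine mul_le_mul_of_nonneg_left ?_ (by positivity)
  rw [← sphereIntegral_const_mul, ← sphereIntegral_const_mul,
    ← sphereIntegral_add (by fun_prop) (by fun_prop)]
  refine sphereIntegral_mono (by fun_prop) (by fun_prop) fun θ _ φ => ?_
  have hS0 := sigH_pos (a := a) hr θ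
  have hSr : r ^ 2 ≤ sigH a r θ := by
    unfold sigH
    nlinarith [mul_nonneg (sq_nonneg a) (sq_nonneg (Real.cos θ))]
  have hsc := Real.sin_sq_add_cos_sq θ
  have hs1 : Real.sin θ ^ 2 ≤ 1 := by nlinarith [sq_nonneg (Real.cos θ)]
  have hsc1 : (Real.sin θ * Real.cos θ) ^ 2 ≤ 1 := by
    rw [mul_pow]
    exact mul_le_one₀ hs1 (sq_nonneg _) (by nlinarith [sq_nonneg (Real.sin θ)])
  have b1 : (2 * a ^ 2 * Real.sin θ * Real.cos θ / sigH a r θ) ^ 2 ≤ 4 := by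
    rw [div_pow, div_le_iff₀ (by positivity)]
    calc (2 * a ^ 2 * Real.sin θ * Real.cos θ) ^ 2
        = 4 * ((a ^ 2) ^ 2 * (Real.sin θ * Real.cos θ) ^ 2) := by ring
      _ ≤ 4 * ((sigH a r θ) ^ 2 * 1) := by gcongr; exact har.trans hSr
      _ = _ := by ring
  have b2 : (2 * r * a * Real.sin θ / sigH a r θ) ^ 2 ≤ 4 := by
    rw [div_pow, div_le_iff₀ (by positivity)]
    calc (2 * r * a * Real.sin θ) ^ 2
        = 4 * (r ^ 2 * a ^ 2 * Real.sin θ ^ 2) := by ring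
      _ ≤ 4 * (sigH a r θ * sigH a r θ * 1) := by
        gcongr
        exact har.trans hSr
      _ = _ := by ring
  have b3 : (a * Real.sin θ) ^ 2 ≤ r ^ 2 := by
    rw [mul_pow]
    nlinarith [sq_nonneg a]
  have ht := htle θ φ
  have hf' := hfle θ φ
  generalize 2 * a ^ 2 * Real.sin θ * Real.cos θ / sigH a r θ = x at *
  generalize 2 * r * a * Real.sin θ / sigH a r θ = y at *
  generalize a * Real.sin θ = z at *
  generalize Rθ τ θ φ = X at *
  generalize Sθ τ θ φ = Y at *
  generalize f τ θ φ = Z at *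
  calc (x * X - y * Y - z * Z) ^ 2 ≤ 3 * (x ^ 2 * X ^ 2 + y ^ 2 * Y ^ 2 + z ^ 2 * Z ^ 2) := by
        linarith [sq_nonneg (x * X + y * Y), sq_nonneg (x * X + z * Z), sq_nonneg (y * Y - z * Z)]
    _ ≤ 3 * (4 * X ^ 2 + 4 * Y ^ 2 + r ^ 2 * Z ^ 2) := by gcongr
    _ ≤ _ := by linarith

end

theorem IsHorizonJet.neg {f ft fθ fφ : ℝ → ℝ → ℝ → ℝ} (h : IsHorizonJet f ft fθ fφ) :
    IsHorizonJet (-f) (-ft) (-fθ) (-fφ) :=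
  ⟨h.cont.neg, h.cont_t.neg, h.cont_θ.neg, h.cont_φ.neg,
    fun τ hτ θ φ => (h.deriv_t τ hτ θ φ).neg, fun τ hτ θ φ => (h.deriv_θ τ hτ θ φ).neg,
    fun τ hτ θ φ => (h.deriv_φ τ hτ θ φ).neg, fun τ θ => by simp [h.periodic]⟩

theorem genDeriv_neg (a r : ℝ) (ft fφ : ℝ → ℝ → ℝ → ℝ) (τ θ φ : ℝ) :
    genDeriv a r (-ft) (-fφ) τ θ φ = -genDeriv a r ft fφ τ θ φ := by
  simp [genDeriv]
  ring

/-- The distance of the spherical mean to half of the conserved charge decays. -/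
theorem abs_charge_sub_le
    {R Rt Rθ Rφ S St Sθ Sφ f₁ f₁t f₁θ f₁φ f₂ f₂t f₂θ f₂φ fb tr dn : ℝ → ℝ → ℝ → ℝ}
    {a r K D p : ℝ} (hr : 0 < r) (har : a ^ 2 ≤ r ^ 2)
    (hR : IsHorizonJet R Rt Rθ Rφ) (hS : IsHorizonJet S St Sθ Sφ)
    (h₁ : IsHorizonJet f₁ f₁t f₁θ f₁φ) (h₂ : IsHorizonJet f₂ f₂t f₂θ f₂φ)
    (hb : ∀ τ θ φ, f₂φ τ θ φ = Real.sin θ * fb τ θ φ - Real.cos θ * f₁ τ θ φ)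
    (heq : ∀ τ, 0 ≤ τ → ∀ θ ∈ Ioo 0 Real.pi, ∀ φ,
      cH a r θ * genDeriv a r Rt Rφ τ θ φ - dH a r θ * genDeriv a r St Sφ τ θ φ
        = f₁θ τ θ φ + a * Real.sin θ * f₂t τ θ φ + fb τ θ φ)
    (htr : ContinuousOn (fun x : ℝ × ℝ × ℝ => tr x.1 x.2.1 x.2.2) {x | 0 ≤ x.1})
    (hdn : ContinuousOn (fun x : ℝ × ℝ × ℝ => dn x.1 x.2.1 x.2.2) {x | 0 ≤ x.1})
    (htle : ∀ τ θ φ, Rθ τ θ φ ^ 2 + Sθ τ θ φ ^ 2 ≤ 4 * r ^ 2 * tr τ θ φ)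
    (hfle : ∀ τ θ φ, r ^ 2 * f₂ τ θ φ ^ 2 ≤ 2 * dn τ θ φ)
    (hK : 0 ≤ K) (hD : 0 ≤ D) (hp : 0 < p)
    (hle : ∀ τ, 0 ≤ τ → ∀ θ ∈ Ioo 0 Real.pi, ∀ φ,
      genDeriv a r Rt Rφ τ θ φ ^ 2 ≤ K * dn τ θ φ)
    (hflux : ∀ τ : ℝ, 0 ≤ τ → ∫⁻ s in Ioi τ, ENNReal.ofReal (sphereIntegral (dn s))
      ≤ ENNReal.ofReal (D / (1 + τ) ^ (1 + p)))
    (htrans : Tendsto (fun s => sphereIntegral (tr s)) atTop (𝓝 0))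
    {τ : ℝ} (hτ : 0 ≤ τ) :
    |sphereIntegral (R τ) - sphereIntegral (chargeDensity a r R S f₂ 0) / 2|
      ≤ (1 - 2 ^ (-(p / 2)))⁻¹ * (√(4 * Real.pi * K * D) * (1 + τ) ^ (-(p / 2))) := by
  refine le_of_forall_pos_le_add fun ε hε => ?_
  -- Chosen so that the bound of `chargeDensity_error_sq_le` becomes exactly ε² when both integrals
  -- are at most δ.
  set δ := ε ^ 2 / (4 * Real.pi * (48 * r ^ 2 + 6)) with hδ
  have hδ0 : 0 < δ := by positivity
  obtain ⟨N, hN⟩ := eventually_atTop.1 (htrans.eventually_lt_const hδ0)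
  -- The transversal term is small at all late times, the flux density only at selected ones; `s` is
  -- late enough for the former and selected for the latter. One such time suffices, because the
  -- mean at τ is compared with that at `s` by the decay rate.
  obtain ⟨s, hs, hsF⟩ := exists_flux_lt (F := fun s => sphereIntegral (dn s))
    (N := max N τ) hδ0 (ne_top_of_le_ne_top ENNReal.ofReal_ne_top
      (hflux (max N τ) (hτ.trans (le_max_right _ _))))
  have hτs : τ ≤ s := (le_max_right N τ).trans hs.le
  have hs0 : 0 ≤ s := hτ.trans hτs
  have hsT := hN s ((le_max_left N τ).trans hs.le)
  have h1 := chargeDensity_error_sq_le hr har hR hS h₂.cont htr hdn hs0 (htle s) (hfle s)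
  rw [sphereIntegral_chargeDensity_eq hr hR hS h₁ h₂ hb heq hs0] at h1
  have h2 := abs_sphereIntegral_sub_le hr hR hdn hK hD hp hle hflux hτ hτs
  have h3 : |sphereIntegral (chargeDensity a r R S f₂ 0) - 2 * sphereIntegral (R s)| ≤ ε := by
    refine abs_le_of_sq_le_sq (h1.trans ?_) hε.le
    calc 4 * Real.pi * (48 * r ^ 2 * sphereIntegral (tr s) + 6 * sphereIntegral (dn s))
        ≤ 4 * Real.pi * (48 * r ^ 2 * δ + 6 * δ) := by gcongr
      _ = ε ^ 2 := by rw [hδ]; field_simp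
  rw [abs_le] at h2 h3 ⊢
  constructor <;> linarith [h2.1, h2.2, h3.1, h3.2]

/-! ## Functions along the horizon -/

section Scalar

variable (a k r : ℝ) (f : R4 → ℝ) (τ θ φ : ℝ)

/-- A function along the horizon, with its derivatives. -/
noncomputable def scal : ℝ := f (chart (kerrPoint k r τ θ φ))
noncomputable def scalT : ℝ := fderiv ℝ f (chart (kerrPoint k r τ θ φ)) vecT
noncomputable def scalTheta : ℝ := fderiv ℝ f (chart (kerrPoint k r τ θ φ)) (vecTheta r θ φ)
noncomputable def scalPhi : ℝ := fderiv ℝ f (chart (kerrPoint k r τ θ φ)) (vecPhi r θ φ)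
noncomputable def scalW : ℝ := fderiv ℝ f (chart (kerrPoint k r τ θ φ)) (vecW a r θ φ)

/-- The squared norm of the horizontal gradient. -/
noncomputable def gradSq : ℝ := (scalTheta k r f τ θ φ ^ 2 + scalW a k r f τ θ φ ^ 2) / sigH a r θ

end Scalar

section

variable {a M k : ℝ} {f : R4 → ℝ} {U : Set R4}

theorem isHorizonJet_scal {r : ℝ} (hU : IsOpen U) (hf : ContDiffOn ℝ ∞ f U)
    (hmem : ∀ τ, 0 ≤ τ → ∀ θ φ, chart (kerrPoint k r τ θ φ) ∈ U) :
    IsHorizonJet (scal k r f) (scalT k r f) (scalTheta k r f) (scalPhi k r f) :=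
  isHorizonJet_scalar hU hf hmem

theorem continuousOn_gradSq {r : ℝ} (hr : 0 < r) (hU : IsOpen U) (hf : ContDiffOn ℝ ∞ f U)
    (hmem : ∀ τ, 0 ≤ τ → ∀ θ φ, chart (kerrPoint k r τ θ φ) ∈ U) :
    ContinuousOn (fun x : ℝ × ℝ × ℝ => gradSq a k r f x.1 x.2.1 x.2.2) {x | 0 ≤ x.1} := by
  have hD := continuousOn_along (hf.continuousOn_fderiv_of_isOpen hU (by simp)) hmem
  have hW : ContinuousOn (fun x : ℝ × ℝ × ℝ => scalW a k r f x.1 x.2.1 x.2.2) {x | 0 ≤ x.1} :=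
    hD.clm_apply (continuous_vecW a r).continuousOn
  have hS : Continuous fun x : ℝ × ℝ × ℝ => sigH a r x.2.1 := by fun_prop
  exact (((isHorizonJet_scal hU hf hmem).cont_θ.pow 2).add (hW.pow 2)).div hS.continuousOn
    fun x _ => (sigH_pos hr _).ne'

theorem fderiv_comp_chart {q : R4} (hf : DifferentiableAt ℝ f (chart q)) (X : R4) :
    fderiv ℝ (f ∘ chart) q X = fderiv ℝ f (chart q) (fderiv ℝ chart q X) := by
  rw [fderiv_comp q hf (contDiff_chart.contDiffAt.differentiableAt (by simp))]
  rfl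

theorem fderiv_comp_chart_e4 {τ θ φ : ℝ}
    (hf : DifferentiableAt ℝ f (chart (kerrPoint k (rPlus a M) τ θ φ))) :
    fderiv ℝ (f ∘ chart) (kerrPoint k (rPlus a M) τ θ φ) (e4 a M (kerrPoint k (rPlus a M) τ θ φ))
      = genDeriv a (rPlus a M) (scalT k (rPlus a M) f) (scalPhi k (rPlus a M) f) τ θ φ := by
  rw [fderiv_comp_chart hf, fderiv_chart (by rw [e4_kerrPoint]; simp), e4_kerrPoint]
  simp [genDeriv, scalT, scalPhi, kerrPoint]
  ring

theorem gradSq_eq {r : ℝ} (hr : 0 < r) {τ θ φ : ℝ} (hs : Real.sin θ ≠ 0)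
    (hf : DifferentiableAt ℝ f (chart (kerrPoint k r τ θ φ))) :
    fderiv ℝ (f ∘ chart) (kerrPoint k r τ θ φ) (frame a 0 (kerrPoint k r τ θ φ)) ^ 2
      + fderiv ℝ (f ∘ chart) (kerrPoint k r τ θ φ) (frame a 1 (kerrPoint k r τ θ φ)) ^ 2
      = gradSq a k r f τ θ φ := by
  have h := (sigH_pos (a := a) hr θ).ne'
  have hS : sigH a r θ = r ^ 2 + a ^ 2 * Real.cos θ ^ 2 := rfl
  rw [fderiv_comp_chart hf, fderiv_comp_chart hf,
    fderiv_chart_frame_zero (q := kerrPoint k r τ θ φ) hr hs,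
    fderiv_chart_frame_one (q := kerrPoint k r τ θ φ) hr hs]
  have h0 : fderiv ℝ f (chart (kerrPoint k r τ θ φ)) (vecTheta r θ φ)
    = scalTheta k r f τ θ φ := rfl
  have h1 : fderiv ℝ f (chart (kerrPoint k r τ θ φ)) (vecW a r θ φ)
    = scalW a k r f τ θ φ := rfl
  have e1 : kerrPoint k r τ θ φ 1 = r := rfl
  have e2 : kerrPoint k r τ θ φ 2 = θ := rfl
  have e3 : kerrPoint k r τ θ φ 3 = φ := rfl
  rw [e1, e2, e3]
  simp only [map_add, map_smul, smul_eq_mul, h0, h1, gradSq, coX, coY]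
  generalize scalTheta k r f τ θ φ = x
  generalize scalW a k r f τ θ φ = y
  field_simp
  rw [hS]
  ring

end

/-! ## The equations on the horizon -/

section

variable {a M : ℝ} {ι ζ : ℝ → ℝ}

theorem radius_chart_kerrPoint {k r : ℝ} (hr : 0 ≤ r) (τ θ φ : ℝ) :
    radius (chart (kerrPoint k r τ θ φ)) = r := by
  have h1 := Real.sin_sq_add_cos_sq θ
  have h2 := Real.sin_sq_add_cos_sq φ
  unfold radius
  rw [show chart (kerrPoint k r τ θ φ) 1 ^ 2 + chart (kerrPoint k r τ θ φ) 2 ^ 2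
      + chart (kerrPoint k r τ θ φ) 3 ^ 2 = r ^ 2 from ?_, Real.sqrt_sq hr]
  simp [chart, kerrPoint]
  linear_combination r ^ 2 * Real.sin θ ^ 2 * h2 + r ^ 2 * h1

theorem chart_mem_futureRegion (hr : 0 < rPlus a M) {τ : ℝ} (hτ : 0 ≤ τ) (θ φ : ℝ) :
    chart (kerrPoint (height a M ι ζ (rPlus a M)) (rPlus a M) τ θ φ) ∈ futureRegion a M ι ζ := by
  simp only [futureRegion, mem_ofPred_eq, radius_chart_kerrPoint hr.le]
  simpa [chart, kerrPoint] using hτ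

theorem chart_mem_initialSphere (hr : 0 < rPlus a M) (θ φ : ℝ) :
    chart (kerrPoint (height a M ι ζ (rPlus a M)) (rPlus a M) 0 θ φ) ∈ initialSphere a M ι ζ := by
  simp only [initialSphere, mem_ofPred_eq, radius_chart_kerrPoint hr.le]
  simp [chart, kerrPoint]

/-- Replaces the integrand by one that is continuous on whole spheres; the poles carry the weight
sin θ = 0. -/
theorem alphaFlux_top {S : Fields} (ha : |a| ≤ M) (hr : 0 < rPlus a M)
    (hS : IsModifiedSolution a M ι ζ S) {τ : ℝ} (hτ : 0 ≤ τ) :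
    alphaFlux a M ι ζ S τ ⊤ = ∫⁻ s in Ioi τ, ENNReal.ofReal (sphereIntegral
      (fluxDensity a (height a M ι ζ (rPlus a M)) (rPlus a M) S.al s)) := by
  obtain ⟨U, hU, hsub, hal, -, -, -⟩ := hS.smooth
  have hset : {s : ℝ | τ < s ∧ (s : EReal) < ⊤} = Ioi τ := by
    ext s
    simp [EReal.coe_lt_top]
  unfold alphaFlux horizonFlux
  rw [hset]
  refine setLIntegral_congr_fun measurableSet_Ioi fun s hs => ?_
  congr 1
  refine sphereIntegral_congr fun θ hθ φ => ?_
  exact fluxDensity_eq ha hr hU hal (fun τ hτ θ φ => hsub (chart_mem_futureRegion hr hτ θ φ))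
    (hτ.trans (le_of_lt hs)) (Real.sin_pos_of_mem_Ioo hθ).ne' φ

/-- The gradient equations express (∇̸ρ̂, ∇̸σ̂) by 𝔗 - 𝔗̲ and ⋆(𝔗 + 𝔗̲) through an orthogonal matrix
in c and d. The parallelogram law then gives |∇̸ρ̂|² + |∇̸σ̂|² = 2(|𝔗|² + |𝔗̲|²). -/
theorem transversalL2Sq_eq {S : Fields} (ha : |a| ≤ M) (hr : 0 < rPlus a M)
    (hS : IsModifiedSolution a M ι ζ S) {τ : ℝ} (hτ : 0 ≤ τ) :
    transversalL2Sq a M ι ζ S τ = sphereIntegral fun θ φ => 1 / 2 *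
      (gradSq a (height a M ι ζ (rPlus a M)) (rPlus a M) S.rho τ θ φ
        + gradSq a (height a M ι ζ (rPlus a M)) (rPlus a M) S.sigma τ θ φ) := by
  obtain ⟨U, hU, hsub, -, -, hrho, hsig⟩ := hS.smooth
  unfold transversalL2Sq
  refine sphereIntegral_congr fun θ hθ φ => ?_
  change (∑ A : Fin 2, fT a M (pullback S.al)
      (kerrPoint (height a M ι ζ (rPlus a M)) (rPlus a M) τ θ φ) A ^ 2)
    + ∑ A : Fin 2, fTBar a M (pullback S.alb)
      (kerrPoint (height a M ι ζ (rPlus a M)) (rPlus a M) τ θ φ) A ^ 2 = _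
  set k := height a M ι ζ (rPlus a M) with hk
  set q := kerrPoint k (rPlus a M) τ θ φ with hq
  have hs := (Real.sin_pos_of_mem_Ioo hθ).ne'
  have hm := hsub (chart_mem_futureRegion (ι := ι) (ζ := ζ) hr hτ θ φ)
  have eqs := hS.maxwell q le_rfl (by rw [hq]; simpa [kerrPoint, ← hk] using hτ) hθ
  have hcd := coefC_sq_add_coefD_sq ha (q := q) hr hs
  rw [← gradSq_eq hr hs ((hrho.contDiffAt (hU.mem_nhds hm)).differentiableAt (by simp)),
    ← gradSq_eq hr hs ((hsig.contDiffAt (hU.mem_nhds hm)).differentiableAt (by simp)), ← hq,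
    eqs.eA_rho, eqs.eA_rho, eqs.eA_sigma, eqs.eA_sigma]
  simp only [hodge, Fin.sum_univ_two, Matrix.cons_val_zero, Matrix.cons_val_one,
    Matrix.cons_val_fin_one]
  generalize fT a M (pullback S.al) q 0 = t0
  generalize fT a M (pullback S.al) q 1 = t1
  generalize fTBar a M (pullback S.alb) q 0 = u0
  generalize fTBar a M (pullback S.alb) q 1 = u1
  linear_combination (-(t0 ^ 2 + t1 ^ 2 + u0 ^ 2 + u1 ^ 2)) * hcd

/-- The equations for the derivatives along `e₄` on the horizon, solved for the divergence and the
curl. -/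
theorem genDeriv_eqs {S : Fields} (ha : |a| ≤ M) (hr : 0 < rPlus a M)
    (hS : IsModifiedSolution a M ι ζ S) {τ θ : ℝ} (hτ : 0 ≤ τ) (hθ : θ ∈ Ioo 0 Real.pi) (φ : ℝ)
    {k : ℝ} (hk : k = height a M ι ζ (rPlus a M)) {r : ℝ} (hrr : r = rPlus a M) :
    cH a r θ * genDeriv a r (scalT k r S.rho) (scalPhi k r S.rho) τ θ φ
        - dH a r θ * genDeriv a r (scalT k r S.sigma) (scalPhi k r S.sigma) τ θ φ
      = divSig a k r S.al τ θ φ ∧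
    cH a r θ * genDeriv a r (scalT k r S.sigma) (scalPhi k r S.sigma) τ θ φ
        + dH a r θ * genDeriv a r (scalT k r S.rho) (scalPhi k r S.rho) τ θ φ
      = -curlSig a k r S.al τ θ φ := by
  obtain ⟨U, hU, hsub, hal, -, hrho, hsig⟩ := hS.smooth
  have hmem : ∀ τ, 0 ≤ τ → ∀ θ φ, chart (kerrPoint k (rPlus a M) τ θ φ) ∈ U :=
    fun τ hτ θ φ => hsub (hk ▸ chart_mem_futureRegion hr hτ θ φ)
  have hs := (Real.sin_pos_of_mem_Ioo hθ).ne'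
  have hn := hU.mem_nhds (hmem τ hτ θ φ)
  have eqs := hS.maxwell (kerrPoint k (rPlus a M) τ θ φ) le_rfl
    (by simpa [kerrPoint, ← hk] using hτ) hθ
  obtain ⟨d1, d2⟩ := divH_curlH_eq ha hr hU hal hmem hτ hs φ
  have e1 := eqs.e4_rho
  have e2 := eqs.e4_sigma
  rw [d1, d2, fderiv_comp_chart_e4 ((hrho.contDiffAt hn).differentiableAt (by simp)),
    coefC_eq ha (q := kerrPoint k (rPlus a M) τ θ φ) hr hs,
    coefD_eq ha (q := kerrPoint k (rPlus a M) τ θ φ) hr hs] at e1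
  rw [d1, d2, fderiv_comp_chart_e4 ((hsig.contDiffAt hn).differentiableAt (by simp)),
    coefC_eq ha (q := kerrPoint k (rPlus a M) τ θ φ) hr hs,
    coefD_eq ha (q := kerrPoint k (rPlus a M) τ θ φ) hr hs] at e2
  have ec : (kerrPoint k (rPlus a M) τ θ φ 1 ^ 2
      - a ^ 2 * Real.cos (kerrPoint k (rPlus a M) τ θ φ 2) ^ 2)
      / Sig a (kerrPoint k (rPlus a M) τ θ φ) = cH a (rPlus a M) θ := rfl
  have ed : -(2 * a * kerrPoint k (rPlus a M) τ θ φ 1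
      * Real.cos (kerrPoint k (rPlus a M) τ θ φ 2)
      / Sig a (kerrPoint k (rPlus a M) τ θ φ)) = dH a (rPlus a M) θ := rfl
  rw [ec, ed] at e1 e2
  have hcd := cH_sq_add_dH_sq (a := a) hr θ
  subst hrr
  rw [e1, e2]
  constructor
  · linear_combination divSig a k (rPlus a M) S.al τ θ φ * hcd
  · linear_combination (-curlSig a k (rPlus a M) S.al τ θ φ) * hcd

/-- With Δ = 0 the factor Σ of g_θθ cancels the one in g_φφ. The induced area form is a constant
multiple of dΩ, so after rescaling it is dΩ. -/
theorem areaDensity_horizon (hr : 0 < rPlus a M) {θ : ℝ} (hθ : θ ∈ Icc 0 Real.pi) (τ φ : ℝ) :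
    areaDensity a M (horizonPoint a M ι ζ τ θ φ) = (rPlus a M ^ 2 + a ^ 2) * Real.sin θ := by
  have h : (rPlus a M ^ 2 + a ^ 2 * Real.cos θ ^ 2) ≠ 0 := by positivity
  have hs := Real.sin_nonneg_of_mem_Icc hθ
  unfold areaDensity
  rw [← Real.sqrt_sq (mul_nonneg (by positivity : 0 ≤ rPlus a M ^ 2 + a ^ 2) hs)]
  congr 1
  simp [kerrMetric, horizonPoint, Sig, Del_rPlus]
  field_simp

theorem horizonL2Sq_eq (hr : 0 < rPlus a M) (f : R4 → ℝ) (τ : ℝ) :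
    horizonL2Sq a M ι ζ (f ∘ chart) τ = sphereIntegral fun θ φ =>
      scal (height a M ι ζ (rPlus a M)) (rPlus a M) f τ θ φ ^ 2 := by
  have hh : 0 < rPlus a M ^ 2 + a ^ 2 := by positivity
  have key : ∀ g : ℝ → ℝ → ℝ, (∫ φ in (0 : ℝ)..2 * Real.pi, ∫ θ in (0 : ℝ)..Real.pi,
      g θ φ * areaDensity a M (horizonPoint a M ι ζ τ θ φ))
      = (rPlus a M ^ 2 + a ^ 2) * sphereIntegral g := fun g => by
    rw [← sphereIntegral_const_mul]
    refine intervalIntegral.integral_congr fun φ _ => intervalIntegral.integral_congr fun θ hθ => ?_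
    rw [uIcc_of_le Real.pi_pos.le] at hθ
    simp only [areaDensity_horizon hr hθ]
    ring
  have h1 := key fun _ _ => 1
  simp only [one_mul] at h1
  unfold horizonL2Sq
  rw [key, h1, sphereIntegral_const]
  have hpi := Real.pi_pos
  field_simp
  rfl

end

/-! ## The charges as functions of the seed data -/

section

variable {a M : ℝ} {ι ζ : ℝ → ℝ}

open Classical in
/-- Extension by zero of a function on the initial horizon sphere. -/
noncomputable def extendByZero {E : Type*} [Zero E] (f : initialSphere a M ι ζ → E) (p : R4) : E :=
  if h : p ∈ initialSphere a M ι ζ then f ⟨p, h⟩ else 0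

theorem extendByZero_chart {E : Type*} [Zero E] (hr : 0 < rPlus a M)
    (f : initialSphere a M ι ζ → E) (g : R4 → E) (h : ∀ p : initialSphere a M ι ζ, f p = g p)
    (θ φ : ℝ) :
    extendByZero f (chart (kerrPoint (height a M ι ζ (rPlus a M)) (rPlus a M) 0 θ φ))
      = g (chart (kerrPoint (height a M ι ζ (rPlus a M)) (rPlus a M) 0 θ φ)) := by
  rw [extendByZero, dif_pos (chart_mem_initialSphere hr θ φ), h]

/-- The charges `𝔮₁` and `𝔮₂` of the seed data on the initial horizon sphere. -/
noncomputable def HorizonSeed.chargeRho (H : HorizonSeed a M ι ζ) : ℝ :=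
  1 / (8 * Real.pi) * sphereIntegral (chargeDensity a (rPlus a M)
    (scal (height a M ι ζ (rPlus a M)) (rPlus a M) (extendByZero H.rho))
    (scal (height a M ι ζ (rPlus a M)) (rPlus a M) (extendByZero H.sigma))
    (alW a (height a M ι ζ (rPlus a M)) (rPlus a M) (extendByZero H.al)) 0)

/-- Obtained from `chargeRho` by the duality (ρ̂, σ̂, W) ↦ (σ̂, -ρ̂, T). The factor 1/(8π) in both
arises because the charge tends to twice the spherical integral, while a constant q has spherical
integral 4πq. -/
noncomputable def HorizonSeed.chargeSigma (H : HorizonSeed a M ι ζ) : ℝ :=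
  1 / (8 * Real.pi) * sphereIntegral (chargeDensity a (rPlus a M)
    (scal (height a M ι ζ (rPlus a M)) (rPlus a M) (extendByZero H.sigma))
    (-scal (height a M ι ζ (rPlus a M)) (rPlus a M) (extendByZero H.rho))
    (alT (height a M ι ζ (rPlus a M)) (rPlus a M) (extendByZero H.al)) 0)

theorem chargeRho_seed (hr : 0 < rPlus a M) (S : Fields) :
    (S.seed a M ι ζ).onHorizon.chargeRho = 1 / (8 * Real.pi) *
      sphereIntegral (chargeDensity a (rPlus a M)
        (scal (height a M ι ζ (rPlus a M)) (rPlus a M) S.rho)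
        (scal (height a M ι ζ (rPlus a M)) (rPlus a M) S.sigma)
        (alW a (height a M ι ζ (rPlus a M)) (rPlus a M) S.al) 0) := by
  have h1 := extendByZero_chart hr (S.seed a M ι ζ).onHorizon.rho S.rho fun _ => rfl
  have h2 := extendByZero_chart hr (S.seed a M ι ζ).onHorizon.sigma S.sigma fun _ => rfl
  have h3 := extendByZero_chart hr (S.seed a M ι ζ).onHorizon.al S.al fun _ => rfl
  unfold HorizonSeed.chargeRho
  congr 2
  ext θ φ
  simp only [chargeDensity, scal, alW, h1, h2, h3]

theorem chargeSigma_seed (hr : 0 < rPlus a M) (S : Fields) :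
    (S.seed a M ι ζ).onHorizon.chargeSigma = 1 / (8 * Real.pi) *
      sphereIntegral (chargeDensity a (rPlus a M)
        (scal (height a M ι ζ (rPlus a M)) (rPlus a M) S.sigma)
        (-scal (height a M ι ζ (rPlus a M)) (rPlus a M) S.rho)
        (alT (height a M ι ζ (rPlus a M)) (rPlus a M) S.al) 0) := by
  have h1 := extendByZero_chart hr (S.seed a M ι ζ).onHorizon.rho S.rho fun _ => rfl
  have h2 := extendByZero_chart hr (S.seed a M ι ζ).onHorizon.sigma S.sigma fun _ => rfl
  have h3 := extendByZero_chart hr (S.seed a M ι ζ).onHorizon.al S.al fun _ => rfl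
  unfold HorizonSeed.chargeSigma
  congr 2
  ext θ φ
  simp only [chargeDensity, scal, alT, Pi.neg_apply, h1, h2, h3]

/-- The pairs (T, W) and (α₁, α₂) differ by a rotation and the scaling √Σ, and Σ ≤ 2r². -/
theorem alT_sq_add_alW_sq_le {k r : ℝ} (hr : 0 < r) (har : a ^ 2 ≤ r ^ 2) (al : OneForm)
    (τ θ φ : ℝ) : r ^ 2 * (alT k r al τ θ φ ^ 2 + alW a k r al τ θ φ ^ 2)
      ≤ 2 * fluxDensity a k r al τ θ φ := by
  have h := (sigH_pos (a := a) hr θ).ne'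
  have hS : sigH a r θ = r ^ 2 + a ^ 2 * Real.cos θ ^ 2 := rfl
  have h1 : alT k r al τ θ φ ^ 2 + alW a k r al τ θ φ ^ 2
      = sigH a r θ * (alP a k r al τ θ φ ^ 2 + alQ a k r al τ θ φ ^ 2) := by
    simp only [alP, alQ, comb, coX, coY]
    field_simp
    rw [hS]
    ring
  have h2 : r ^ 4 * (alP a k r al τ θ φ ^ 2 + alQ a k r al τ θ φ ^ 2)
      ≤ fluxDensity a k r al τ θ φ := by
    unfold fluxDensity
    refine mul_le_mul_of_nonneg_left ?_ (by positivity)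
    rw [add_assoc]
    exact le_add_of_nonneg_right (by positivity)
  have h3 := sigH_le har θ
  rw [h1]
  calc r ^ 2 * (sigH a r θ * (alP a k r al τ θ φ ^ 2 + alQ a k r al τ θ φ ^ 2))
      ≤ r ^ 2 * ((2 * r ^ 2) * (alP a k r al τ θ φ ^ 2 + alQ a k r al τ θ φ ^ 2)) := by gcongr
    _ = 2 * (r ^ 4 * (alP a k r al τ θ φ ^ 2 + alQ a k r al τ θ φ ^ 2)) := by ring
    _ ≤ _ := by gcongr

theorem fluxDensity_nonneg (k r : ℝ) (al : OneForm) (τ θ φ : ℝ) :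
    0 ≤ fluxDensity a k r al τ θ φ := by
  unfold fluxDensity
  positivity

theorem scalTheta_sq_le {k r : ℝ} (hr : 0 < r) (har : a ^ 2 ≤ r ^ 2) (f g : R4 → ℝ) (τ θ φ : ℝ) :
    scalTheta k r f τ θ φ ^ 2 + scalTheta k r g τ θ φ ^ 2
      ≤ 4 * r ^ 2 * (1 / 2 * (gradSq a k r f τ θ φ + gradSq a k r g τ θ φ)) := by
  have h := sigH_pos (a := a) hr θ
  have h3 := sigH_le har θ
  have key : ∀ f : R4 → ℝ, scalTheta k r f τ θ φ ^ 2 ≤ 2 * r ^ 2 * gradSq a k r f τ θ φ := by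
    intro f
    calc scalTheta k r f τ θ φ ^ 2 ≤ sigH a r θ * gradSq a k r f τ θ φ := by
          unfold gradSq
          rw [mul_div_cancel₀ _ h.ne']
          exact le_add_of_nonneg_right (sq_nonneg _)
      _ ≤ _ := by
          have : 0 ≤ gradSq a k r f τ θ φ := by unfold gradSq; positivity
          gcongr
  linarith [key f, key g]

/-- The constant relating the energy flux to the derivatives of the spherical means. -/
noncomputable def fluxConst (M : ℝ) : ℝ := 16 * (1 + 1 / M ^ 2)

/-- The decay rate of the spherical means towards their limits. -/
noncomputable def meanRate (M p D τ : ℝ) : ℝ :=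
  (1 - 2 ^ (-(p / 2)))⁻¹ * (√(4 * Real.pi * fluxConst M * D) * (1 + τ) ^ (-(p / 2)))

theorem fluxConst_pos {M : ℝ} : 0 < fluxConst M := by unfold fluxConst; positivity

theorem meanRate_sq {M p D τ : ℝ} (hD : 0 ≤ D) (hτ : 0 ≤ τ) :
    meanRate M p D τ ^ 2
      = (1 - 2 ^ (-(p / 2)))⁻¹ ^ 2 * (4 * Real.pi * fluxConst M) * (D / (1 + τ) ^ p) := by
  have hpos : 0 < 1 + τ := by linarith
  have := fluxConst_pos (M := M)
  unfold meanRate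
  rw [mul_pow, mul_pow, Real.sq_sqrt (by positivity), ← Real.rpow_natCast ((1 + τ) ^ _),
    ← Real.rpow_mul hpos.le, show -(p / 2) * ((2 : ℕ) : ℝ) = -p by push_cast; ring,
    Real.rpow_neg hpos.le]
  ring

/-- Decay of the spherical means of a modified solution on the horizon. -/
theorem modes_estimates {S : Fields} {p D : ℝ} (hM : 0 < M) (ha : |a| ≤ M) (hp : 0 < p)
    (hD : 0 ≤ D) (hS : IsModifiedSolution a M ι ζ S)
    (htrans : Tendsto (transversalL2Sq a M ι ζ S) atTop (𝓝 0))
    (hflux : ∀ τ : ℝ, 0 ≤ τ →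
      alphaFlux a M ι ζ S τ ⊤ ≤ ENNReal.ofReal (D / (1 + τ) ^ (1 + p)))
    {τ : ℝ} (hτ : 0 ≤ τ) :
    (|rhoMode a M ι ζ S τ - rhoMode a M ι ζ S 0| ≤ meanRate M p D 0 ∧
      |sigmaMode a M ι ζ S τ - sigmaMode a M ι ζ S 0| ≤ meanRate M p D 0) ∧
    |rhoMode a M ι ζ S τ - 4 * Real.pi * (S.seed a M ι ζ).onHorizon.chargeRho|
      ≤ meanRate M p D τ ∧
    |sigmaMode a M ι ζ S τ - 4 * Real.pi * (S.seed a M ι ζ).onHorizon.chargeSigma|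
      ≤ meanRate M p D τ := by
  have hMr : M ≤ rPlus a M := rPlus_ge
  have hr : 0 < rPlus a M := hM.trans_le hMr
  have har : a ^ 2 ≤ rPlus a M ^ 2 := by
    rw [← sq_abs a]
    exact pow_le_pow_left₀ (abs_nonneg a) (ha.trans hMr) 2
  rw [chargeRho_seed hr, chargeSigma_seed hr]
  obtain ⟨U, hU, hsub, hal, -, hrho, hsig⟩ := hS.smooth
  have hT := fun t (ht : 0 ≤ t) => transversalL2Sq_eq (τ := t) ha hr hS ht
  have hF := fun t (ht : 0 ≤ t) => alphaFlux_top (τ := t) ha hr hS ht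
  have heqs := fun t θ (ht : 0 ≤ t) hθ φ => genDeriv_eqs (τ := t) (θ := θ) ha hr hS ht hθ φ rfl rfl
  have hmem : ∀ τ, 0 ≤ τ → ∀ θ φ,
      chart (kerrPoint (height a M ι ζ (rPlus a M)) (rPlus a M) τ θ φ) ∈ U :=
    fun τ hτ θ φ => hsub (chart_mem_futureRegion hr hτ θ φ)
  have hrhoMode : ∀ t, rhoMode a M ι ζ S t
      = sphereIntegral (scal (height a M ι ζ (rPlus a M)) (rPlus a M) S.rho t) := fun _ => rfl
  have hsigmaMode : ∀ t, sigmaMode a M ι ζ S t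
      = sphereIntegral (scal (height a M ι ζ (rPlus a M)) (rPlus a M) S.sigma t) := fun _ => rfl
  simp only [hrhoMode, hsigmaMode]
  -- The geometry has been used up: from here on only M ≤ r, a² ≤ r² and the equations in terms of
  -- jets matter.
  generalize height a M ι ζ (rPlus a M) = k at *
  generalize rPlus a M = r at *
  have jR := isHorizonJet_scal hU hrho hmem
  have jS := isHorizonJet_scal hU hsig hmem
  have jT := isHorizonJet_alT (a := a) hU hal hmem
  have jW := isHorizonJet_alW (a := a) hU hal hmem
  have hdn := continuousOn_fluxDensity (a := a) hr hU hal hmem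
  have htr : ContinuousOn (fun x : ℝ × ℝ × ℝ => (fun τ θ φ => 1 / 2 *
      (gradSq a k r S.rho τ θ φ + gradSq a k r S.sigma τ θ φ)) x.1 x.2.1 x.2.2) {x | 0 ≤ x.1} :=
    continuousOn_const.mul ((continuousOn_gradSq hr hU hrho hmem).add
      (continuousOn_gradSq hr hU hsig hmem))
  have htrans' : Tendsto (fun s => sphereIntegral ((fun τ θ φ => 1 / 2 *
      (gradSq a k r S.rho τ θ φ + gradSq a k r S.sigma τ θ φ)) s)) atTop (𝓝 0) :=
    htrans.congr' ((eventually_ge_atTop 0).mono fun t ht => hT t ht)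
  have hflux' : ∀ τ : ℝ, 0 ≤ τ → ∫⁻ s in Ioi τ,
      ENNReal.ofReal (sphereIntegral (fluxDensity a k r S.al s))
        ≤ ENNReal.ofReal (D / (1 + τ) ^ (1 + p)) := fun τ hτ => hF τ hτ ▸ hflux τ hτ
  -- The rotation (c, d) preserves lengths, so |e₄ρ̂|² + |e₄σ̂|² = |div(Σα)|² + |curl(Σα)|². The
  -- constant becomes uniform in `a` because r₊ ≥ M.
  have hgen : ∀ τ, 0 ≤ τ → ∀ θ ∈ Ioo 0 Real.pi, ∀ φ,
      genDeriv a r (scalT k r S.rho) (scalPhi k r S.rho) τ θ φ ^ 2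
        + genDeriv a r (scalT k r S.sigma) (scalPhi k r S.sigma) τ θ φ ^ 2
        ≤ fluxConst M * fluxDensity a k r S.al τ θ φ := by
    intro τ hτ θ hθ φ
    obtain ⟨e1, e2⟩ := heqs τ θ hτ hθ φ
    have hcd := cH_sq_add_dH_sq (a := a) hr θ
    have h1 : genDeriv a r (scalT k r S.rho) (scalPhi k r S.rho) τ θ φ ^ 2
        + genDeriv a r (scalT k r S.sigma) (scalPhi k r S.sigma) τ θ φ ^ 2
        = divSig a k r S.al τ θ φ ^ 2 + curlSig a k r S.al τ θ φ ^ 2 := by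
      rw [← neg_sq (curlSig a k r S.al τ θ φ), ← e1, ← e2]
      generalize genDeriv a r (scalT k r S.rho) (scalPhi k r S.rho) τ θ φ = x
      generalize genDeriv a r (scalT k r S.sigma) (scalPhi k r S.sigma) τ θ φ = y
      linear_combination (-(x ^ 2 + y ^ 2)) * hcd
    rw [h1]
    refine (divSig_sq_add_curlSig_sq_le hr har τ θ φ).trans ?_
    unfold fluxConst
    have := fluxDensity_nonneg (a := a) k r S.al τ θ φ
    gcongr
  have hgenR := fun τ hτ θ hθ φ => (le_add_of_nonneg_right (sq_nonneg _)).trans (hgen τ hτ θ hθ φ)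
  have hgenS := fun τ hτ θ hθ φ => (le_add_of_nonneg_left (sq_nonneg _)).trans (hgen τ hτ θ hθ φ)
  have hK := (fluxConst_pos (M := M)).le
  have hTW := alT_sq_add_alW_sq_le (a := a) (k := k) hr har S.al
  have hWle : ∀ τ θ φ, r ^ 2 * alW a k r S.al τ θ φ ^ 2 ≤ 2 * fluxDensity a k r S.al τ θ φ :=
    fun τ θ φ => (mul_le_mul_of_nonneg_left (le_add_of_nonneg_left (sq_nonneg _))
      (sq_nonneg r)).trans (hTW τ θ φ)
  have hTle : ∀ τ θ φ, r ^ 2 * alT k r S.al τ θ φ ^ 2 ≤ 2 * fluxDensity a k r S.al τ θ φ :=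
    fun τ θ φ => (mul_le_mul_of_nonneg_left (le_add_of_nonneg_right (sq_nonneg _))
      (sq_nonneg r)).trans (hTW τ θ φ)
  have hpi : ∀ x : ℝ, 4 * Real.pi * (1 / (8 * Real.pi) * x) = x / 2 := fun x => by
    field_simp
    ring
  refine ⟨⟨abs_sphereIntegral_sub_le hr jR hdn hK hD hp hgenR hflux' le_rfl hτ,
    abs_sphereIntegral_sub_le hr jS hdn hK hD hp hgenS hflux' le_rfl hτ⟩, ?_, ?_⟩
  · have h := abs_charge_sub_le hr har jR jS jT jW (fb := alWb a k r S.al)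
      (alWφ_eq a k r S.al) (fun τ hτ θ hθ φ => (heqs τ θ hτ hθ φ).1) htr hdn
      (fun τ θ φ => scalTheta_sq_le hr har S.rho S.sigma τ θ φ)
      hWle
      hK hD hp hgenR hflux' htrans' hτ
    rw [hpi]
    exact h
  -- The dual case, with R = σ̂, S = -ρ̂, f₁ = -W and f₂ = T: the second inverted equation then
  -- takes the form of the first.
  · have h := abs_charge_sub_le hr har jS jR.neg jW.neg jT (fb := alTb a k r S.al)
      (fun τ θ φ => by rw [alTφ_eq, Pi.neg_apply, Pi.neg_apply, Pi.neg_apply]; ring)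
      (fun τ hτ θ hθ φ => by
        have e := (heqs τ θ hτ hθ φ).2
        rw [genDeriv_neg]
        simp only [Pi.neg_apply, curlSig] at e ⊢
        linarith) htr hdn
      (fun τ θ φ => by
        have := scalTheta_sq_le (a := a) (k := k) hr har S.rho S.sigma τ θ φ
        simp only [Pi.neg_apply, neg_sq]
        linarith)
      hTle
      hK hD hp hgenS hflux' htrans' hτ
    rw [hpi]
    exact h

theorem modes_sub_stationary {S : Fields} (hr : 0 < rPlus a M)
    (hS : IsModifiedSolution a M ι ζ S) (q₁ q₂ : ℝ) {τ : ℝ} (hτ : 0 ≤ τ) :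
    rhoMode a M ι ζ (S - stationary q₁ q₂) τ = rhoMode a M ι ζ S τ - 4 * Real.pi * q₁ ∧
    sigmaMode a M ι ζ (S - stationary q₁ q₂) τ = sigmaMode a M ι ζ S τ - 4 * Real.pi * q₂ := by
  obtain ⟨U, hU, hsub, -, -, hrho, hsig⟩ := hS.smooth
  have hmem : ∀ τ, 0 ≤ τ → ∀ θ φ,
      chart (kerrPoint (height a M ι ζ (rPlus a M)) (rPlus a M) τ θ φ) ∈ U :=
    fun τ hτ θ φ => hsub (chart_mem_futureRegion hr hτ θ φ)
  rw [← sphereIntegral_const q₁, ← sphereIntegral_const q₂]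
  exact ⟨sphereIntegral_sub (continuous_slice (isHorizonJet_scal hU hrho hmem).cont hτ)
      continuous_const,
    sphereIntegral_sub (continuous_slice (isHorizonJet_scal hU hsig hmem).cont hτ)
      continuous_const⟩

theorem modes_zero_sq_le {S : Fields} (hr : 0 < rPlus a M)
    (hS : IsModifiedSolution a M ι ζ S) :
    rhoMode a M ι ζ S 0 ^ 2 ≤ 4 * Real.pi * horizonL2Sq a M ι ζ (S.rho ∘ chart) 0 ∧
    sigmaMode a M ι ζ S 0 ^ 2 ≤ 4 * Real.pi * horizonL2Sq a M ι ζ (S.sigma ∘ chart) 0 := by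
  obtain ⟨U, hU, hsub, -, -, hrho, hsig⟩ := hS.smooth
  have hmem : ∀ τ, 0 ≤ τ → ∀ θ φ,
      chart (kerrPoint (height a M ι ζ (rPlus a M)) (rPlus a M) τ θ φ) ∈ U :=
    fun τ hτ θ φ => hsub (chart_mem_futureRegion hr hτ θ φ)
  rw [horizonL2Sq_eq hr, horizonL2Sq_eq hr]
  exact ⟨sphereIntegral_sq_le (continuous_slice (isHorizonJet_scal hU hrho hmem).cont le_rfl),
    sphereIntegral_sq_le (continuous_slice (isHorizonJet_scal hU hsig hmem).cont le_rfl)⟩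

end

end KerrMaxwell

/-! ### Assembly of the estimates -/

theorem lemma6p4 (M pα : ℝ) (hM : 0 < M) (hpα : 0 < pα) :
    (∀ a : ℝ, |a| ≤ M →
      KerrMaxwell.chargeConstant a M ≠ 0 ∧
      (a ≠ 0 → KerrMaxwell.chargeConstant a M
        = 4 * Real.pi * (2 * Real.arctan (a / KerrMaxwell.rPlus a M) / (a / KerrMaxwell.rPlus a M) - 1)) ∧
      (a = 0 → KerrMaxwell.chargeConstant a M = 4 * Real.pi)) ∧
    ∃ C : ℝ, 0 < C ∧
      ∀ a : ℝ, |a| ≤ M →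
      ∀ ι ζ : ℝ → ℝ, KerrMaxwell.IsStarCutoff a M ι → KerrMaxwell.IsHyperboloidalCutoff M ζ →
      ∃ 𝔮₁ 𝔮₂ : KerrMaxwell.HorizonSeed a M ι ζ → ℝ,
      ∀ 𝔻 : KerrMaxwell.SeedData a M ι ζ → ℝ≥0,
      ∀ S : KerrMaxwell.Fields, KerrMaxwell.IsModifiedSolution a M ι ζ S →
        Filter.Tendsto (KerrMaxwell.transversalL2Sq a M ι ζ S) Filter.atTop (𝓝 0) →
        (∀ τ : ℝ, 0 ≤ τ → KerrMaxwell.alphaFlux a M ι ζ S τ ⊤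
          ≤ ENNReal.ofReal ((𝔻 (S.seed a M ι ζ) : ℝ) / (1 + τ) ^ (1 + pα))) →
        (∀ τ : ℝ, 0 ≤ τ →
          |KerrMaxwell.rhoMode a M ι ζ S τ| ^ 2 + |KerrMaxwell.sigmaMode a M ι ζ S τ| ^ 2
            ≤ C * (KerrMaxwell.horizonL2Sq a M ι ζ (S.rho ∘ KerrMaxwell.chart) 0
                + KerrMaxwell.horizonL2Sq a M ι ζ (S.sigma ∘ KerrMaxwell.chart) 0
                + (𝔻 (S.seed a M ι ζ) : ℝ))) ∧
        (∀ τ : ℝ, 0 ≤ τ →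
          |KerrMaxwell.rhoMode a M ι ζ
              (S - KerrMaxwell.stationary (𝔮₁ (S.seed a M ι ζ).onHorizon)
                (𝔮₂ (S.seed a M ι ζ).onHorizon)) τ| ^ 2
            + |KerrMaxwell.sigmaMode a M ι ζ
              (S - KerrMaxwell.stationary (𝔮₁ (S.seed a M ι ζ).onHorizon)
                (𝔮₂ (S.seed a M ι ζ).onHorizon)) τ| ^ 2
            ≤ C * ((𝔻 (S.seed a M ι ζ) : ℝ) / (1 + τ) ^ pα)) := by
  refine ⟨fun a ha => ⟨KerrMaxwell.chargeConstant_ne_zero hM ha,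
    KerrMaxwell.chargeConstant_of_ne_zero hM, fun h => h ▸ KerrMaxwell.chargeConstant_zero⟩, ?_⟩
  have hK := KerrMaxwell.fluxConst_pos (M := M)
  set L : ℝ := (1 - 2 ^ (-(pα / 2)))⁻¹ ^ 2 * (4 * Real.pi * KerrMaxwell.fluxConst M) with hL
  have hL0 : 0 ≤ L := by positivity
  have hpi := Real.pi_pos
  -- `L` depends on M and pα only, and `L * D / (1 + τ) ^ pα` is the squared decay rate. For (1), x²
  -- ≤ 2y² + 2(x - y)² with y the mean at time 0 and y² ≤ 4π‖·‖² gives 8π‖·‖² + 2LD for each of ρ̂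
  -- and σ̂, hence 8π and 4L in total. For (2), 2L would suffice.
  refine ⟨8 * Real.pi + 4 * L, by positivity, fun a ha ι ζ _ _ =>
    ⟨KerrMaxwell.HorizonSeed.chargeRho, KerrMaxwell.HorizonSeed.chargeSigma,
      fun 𝔻 S hS htrans hflux => ?_⟩⟩
  have hr : 0 < KerrMaxwell.rPlus a M := hM.trans_le KerrMaxwell.rPlus_ge
  have hD : (0 : ℝ) ≤ 𝔻 (S.seed a M ι ζ) := NNReal.coe_nonneg _
  generalize (𝔻 (S.seed a M ι ζ) : ℝ) = D at *
  have hest := fun τ (hτ : 0 ≤ τ) =>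
    KerrMaxwell.modes_estimates (τ := τ) hM ha hpα hD hS htrans hflux hτ
  constructor
  · intro τ hτ
    obtain ⟨⟨h1, h2⟩, -⟩ := hest τ hτ
    obtain ⟨z1, z2⟩ := KerrMaxwell.modes_zero_sq_le hr hS
    have hm := KerrMaxwell.meanRate_sq (M := M) (p := pα) hD (le_refl (0 : ℝ))
    rw [← hL, add_zero, Real.one_rpow, div_one] at hm
    have s1 := sq_le_sq' (neg_le_of_abs_le h1) (le_of_abs_le h1)
    have s2 := sq_le_sq' (neg_le_of_abs_le h2) (le_of_abs_le h2)
    rw [hm] at s1 s2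
    have n1 := nonneg_of_mul_nonneg_right ((sq_nonneg _).trans z1) (by positivity)
    have n2 := nonneg_of_mul_nonneg_right ((sq_nonneg _).trans z2) (by positivity)
    rw [sq_abs, sq_abs]
    -- The square (x - 2y)² is the difference 2y² + 2(x - y)² - x².
    nlinarith [sq_nonneg (KerrMaxwell.rhoMode a M ι ζ S τ - 2 * KerrMaxwell.rhoMode a M ι ζ S 0),
      sq_nonneg (KerrMaxwell.sigmaMode a M ι ζ S τ - 2 * KerrMaxwell.sigmaMode a M ι ζ S 0),
      mul_nonneg hL0 n1, mul_nonneg hL0 n2, mul_nonneg hpi.le hD]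
  · intro τ hτ
    obtain ⟨-, h1, h2⟩ := hest τ hτ
    obtain ⟨m1, m2⟩ := KerrMaxwell.modes_sub_stationary hr hS
      (S.seed a M ι ζ).onHorizon.chargeRho (S.seed a M ι ζ).onHorizon.chargeSigma hτ
    rw [m1, m2]
    have hm := KerrMaxwell.meanRate_sq (M := M) (p := pα) hD hτ
    rw [← hL] at hm
    have s1 := pow_le_pow_left₀ (abs_nonneg _) h1 2
    have s2 := pow_le_pow_left₀ (abs_nonneg _) h2 2
    rw [hm] at s1 s2
    have h0 : 0 ≤ D / (1 + τ) ^ pα := by positivity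
    nlinarith [mul_nonneg hL0 h0, mul_nonneg hpi.le h0]
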